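/- All vector spaces, linear maps and tensor products are over a field $\mathbb F$ of characteristic $0$. For a vector space $M$ with an endomorphism $\partial$, the notation $p(|_{x=\partial}a)$ means that, in the polynomial $p$, the powers $x^n$ are to be replaced by $\partial^n a$; e.g. for $\psi_\lambda=\sum_n\lambda^n\psi_n$ in $M[\lambda]$, $(|_{x=\partial}a)\psi_{\lambda+x}=\sum_n((\lambda+\partial)^n a)\,\psi_n$. **Definitions.** A differential algebra is a commutative associative unital algebra $A$ with a derivation $\partial$; a left $A[\partial]$-module is an $A$-module $M$ with a linear map $\partial$ such that $\partial(am)=(\partial a)m+a\,\partial m$. A *Lie conformal algebra* (LCA) is an $\mathbb F[\partial]$-module $E$ with a bilinear $\lambda$-bracket $E\times E\to E[\lambda]$ such that $[\partial u_\lambda v]=-\lambda[u_\lambda v]$, $[u_\lambda\partial v]=(\partial+\lambda)[u_\lambda v]$, $[v_\lambda u]=-[u_{-\lambda-\partial}v]$ ($\partial$ acting on the coefficients) and $[u_\lambda[v_\mu w]]-[v_\mu[u_\lambda w]]=[[u_\lambda v]_{\lambda+\mu}w]$. A *Poisson vertex algebra* (PVA) is a differential algebra $\mathcal V$ with an LCA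 $\lambda$-bracket such that $\{f_\lambda gh\}=g\{f_\lambda h\}+h\{f_\lambda g\}$. A *module* over it is a left $\mathcal V[\partial]$-module $M$ with a bilinear $\lambda$-action $\mathcal V\times M\to M[\lambda]$ such that $(\partial f)_\lambda m=-\lambda f_\lambda m$, $f_\lambda(\partial m)=(\partial+\lambda)f_\lambda m$, $f_\lambda(g_\mu m)-g_\mu(f_\lambda m)=\{f_\lambda g\}_{\lambda+\mu}m$, $f_\lambda(gm)=\{f_\lambda g\}m+g(f_\lambda m)$ and $(fg)_\lambda m=(|_{x=\partial}f)g_{\lambda+x}m+(|_{x=\partial}g)f_{\lambda+x}m$. A *Lie conformal algebroid* (LCAd) over a differential algebra $A$ is a left $A[\partial]$-module $E$ with an LCA $\lambda$-bracket and a bilinear map $E\times A\to A[\lambda]$, $(u,a)\mapsto\theta(u)_\lambda(a)$ (the anchor), such that $\theta(u)_\lambda(\partial a)=(\partial+\lambda)\theta(u)_\lambda(a)$, $\theta(u)_\lambda(ab)=a\,\theta(u)_\lambda(b)+b\,\theta(u)_\lambda(a)$, $\theta(\partial u)_\lambda=-\lambda\theta(u)_\lambda$, $\theta(au)_\lambda=(|_{x=\partial}a)\theta(u)_{\lambda+x}$,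 $[u_\lambda av]=a[u_\lambda v]+\theta(u)_\lambda(a)v$ and $\theta([u_\lambda v])_\mu(a)=\theta(u)_\lambda(\theta(v)_{\mu-\lambda}(a))-\theta(v)_{\mu-\lambda}(\theta(u)_\lambda(a))$. A *module* over $E$ is a left $A[\partial]$-module $M$ with a bilinear $\lambda$-action $E\times M\to M[\lambda]$ such that $u_\lambda(\partial m)=(\partial+\lambda)u_\lambda m$, $u_\lambda(am)=a(u_\lambda m)+\theta(u)_\lambda(a)m$, $(\partial u)_\lambda m=-\lambda u_\lambda m$, $(au)_\lambda m=(|_{x=\partial}a)u_{\lambda+x}m$ and $[u_\lambda v]_\mu m=u_\lambda(v_{\mu-\lambda}m)-v_{\mu-\lambda}(u_\lambda m)$. For an LCAd $E$ over $A$ and an $E$-module $M$, $C^k(E,M)$ ($k\ge0$) is the space of linear maps $\varphi_{\lambda_1,\dots,\lambda_k}:E^{\otimes k}\to M[\lambda_1,\dots,\lambda_k]/\langle\partial+\lambda_1+\dots+\lambda_k\rangle$ that are skewsymmetric, $\varphi_{\lambda_1,\dots,\lambda_k}(u_1,\dots,u_k)=\mathrm{sign}(\pi)\varphi_{\lambda_{\pi(1)},\dots,\lambda_{\pi(k)}}(u_{\pi(1)},\dots,u_{\pi(k)})$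 for all $\pi\in S_k$, and satisfy for every $i$ that $\varphi_{\lambda_1,\dots,\lambda_k}(\dots,\partial u_i,\dots)=-\lambda_i\varphi_{\lambda_1,\dots,\lambda_k}(\dots,u_i,\dots)$ and $\varphi_{\lambda_1,\dots,\lambda_k}(\dots,au_i,\dots)=(|_{x=\partial}a)\varphi_{\lambda_1,\dots,\lambda_i+x,\dots,\lambda_k}(\dots,u_i,\dots)$. The differential is $$(d\varphi)_{\lambda_1,\dots,\lambda_{k+1}}(u_1,\dots,u_{k+1})=\sum_{i}(-1)^{i+1}{u_i}_{\lambda_i}\big(\varphi_{\lambda_1,\overset{i}{\check\dots},\lambda_{k+1}}(u_1,\overset{i}{\check\dots},u_{k+1})\big)+\sum_{i<j}(-1)^{i+j}\varphi_{\lambda_i+\lambda_j,\lambda_1,\overset{i}{\check\dots}\overset{j}{\check\dots},\lambda_{k+1}}\big([{u_i}_{\lambda_i}u_j],u_1,\overset{i}{\check\dots}\overset{j}{\check\dots},u_{k+1}\big).$$ For a PVA $\mathcal V$ and a module $M$ over it, $\Gamma^k(\mathcal V,M)$ is the space of linear maps $\gamma_{\lambda_1,\dots,\lambda_k}:\mathcal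 V^{\otimes k}\to M[\lambda_1,\dots,\lambda_k]/\langle\partial+\lambda_1+\dots+\lambda_k\rangle$ with the same skewsymmetry, with $\gamma_{\lambda_1,\dots,\lambda_k}(\dots,\partial a_i,\dots)=-\lambda_i\gamma_{\lambda_1,\dots,\lambda_k}(\dots,a_i,\dots)$, and with $\gamma_{\lambda_1,\dots,\lambda_k}(\dots,b_ic_i,\dots)=(|_{x=\partial}b_i)\gamma_{\lambda_1,\dots,\lambda_i+x,\dots,\lambda_k}(\dots,c_i,\dots)+(|_{x=\partial}c_i)\gamma_{\lambda_1,\dots,\lambda_i+x,\dots,\lambda_k}(\dots,b_i,\dots)$; its differential is given by the same formula, with the $\lambda$-bracket and the $\lambda$-action of $\mathcal V$. **Theorem.** Let $\mathcal V$ be a PVA, $M$ a PVA module over $\mathcal V$, and $\Omega(\mathcal V)$ the left $\mathcal V[\partial]$-module of Kähler differentials of $\mathcal V$ over $\mathbb F$, with $\partial(a\,df)=(\partial a)df+a\,d(\partial f)$. There is a unique structure of an LCAd over $\mathcal V$ on $\Omega(\mathcal V)$ with $\theta(df)_\lambda(g)=\{f_\lambda g\}$ and $[df_\lambda dg]=d(\{f_\lambda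 g\})$, and a unique structure of a module over this LCAd on the left $\mathcal V[\partial]$-module $M$ with $(df)_\lambda m=f_\lambda m$, for all $f,g\in\mathcal V$, $m\in M$. With these structures, $(\Gamma^\bullet(\mathcal V,M),d)$ and $(C^\bullet(\Omega(\mathcal V),M),d)$ are well defined complexes, and there is an isomorphism of complexes $$\Phi:(\Gamma^\bullet(\mathcal V,M),d)\xrightarrow{\ \sim\ }(C^\bullet(\Omega(\mathcal V),M),d)$$ such that, for all $k\ge0$, $\gamma\in\Gamma^k(\mathcal V,M)$ and $a_1,u_1,\dots,a_k,u_k\in\mathcal V$, $$\Phi(\gamma)_{\lambda_1,\dots,\lambda_k}(a_1du_1,\dots,a_kdu_k)=(|_{x_1=\partial}a_1)\cdots(|_{x_k=\partial}a_k)\,\gamma_{\lambda_1+x_1,\dots,\lambda_k+x_k}(u_1,\dots,u_k).$$ Hence $\Phi$ induces isomorphisms $H^k_{\rm var}(\mathcal V,M)\cong H^k_{\rm LCAd}(\Omega(\mathcal V),M)$ of the cohomology spaces for all $k\ge0$. -/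

import Mathlib

open scoped TensorProduct Polynomial

noncomputable section

namespace LambdaCalc

/-! ### Polynomials in `λ` with coefficients in a vector space

`M[λ]` is `F[X] ⊗[F] M`, and `M[λ₁, …, λₖ]` is `MvPolynomial (Fin k) F ⊗[F] M`.
Most constructions are made for `S ⊗[F] M`, with `S` any commutative `F`-algebra. -/

section Basic

variable {F : Type*} [Field F]
variable {S : Type*} [CommRing S] [Algebra F S] {S' : Type*} [CommRing S'] [Algebra F S']
variable {E : Type*} [AddCommGroup E] [Module F E]
variable {M : Type*} [AddCommGroup M] [Module F M]
variable {N : Type*} [AddCommGroup N] [Module F N]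

/-- The operator `∂ + s` on `S ⊗ M`, where `∂` acts on the coefficients. -/
def addDer (dM : Module.End F M) (s : S) : S ⊗[F] M →ₗ[S] S ⊗[F] M :=
  s • LinearMap.id + dM.baseChange S

/-- The change of variables `S ⊗ M → S' ⊗ M` given by an algebra homomorphism `S → S'`. -/
def changeVar (M : Type*) [AddCommGroup M] [Module F M] (f : S →ₐ[F] S') :
    S ⊗[F] M →ₗ[F] S' ⊗[F] M :=
  f.toLinearMap.rTensor M

/-- Evaluation of an element of `N[λ]` at `λ = s`. -/
def evalAt (s : S) : F[X] ⊗[F] N →ₗ[F] S ⊗[F] N :=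
  changeVar N (Polynomial.aeval s)

/-- The `S`-bilinear extension `S ⊗ E → S ⊗ M → S ⊗ N` of a map `(u, m) ↦ u_λ m ∈ N[λ]`, evaluated
at `λ = s`: it takes `(p ⊗ u, q ⊗ m)` to `p q (u_s m)`. -/
def extend (b : E →ₗ[F] M →ₗ[F] F[X] ⊗[F] N) (s : S) :
    S ⊗[F] E →ₗ[S] S ⊗[F] M →ₗ[S] S ⊗[F] N :=
  LinearMap.liftBaseChange S
    (((LinearMap.liftBaseChangeEquiv S).restrictScalars F).toLinearMap ∘ₗ
      (LinearMap.compRight F (evalAt s) ∘ₗ b : E →ₗ[F] M →ₗ[F] S ⊗[F] N))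

/-- Substitution `λ ↦ -λ - ∂` in an element `∑ λⁿ cₙ` of `E[λ]`, giving `∑ (-λ - ∂)ⁿ cₙ`. -/
def negSubst (dE : Module.End F E) : F[X] ⊗[F] E →ₗ[F] F[X] ⊗[F] E :=
  TensorProduct.lift <| LinearMap.mk₂ F
    (fun (p : F[X]) (c : E) =>
      (Polynomial.aeval (-(addDer dE (Polynomial.X : F[X]))) p :
        Module.End F[X] (F[X] ⊗[F] E)) (1 ⊗ₜ[F] c))
    (by intros; simp) (by intros; simp)
    (by intros; simp [TensorProduct.tmul_add]) (by intros; simp [TensorProduct.tmul_smul])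

/-- The quotient of `S ⊗ M` by the image of `∂ + s`. -/
abbrev ModRange (dM : Module.End F M) (s : S) := (S ⊗[F] M) ⧸ LinearMap.range (addDer dM s)

/-- A linear map `S ⊗ M → S' ⊗ N` that intertwines `∂ + s` and `∂ + s'` descends to the
quotients by the images of these operators. -/
def mapQuot {dM : Module.End F M} {s : S} {dN : Module.End F N} {s' : S'}
    (f : S ⊗[F] M →ₗ[F] S' ⊗[F] N)
    (hf : ∀ x, f (addDer dM s x) = addDer dN s' (f x)) :
    ModRange dM s →ₗ[F] ModRange dN s' :=
  (Submodule.liftQ ((LinearMap.range (addDer dM s)).restrictScalars F)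
      ((LinearMap.range (addDer dN s')).mkQ.restrictScalars F ∘ₗ f)
      (by
        rintro _ ⟨x, rfl⟩
        simp [hf])) ∘ₗ
    (Submodule.Quotient.restrictScalarsEquiv F (LinearMap.range (addDer dM s))).symm.toLinearMap

@[simp] theorem addDer_tmul (dM : Module.End F M) (s p : S) (m : M) :
    addDer dM s (p ⊗ₜ[F] m) = (s * p) ⊗ₜ m + p ⊗ₜ dM m := by
  simp [addDer, TensorProduct.smul_tmul']

@[simp] theorem changeVar_tmul (f : S →ₐ[F] S') (p : S) (m : M) :
    changeVar M f (p ⊗ₜ[F] m) = f p ⊗ₜ m := by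
  simp [changeVar]

@[simp] theorem evalAt_tmul (s : S) (p : F[X]) (m : N) :
    evalAt s (p ⊗ₜ[F] m) = Polynomial.aeval s p ⊗ₜ m := by
  simp [evalAt]

@[simp] theorem extend_tmul (b : E →ₗ[F] M →ₗ[F] F[X] ⊗[F] N) (s p q : S) (u : E) (m : M) :
    extend b s (p ⊗ₜ[F] u) (q ⊗ₜ[F] m) = p • q • evalAt s (b u m) := by
  simp [extend]

@[simp] theorem mapQuot_mk {dM : Module.End F M} {s : S} {dN : Module.End F N} {s' : S'}
    (f : S ⊗[F] M →ₗ[F] S' ⊗[F] N)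
    (hf : ∀ x, f (addDer dM s x) = addDer dN s' (f x)) (x : S ⊗[F] M) :
    mapQuot f hf (Submodule.Quotient.mk x) = Submodule.Quotient.mk (f x) := by
  rfl

theorem changeVar_addDer (dM : Module.End F M) (f : S →ₐ[F] S') (s : S) (x : S ⊗[F] M) :
    changeVar M f (addDer dM s x) = addDer dM (f s) (changeVar M f x) := by
  induction x with
  | zero => simp
  | tmul p m => simp
  | add x y hx hy => simp [hx, hy]

end Basic

/-! ### Lambda-products, Lie conformal algebras -/

section LCA

variable {F : Type*} [Field F]
variable {S : Type*} [CommRing S] [Algebra F S]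
variable {E : Type*} [AddCommGroup E] [Module F E]
variable {M : Type*} [AddCommGroup M] [Module F M]

/-- A sesquilinear map `E × M → M[λ]`, `(u, m) ↦ u_λ m`, where `∂` acts on `E` as `dE` and on `M`
as `dM`. -/
structure LambdaProduct (dE : Module.End F E) (dM : Module.End F M) where
  prod : E →ₗ[F] M →ₗ[F] F[X] ⊗[F] M
  sesq_left : ∀ u m, prod (dE u) m = -((Polynomial.X : F[X]) • prod u m)
  sesq_right : ∀ u m, prod u (dM m) = addDer dM (Polynomial.X : F[X]) (prod u m)

/-- A Lie conformal algebra structure on the `F[∂]`-module `(E, dE)`. The Jacobi identity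
`[u_λ [v_μ w]] - [v_μ [u_λ w]] = [[u_λ v]_{λ+μ} w]` is an identity in `E[λ, μ]`, with `λ = X 0`
and `μ = X 1`. -/
structure LieConformalAlgebra (dE : Module.End F E) extends LambdaProduct dE dE where
  skew : ∀ u v, prod v u = -(negSubst dE (prod u v))
  jacobi : ∀ u v w : E,
    let l : MvPolynomial (Fin 2) F := MvPolynomial.X 0
    let m : MvPolynomial (Fin 2) F := MvPolynomial.X 1
    extend prod l (1 ⊗ₜ u) (extend prod m (1 ⊗ₜ v) (1 ⊗ₜ w))
        - extend prod m (1 ⊗ₜ v) (extend prod l (1 ⊗ₜ u) (1 ⊗ₜ w))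
      = extend prod (l + m) (extend prod l (1 ⊗ₜ u) (1 ⊗ₜ v)) (1 ⊗ₜ w)

theorem LambdaProduct.evalAt_sesq {dE : Module.End F E} {dM : Module.End F M}
    (b : LambdaProduct dE dM) (s : S) (u : E) (m : M) :
    evalAt s (b.prod u (dM m)) = addDer dM s (evalAt s (b.prod u m)) := by
  rw [b.sesq_right, evalAt, changeVar_addDer, Polynomial.aeval_X]

theorem LambdaProduct.extend_addDer {dE : Module.End F E} {dM : Module.End F M}
    (b : LambdaProduct dE dM) (s t : S) (u : E) (x : S ⊗[F] M) :
    extend b.prod s (1 ⊗ₜ u) (addDer dM t x)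
      = addDer dM (t + s) (extend b.prod s (1 ⊗ₜ u) x) := by
  induction x with
  | zero => simp
  | tmul p m =>
    simp only [addDer_tmul, map_add, extend_tmul, one_smul, b.evalAt_sesq, map_smul]
    simp only [addDer, LinearMap.add_apply, LinearMap.smul_apply, LinearMap.id_apply, smul_add,
      add_smul, mul_smul, smul_comm p]
    abel
  | add x y hx hy => simp only [map_add, hx, hy]

end LCA

/-! ### Modules over the algebra of differential operators -/

section Diff

variable {F : Type*} [Field F]
variable {S : Type*} [CommRing S] [Algebra F S]
variable {A : Type*} [CommRing A] [Algebra F A]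
variable {M : Type*} [AddCommGroup M] [Module F M] [Module A M] [IsScalarTower F A M]

/-- A left `A[∂]`-module structure on the `A`-module `M`, where `(A, D)` is a differential algebra:
an action of `∂` with `∂ (a m) = (∂ a) m + a (∂ m)`. -/
structure DiffModule (D : Derivation F A A) (M : Type*) [AddCommGroup M] [Module F M]
    [Module A M] [IsScalarTower F A M] where
  der : Module.End F M
  der_smul : ∀ (a : A) (m : M), der (a • m) = D a • m + a • der m

/-- Multiplication of the coefficients of an element of `S ⊗ M` by `a`. -/
def coeffMul (a : A) : S ⊗[F] M →ₗ[F] S ⊗[F] M :=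
  (Algebra.lsmul F F M a).lTensor S

/-- For `h ∈ S ⊗ A` and `m ∈ M`, the element `h · m` of `S ⊗ M`. -/
def mulVec (h : S ⊗[F] A) (m : M) : S ⊗[F] M :=
  ((LinearMap.toSpanSingleton A M m).restrictScalars F).lTensor S h

/-- Let `τ : S → S[x]` be a change of variables, such as `λ ↦ λ + x`. Then `shift D τ a` takes
`p m` to `∑ₙ pₙ (∂ⁿ a) m`, where `τ p = ∑ₙ pₙ xⁿ`: it is the operator
`φ_λ ↦ (|_{x=∂} a) φ_{λ+x}`, where `x` is replaced by `∂` acting on `a` only. -/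
def shift (D : Derivation F A A) (τ : S →ₐ[F] S[X]) (a : A) : S ⊗[F] M →ₗ[F] S ⊗[F] M :=
  TensorProduct.lift
    ((Polynomial.lsum fun n : ℕ =>
      (TensorProduct.mk F S M).compl₂ (Algebra.lsmul F F M ((D : A →ₗ[F] A)^[n] a))) ∘ₗ
      τ.toLinearMap)

/-- The change of variables `λ ↦ λ + x`. -/
def addVar : F[X] →ₐ[F] F[X][X] :=
  Polynomial.aeval (Polynomial.C Polynomial.X + Polynomial.X)

/-- The change of variables `λᵢ ↦ λᵢ + x`, all other `λⱼ` being fixed. -/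
def addVarAt {k : ℕ} (i : Fin k) :
    MvPolynomial (Fin k) F →ₐ[F] (MvPolynomial (Fin k) F)[X] :=
  MvPolynomial.aeval fun j =>
    Polynomial.C (MvPolynomial.X j) + if j = i then Polynomial.X else 0

@[simp] theorem shift_tmul (D : Derivation F A A) (τ : S →ₐ[F] S[X]) (a : A) (p : S) (m : M) :
    shift D τ a (p ⊗ₜ[F] m)
      = (τ p).sum fun n q => q ⊗ₜ[F] ((D : A →ₗ[F] A)^[n] a • m) := by
  simp only [shift, TensorProduct.lift.tmul, LinearMap.comp_apply, Polynomial.lsum_apply,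
    AlgHom.toLinearMap_apply, Polynomial.sum_def, LinearMap.sum_apply]
  rfl


theorem shift_addDer {D : Derivation F A A} (dM : DiffModule D M) (τ : S →ₐ[F] S[X]) (s : S)
    (hs : τ s = Polynomial.C s + Polynomial.X) (a : A) (x : S ⊗[F] M) :
    shift D τ a (addDer dM.der s x) = addDer dM.der s (shift D τ a x) := by
  induction x with
  | zero => simp
  | add x y hx hy => simp only [map_add, hx, hy]
  | tmul p m =>
    let L (m : M) : S[X] →ₗ[F] S ⊗[F] M := Polynomial.lsum fun n : ℕ =>
      (TensorProduct.mk F S M).flip ((D : A →ₗ[F] A)^[n] a • m)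
    have hL (m : M) (q : S[X]) :
        (q.sum fun n r => r ⊗ₜ[F] ((D : A →ₗ[F] A)^[n] a • m)) = L m q := rfl
    have hmon (m : M) (n : ℕ) (r : S) :
        L m (Polynomial.monomial n r) = r ⊗ₜ[F] ((D : A →ₗ[F] A)^[n] a • m) := by
      rw [← hL, Polynomial.sum_monomial_index]
      simp
    have key : ∀ q : S[X], L m ((Polynomial.C s + Polynomial.X) * q) + L (dM.der m) q
        = addDer dM.der s (L m q) := by
      intro q
      induction q using Polynomial.induction_on' with
      | add p q hp hq =>
        rw [mul_add, map_add, map_add, map_add, map_add, ← hp, ← hq]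
        abel
      | monomial n r =>
        rw [add_mul, Polynomial.C_mul_monomial, Polynomial.X_mul_monomial, map_add, hmon, hmon,
          hmon, hmon, addDer_tmul, dM.der_smul, TensorProduct.tmul_add,
          Function.iterate_succ_apply', add_assoc]
        rfl
    rw [addDer_tmul, map_add, shift_tmul, shift_tmul, shift_tmul, hL, hL, hL, map_mul, hs, key]

end Diff

/-! ### Poisson vertex algebras, Lie conformal algebroids and their modules -/

section Structures

variable {F : Type*} [Field F]

/-- A Poisson vertex algebra structure on the commutative algebra `V`: a derivation `∂` and a Lie
conformal algebra `λ`-bracket such that `{f_λ g h} = g {f_λ h} + h {f_λ g}`. -/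
structure PVA (F : Type*) [Field F] (V : Type*) [CommRing V] [Algebra F V] where
  der : Derivation F V V
  lca : LieConformalAlgebra (der : Module.End F V)
  leibniz : ∀ f g h : V,
    lca.prod f (g * h) = coeffMul g (lca.prod f h) + coeffMul h (lca.prod f g)

section

variable {V : Type*} [CommRing V] [Algebra F V]
variable {M : Type*} [AddCommGroup M] [Module F M] [Module V M] [IsScalarTower F V M]

/-- A module structure over the Poisson vertex algebra `P` on the `V[∂]`-module `(M, dM)`: a
`λ`-action of the Lie conformal algebra `V` on `M` satisfying the left and right Leibniz rules. -/
structure PVAModule (P : PVA F V) (dM : DiffModule P.der M) extends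
    LambdaProduct (P.der : Module.End F V) dM.der where
  jacobi : ∀ (f g : V) (m : M),
    let l : MvPolynomial (Fin 2) F := MvPolynomial.X 0
    let μ : MvPolynomial (Fin 2) F := MvPolynomial.X 1
    extend prod l (1 ⊗ₜ f) (extend prod μ (1 ⊗ₜ g) (1 ⊗ₜ m))
        - extend prod μ (1 ⊗ₜ g) (extend prod l (1 ⊗ₜ f) (1 ⊗ₜ m))
      = extend prod (l + μ) (extend P.lca.prod l (1 ⊗ₜ f) (1 ⊗ₜ g)) (1 ⊗ₜ m)
  /-- `f_λ (g m) = {f_λ g} m + g (f_λ m)` -/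
  leibniz_left : ∀ (f g : V) (m : M),
    prod f (g • m) = mulVec (P.lca.prod f g) m + coeffMul g (prod f m)
  /-- `(f g)_λ m = (|_{x=∂} f) g_{λ+x} m + (|_{x=∂} g) f_{λ+x} m` -/
  leibniz_right : ∀ (f g : V) (m : M),
    prod (f * g) m = shift P.der addVar f (prod g m) + shift P.der addVar g (prod f m)

end

section

variable {A : Type*} [CommRing A] [Algebra F A]
variable {E : Type*} [AddCommGroup E] [Module F E] [Module A E] [IsScalarTower F A E]
variable {M : Type*} [AddCommGroup M] [Module F M] [Module A M] [IsScalarTower F A M]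

/-- A Lie conformal algebroid structure over the differential algebra `(A, D)` on the
`A[∂]`-module `(E, dE)`. The anchor is a left `A[∂]`-module homomorphism from `E` to the space of
conformal derivations of `A`, that is, of linear maps `φ_λ : A → A[λ]` such that
`φ_λ(∂ a) = (∂ + λ) φ_λ(a)` and `φ_λ(a b) = a φ_λ(b) + b φ_λ(a)`, with the `A[∂]`-module structure
`(a φ)_λ = (|_{x=∂} a) φ_{λ+x}`, `(∂ φ)_λ = -λ φ_λ`. -/
structure LCAd {D : Derivation F A A} (dE : DiffModule D E) where
  lca : LieConformalAlgebra dE.der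
  /-- The sesquilinearity of `anchor` says that `θ(∂ u)_λ = -λ θ(u)_λ` and
  `θ(u)_λ (∂ a) = (∂ + λ) θ(u)_λ(a)`. -/
  anchor : LambdaProduct dE.der (D : Module.End F A)
  anchor_mul : ∀ (u : E) (a b : A),
    anchor.prod u (a * b) = coeffMul a (anchor.prod u b) + coeffMul b (anchor.prod u a)
  anchor_smul : ∀ (a : A) (u : E) (b : A),
    anchor.prod (a • u) b = shift D addVar a (anchor.prod u b)
  /-- `[u_λ (a v)] = a [u_λ v] + θ(u)_λ(a) v` -/
  bracket_smul : ∀ (u : E) (a : A) (v : E),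
    lca.prod u (a • v) = coeffMul a (lca.prod u v) + mulVec (anchor.prod u a) v
  /-- `θ([u_λ v])_μ(a) = θ(u)_λ(θ(v)_{μ-λ}(a)) - θ(v)_{μ-λ}(θ(u)_λ(a))` -/
  anchor_bracket : ∀ (u v : E) (a : A),
    let l : MvPolynomial (Fin 2) F := MvPolynomial.X 0
    let μ : MvPolynomial (Fin 2) F := MvPolynomial.X 1
    extend anchor.prod μ (extend lca.prod l (1 ⊗ₜ u) (1 ⊗ₜ v)) (1 ⊗ₜ a)
      = extend anchor.prod l (1 ⊗ₜ u) (extend anchor.prod (μ - l) (1 ⊗ₜ v) (1 ⊗ₜ a))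
        - extend anchor.prod (μ - l) (1 ⊗ₜ v) (extend anchor.prod l (1 ⊗ₜ u) (1 ⊗ₜ a))

/-- A module structure over the Lie conformal algebroid `L` on the `A[∂]`-module `(M, dM)`. -/
structure LCAdModule {D : Derivation F A A} {dE : DiffModule D E} (L : LCAd dE)
    (dM : DiffModule D M) extends LambdaProduct dE.der dM.der where
  /-- `u_λ (a m) = a (u_λ m) + θ(u)_λ(a) m` -/
  act_smul : ∀ (u : E) (a : A) (m : M),
    prod u (a • m) = coeffMul a (prod u m) + mulVec (L.anchor.prod u a) m
  /-- `(a u)_λ m = (|_{x=∂} a) u_{λ+x} m` -/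
  smul_act : ∀ (a : A) (u : E) (m : M), prod (a • u) m = shift D addVar a (prod u m)
  /-- `[u_λ v]_μ m = u_λ (v_{μ-λ} m) - v_{μ-λ} (u_λ m)` -/
  bracket_act : ∀ (u v : E) (m : M),
    let l : MvPolynomial (Fin 2) F := MvPolynomial.X 0
    let μ : MvPolynomial (Fin 2) F := MvPolynomial.X 1
    extend prod μ (extend L.lca.prod l (1 ⊗ₜ u) (1 ⊗ₜ v)) (1 ⊗ₜ m)
      = extend prod l (1 ⊗ₜ u) (extend prod (μ - l) (1 ⊗ₜ v) (1 ⊗ₜ m))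
        - extend prod (μ - l) (1 ⊗ₜ v) (extend prod l (1 ⊗ₜ u) (1 ⊗ₜ m))

end

end Structures

/-! ### Cochains -/

section Cochains

variable {F : Type*} [Field F]
variable {E : Type*} [AddCommGroup E] [Module F E]
variable {M : Type*} [AddCommGroup M] [Module F M]

/-- `λ₁ + ⋯ + λₖ` -/
def varSum (F : Type*) [Field F] (k : ℕ) : MvPolynomial (Fin k) F := ∑ i, MvPolynomial.X i

/-- `M[λ₁, …, λₖ] / ⟨∂ + λ₁ + ⋯ + λₖ⟩` -/
abbrev Coeff (dM : Module.End F M) (k : ℕ) := ModRange dM (varSum F k)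

/-- The linear maps `E^{⊗k} → M[λ₁, …, λₖ] / ⟨∂ + λ₁ + ⋯ + λₖ⟩`. -/
abbrev PreCochain (E : Type*) [AddCommGroup E] [Module F E] (dM : Module.End F M) (k : ℕ) :=
  MultilinearMap F (fun _ : Fin k => E) (Coeff dM k)

instance preCochainAddCommGroup (dM : Module.End F M) (k : ℕ) :
    AddCommGroup (PreCochain E dM k) :=
  MultilinearMap.instAddCommGroup

instance preCochainModule (dM : Module.End F M) (k : ℕ) : Module F (PreCochain E dM k) :=
  MultilinearMap.instModule

/-- The substitution `λᵢ ↦ λ_{π(i)}`. -/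
def permCoeff (dM : Module.End F M) {k : ℕ} (π : Equiv.Perm (Fin k)) :
    Coeff dM k →ₗ[F] Coeff dM k :=
  mapQuot (changeVar M (MvPolynomial.rename π)) fun x => by
    rw [changeVar_addDer]
    congr 2
    simpa [varSum] using Equiv.sum_comp π (fun i => (MvPolynomial.X i : MvPolynomial (Fin k) F))

/-- `φ_{λ₁,…,λₖ}(u₁, …, uₖ) = sign(π) φ_{λ_{π(1)},…,λ_{π(k)}}(u_{π(1)}, …, u_{π(k)})` for all
permutations `π`. -/
def IsSkew {dM : Module.End F M} {k : ℕ} (φ : PreCochain E dM k) : Prop :=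
  ∀ (π : Equiv.Perm (Fin k)) (u : Fin k → E),
    φ u = (Equiv.Perm.sign π : ℤ) • permCoeff dM π (φ (u ∘ π))

/-- `φ_{λ₁,…,λₖ}(u₁, …, ∂ uᵢ, …, uₖ) = -λᵢ φ_{λ₁,…,λₖ}(u₁, …, uₖ)` for all `i`. -/
def IsSesquilinear (dE : Module.End F E) {dM : Module.End F M} {k : ℕ}
    (φ : PreCochain E dM k) : Prop :=
  ∀ (i : Fin k) (u : Fin k → E),
    φ (Function.update u i (dE (u i))) = -((MvPolynomial.X i : MvPolynomial (Fin k) F) • φ u)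

section

variable {A : Type*} [CommRing A] [Algebra F A] [Module A M] [IsScalarTower F A M]

/-- The operator `φ_{λ₁,…,λₖ} ↦ (|_{x=∂} a) φ_{λ₁,…,λᵢ+x,…,λₖ}`. -/
def shiftCoeff {D : Derivation F A A} (dM : DiffModule D M) {k : ℕ} (i : Fin k) (a : A) :
    Coeff dM.der k →ₗ[F] Coeff dM.der k :=
  mapQuot (shift D (addVarAt i) a) fun x => by
    apply shift_addDer
    simp [varSum, addVarAt, Finset.sum_add_distrib]

/-- The space `C^k(E, M)` of `k`-cochains of a Lie conformal algebroid, for left `A[∂]`-modules `E`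
and `M`. -/
def lcadCochains [Module A E] [IsScalarTower F A E] {D : Derivation F A A} (dE : DiffModule D E)
    (dM : DiffModule D M) (k : ℕ) : Submodule F (PreCochain E dM.der k) where
  carrier := {φ | IsSesquilinear dE.der φ ∧
    (∀ (i : Fin k) (a : A) (u : Fin k → E),
      φ (Function.update u i (a • u i)) = shiftCoeff dM i a (φ u)) ∧
    IsSkew φ}
  add_mem' := by
    rintro φ ψ ⟨h1, h2, h3⟩ ⟨h1', h2', h3'⟩
    refine ⟨fun i u => ?_, fun i a u => ?_, fun π u => ?_⟩
    · simp [h1 i u, h1' i u]; abel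
    · simp [h2 i a u, h2' i a u]
    · rw [add_apply, add_apply, map_add, smul_add, ← h3, ← h3']
  zero_mem' := ⟨fun i u => by simp, fun i a u => by simp, fun π u => by simp⟩
  smul_mem' := by
    rintro c φ ⟨h1, h2, h3⟩
    refine ⟨fun i u => ?_, fun i a u => ?_, fun π u => ?_⟩
    · simp [h1 i u, smul_comm c]
    · simp [h2 i a u]
    · rw [smul_apply, smul_apply, map_smul, smul_comm, ← h3]

/-- The space `Γ^k(V, M)` of variational `k`-cochains, where `(V, D)` is a differential algebra
and `M` is a left `V[∂]`-module. -/
def pvaCochains {V : Type*} [CommRing V] [Algebra F V] [Module V M] [IsScalarTower F V M]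
    {D : Derivation F V V} (dM : DiffModule D M) (k : ℕ) :
    Submodule F (PreCochain V dM.der k) where
  carrier := {γ | IsSesquilinear (D : Module.End F V) γ ∧
    (∀ (i : Fin k) (b c : V) (u : Fin k → V),
      γ (Function.update u i (b * c)) =
        shiftCoeff dM i b (γ (Function.update u i c))
          + shiftCoeff dM i c (γ (Function.update u i b))) ∧
    IsSkew γ}
  add_mem' := by
    rintro φ ψ ⟨h1, h2, h3⟩ ⟨h1', h2', h3'⟩
    refine ⟨fun i u => ?_, fun i b c u => ?_, fun π u => ?_⟩
    · rw [add_apply, add_apply, h1 i u, h1' i u, smul_add, neg_add]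
    · simp [h2 i b c u, h2' i b c u]; abel
    · rw [add_apply, add_apply, map_add, smul_add, ← h3, ← h3']
  zero_mem' := ⟨fun i u => by simp, fun i b c u => by simp, fun π u => by simp⟩
  smul_mem' := by
    rintro c φ ⟨h1, h2, h3⟩
    refine ⟨fun i u => ?_, fun i a b u => ?_, fun π u => ?_⟩
    · rw [smul_apply, smul_apply, h1 i u, smul_neg, smul_comm c]
    · simp [h2 i a b u]
    · rw [smul_apply, smul_apply, map_smul, smul_comm, ← h3]

end

end Cochains

/-! ### The differential -/

section Differential

variable {F : Type*} [Field F]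
variable {E : Type*} [AddCommGroup E] [Module F E]
variable {M : Type*} [AddCommGroup M] [Module F M]
variable {dE : Module.End F E} {dM : Module.End F M}

/-- The map `q ↦ u_{λᵢ} q`, where the variables of `q` are named `λ₁, …, λ̌ᵢ, …, λ_{k+1}`. -/
def actCoeff (act : LambdaProduct dE dM) {k : ℕ} (i : Fin (k + 1)) :
    E →ₗ[F] Coeff dM k →ₗ[F] Coeff dM (k + 1) where
  toFun u := mapQuot
    ((extend act.prod (MvPolynomial.X i : MvPolynomial (Fin (k + 1)) F)
      (1 ⊗ₜ u)).restrictScalars F ∘ₗ changeVar M (MvPolynomial.rename i.succAbove)) fun x => by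
        simp only [LinearMap.comp_apply, LinearMap.restrictScalars_apply, changeVar_addDer,
          act.extend_addDer]
        congr 2
        simp [varSum, Fin.sum_univ_succAbove _ i, add_comm]
  map_add' u v := by
    refine LinearMap.ext fun x => ?_
    obtain ⟨x, rfl⟩ := Submodule.Quotient.mk_surjective _ x
    simp only [LinearMap.add_apply, mapQuot_mk, LinearMap.comp_apply,
      LinearMap.restrictScalars_apply, TensorProduct.tmul_add, map_add, Submodule.Quotient.mk_add]
  map_smul' c u := by
    refine LinearMap.ext fun x => ?_
    obtain ⟨x, rfl⟩ := Submodule.Quotient.mk_surjective _ x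
    simp only [LinearMap.smul_apply, mapQuot_mk, LinearMap.comp_apply, RingHom.id_apply,
      LinearMap.restrictScalars_apply, TensorProduct.tmul_smul, LinearMap.map_smul_of_tower,
      Submodule.Quotient.mk_smul]

/-- For `i < j` (as positions in `Fin (m + 2)`, `i` being the position of `i.castSucc`), the
substitution `φ_{λ₁,…,λ_{m+1}} ↦ φ_{λᵢ+λⱼ, λ₁, …, λ̌ᵢ, …, λ̌ⱼ, …, λ_{m+2}}`. -/
def mergeVar (m : ℕ) (i : Fin (m + 1)) (j : Fin (m + 2)) :
    MvPolynomial (Fin (m + 1)) F →ₐ[F] MvPolynomial (Fin (m + 2)) F :=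
  MvPolynomial.aeval <| Fin.cons
    (MvPolynomial.X (j.succAbove i) + MvPolynomial.X j)
    (fun t => MvPolynomial.X (j.succAbove (i.succAbove t)))

/-- The substitution `mergeVar` on coefficients. -/
def mergeCoeff (dM : Module.End F M) (m : ℕ) (i : Fin (m + 1)) (j : Fin (m + 2)) :
    Coeff dM (m + 1) →ₗ[F] Coeff dM (m + 2) :=
  mapQuot (changeVar M (mergeVar m i j)) fun x => by
    rw [changeVar_addDer]
    congr 2
    rw [varSum, varSum, map_sum, Fin.sum_univ_succ, Fin.sum_univ_succAbove _ j,
      Fin.sum_univ_succAbove _ i]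
    simp only [mergeVar, MvPolynomial.aeval_X, Fin.cons_zero, Fin.cons_succ]
    ring

/-- The cochain `(u₁, …, u_{k+1}) ↦ uᵢ_{λᵢ} (φ_{λ₁,…,λ̌ᵢ,…,λ_{k+1}}(u₁, …, ǔᵢ, …, u_{k+1}))`. -/
def actTerm (act : LambdaProduct dE dM) {k : ℕ} (i : Fin (k + 1)) (φ : PreCochain E dM k) :
    PreCochain E dM (k + 1) :=
  LinearMap.uncurryMid i
    { toFun := fun u => (actCoeff act i u).compMultilinearMap φ
      map_add' := fun u v => by ext; simp
      map_smul' := fun c u => by ext; simp }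

/-- For `w = ∑ₙ λⁿ wₙ` in `E[λ]`, the map that takes `(u₁, …, ǔᵢ, …, ǔⱼ, …, u_{m+2})` to
`∑ₙ λᵢⁿ φ_{λᵢ+λⱼ, λ₁, …, λ̌ᵢ, …, λ̌ⱼ, …, λ_{m+2}}(wₙ, u₁, …, ǔᵢ, …, ǔⱼ, …, u_{m+2})`. -/
def insertFirst {m : ℕ} (i : Fin (m + 1)) (j : Fin (m + 2)) (φ : PreCochain E dM (m + 1)) :
    F[X] ⊗[F] E →ₗ[F] MultilinearMap F (fun _ : Fin m => E) (Coeff dM (m + 2)) :=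
  TensorProduct.lift <| LinearMap.mk₂ F
    (fun (p : F[X]) (w : E) =>
      (Polynomial.aeval (MvPolynomial.X (j.succAbove i) : MvPolynomial (Fin (m + 2)) F) p •
        mergeCoeff dM m i j).compMultilinearMap (φ.curryLeft w))
    (by intros; ext; simp [add_smul]) (by intros; ext; simp)
    (by intros; ext; simp) (by intros; ext; simp)

/-- The cochain
`(u₁, …, u_{m+2}) ↦ φ_{λᵢ+λⱼ, λ₁, …, λ̌ᵢ, …, λ̌ⱼ, …}([uᵢ_{λᵢ} uⱼ], u₁, …, ǔᵢ, …, ǔⱼ, …, u_{m+2})`. -/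
def bracketTerm (br : LambdaProduct dE dE) {m : ℕ} (i : Fin (m + 1)) (j : Fin (m + 2))
    (φ : PreCochain E dM (m + 1)) : PreCochain E dM (m + 2) :=
  LinearMap.uncurryMid j
    { toFun := fun v => LinearMap.uncurryMid i
        { toFun := fun u => insertFirst i j φ (br.prod u v)
          map_add' := fun u u' => by simp
          map_smul' := fun c u => by simp }
      map_add' := fun v v' => by ext; simp
      map_smul' := fun c v => by ext; simp }

theorem actTerm_apply (act : LambdaProduct dE dM) {k : ℕ} (i : Fin (k + 1))
    (φ : PreCochain E dM k) (u : Fin (k + 1) → E) :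
    actTerm act i φ u = actCoeff act i (u i) (φ fun t => u (i.succAbove t)) := rfl

theorem bracketTerm_apply (br : LambdaProduct dE dE) {m : ℕ} (i : Fin (m + 1)) (j : Fin (m + 2))
    (φ : PreCochain E dM (m + 1)) (u : Fin (m + 2) → E) :
    bracketTerm br i j φ u =
      insertFirst i j φ (br.prod (u (j.succAbove i)) (u j))
        (fun t => u (j.succAbove (i.succAbove t))) := rfl

theorem insertFirst_tmul {m : ℕ} (i : Fin (m + 1)) (j : Fin (m + 2))
    (φ : PreCochain E dM (m + 1)) (p : F[X]) (w : E) (u : Fin m → E) :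
    insertFirst i j φ (p ⊗ₜ w) u =
      Polynomial.aeval (MvPolynomial.X (j.succAbove i) : MvPolynomial (Fin (m + 2)) F) p •
        mergeCoeff dM m i j (φ (Fin.cons w u)) := rfl

/-- The first sum in the differential, `∑ᵢ (-1)^{i+1} uᵢ_{λᵢ} (φ(…))`. (The indices of `Fin`
start from `0`.) -/
def diffAct (act : LambdaProduct dE dM) (k : ℕ) (φ : PreCochain E dM k) :
    PreCochain E dM (k + 1) :=
  ∑ i : Fin (k + 1), (-1 : ℤ) ^ (i : ℕ) • actTerm act i φ

/-- The second sum in the differential, `∑_{i<j} (-1)^{i+j} φ([uᵢ_{λᵢ} uⱼ], …)`; for `k = 0` there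
are no such pairs. -/
def diffBracket (br : LambdaProduct dE dE) :
    (k : ℕ) → PreCochain E dM k → PreCochain E dM (k + 1)
  | 0, _ => 0
  | m + 1, φ => ∑ j : Fin (m + 2), ∑ i : Fin (m + 1),
      if i.castSucc < j then (-1 : ℤ) ^ ((i : ℕ) + (j : ℕ)) • bracketTerm br i j φ else 0

theorem actTerm_linear (act : LambdaProduct dE dM) {k : ℕ} (i : Fin (k + 1)) (c : F)
    (φ ψ : PreCochain E dM k) :
    actTerm act i (c • φ + ψ) = c • actTerm act i φ + actTerm act i ψ := by
  ext u
  simp [actTerm_apply]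

theorem insertFirst_linear {m : ℕ} (i : Fin (m + 1)) (j : Fin (m + 2)) (c : F)
    (φ ψ : PreCochain E dM (m + 1)) (x : F[X] ⊗[F] E) :
    insertFirst i j (c • φ + ψ) x = c • insertFirst i j φ x + insertFirst i j ψ x := by
  induction x with
  | zero => simp
  | tmul p w =>
    ext u
    rw [add_apply, smul_apply, insertFirst_tmul, insertFirst_tmul, insertFirst_tmul, add_apply,
      smul_apply, map_add, map_smul, smul_add, smul_comm c]
  | add x y hx hy =>
    rw [map_add, hx, hy, map_add, map_add, smul_add]
    abel

theorem bracketTerm_linear (br : LambdaProduct dE dE) {m : ℕ} (i : Fin (m + 1)) (j : Fin (m + 2))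
    (c : F) (φ ψ : PreCochain E dM (m + 1)) :
    bracketTerm br i j (c • φ + ψ) = c • bracketTerm br i j φ + bracketTerm br i j ψ := by
  ext u
  simp only [bracketTerm_apply, insertFirst_linear, add_apply, smul_apply]

theorem diff_linear (br : LambdaProduct dE dE) (act : LambdaProduct dE dM) (k : ℕ) (c : F)
    (φ ψ : PreCochain E dM k) :
    diffAct act k (c • φ + ψ) + diffBracket br k (c • φ + ψ)
      = c • (diffAct act k φ + diffBracket br k φ) + (diffAct act k ψ + diffBracket br k ψ) := by
  have h1 : diffAct act k (c • φ + ψ) = c • diffAct act k φ + diffAct act k ψ := by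
    simp only [diffAct, Finset.smul_sum, ← Finset.sum_add_distrib]
    refine Finset.sum_congr rfl fun i _ => ?_
    rw [actTerm_linear, smul_add, smul_comm c]
  have h2 : diffBracket br k (c • φ + ψ) = c • diffBracket br k φ + diffBracket br k ψ := by
    cases k with
    | zero => simp [diffBracket]
    | succ m =>
      simp only [diffBracket, Finset.smul_sum, ← Finset.sum_add_distrib]
      refine Finset.sum_congr rfl fun j _ => Finset.sum_congr rfl fun i _ => ?_
      split_ifs
      · rw [bracketTerm_linear, smul_add, smul_comm c]
      · simp
  rw [h1, h2, smul_add]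
  abel

/-- The differential on cochains defined by a bracket on `E` and an action of `E` on `M`. -/
def differential (br : LambdaProduct dE dE) (act : LambdaProduct dE dM) (k : ℕ) :
    PreCochain E dM k →ₗ[F] PreCochain E dM (k + 1) where
  toFun φ := diffAct act k φ + diffBracket br k φ
  map_add' φ ψ := by simpa using diff_linear br act k 1 φ ψ
  map_smul' c φ := by
    have h0 := diff_linear br act k 1 (0 : PreCochain E dM k) 0
    have h := diff_linear br act k c φ 0
    simp only [smul_zero, add_zero, one_smul, left_eq_add] at h0
    rw [add_zero, h0, add_zero] at h
    exact h

end Differential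

/-! ### Cochain complexes -/

section Complex

universe u v

variable {F : Type u} [Field F] {X : ℕ → Type v} [∀ k, AddCommGroup (X k)] [∀ k, Module F (X k)]

/-- The subspaces `C k` of `X k` form a cochain complex with respect to the maps `d`: these map
`C k` to `C (k + 1)`, and `d ∘ d = 0` on `C k`. -/
structure IsCochainComplex (C : ∀ k, Submodule F (X k)) (d : ∀ k, X k →ₗ[F] X (k + 1)) : Prop where
  map_mem : ∀ k, ∀ φ ∈ C k, d k φ ∈ C (k + 1)
  sq_zero : ∀ k, ∀ φ ∈ C k, d (k + 1) (d k φ) = 0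

/-- The cochain complex `C 0 → C 1 → ⋯` of `F`-vector spaces with differential `d`. -/
def IsCochainComplex.toComplex {C : ∀ k, Submodule F (X k)} {d : ∀ k, X k →ₗ[F] X (k + 1)}
    (h : IsCochainComplex C d) : CochainComplex (ModuleCat.{v} F) ℕ :=
  CochainComplex.of (fun k => ModuleCat.of F (C k))
    (fun k => ModuleCat.ofHom ((d k).restrict (h.map_mem k)))
    (fun k => by
      ext φ
      exact h.sq_zero k φ φ.2)

end Complex

/-! ### Kähler differentials -/

section Kaehler

variable {F : Type*} [Field F] {A : Type*} [CommRing A] [Algebra F A]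
variable {W : Type*} [AddCommGroup W] [Module F W]

/-- The space of linear maps from `A` to `W`, as an `A`-module through `(a φ)(b) = φ(b a)`. -/
def DomHom (F A W : Type*) [Field F] [CommRing A] [Algebra F A] [AddCommGroup W] [Module F W] :=
  A →ₗ[F] W

instance : AddCommGroup (DomHom F A W) := inferInstanceAs (AddCommGroup (A →ₗ[F] W))

instance : Module F (DomHom F A W) := inferInstanceAs (Module F (A →ₗ[F] W))

instance : Module A (DomHom F A W) where
  smul a φ := LinearMap.comp (show A →ₗ[F] W from φ) (LinearMap.mulRight F a)
  one_smul φ := LinearMap.ext fun b => congrArg (show A →ₗ[F] W from φ) (mul_one b)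
  mul_smul a a' φ := LinearMap.ext fun b =>
    congrArg (show A →ₗ[F] W from φ) (show b * (a * a') = b * a * a' from (mul_assoc _ _ _).symm)
  smul_zero _ := rfl
  smul_add _ _ _ := rfl
  add_smul a a' φ := LinearMap.ext fun b =>
    (congrArg (show A →ₗ[F] W from φ) (mul_add b a a')).trans (map_add _ _ _)
  zero_smul φ := LinearMap.ext fun b =>
    (congrArg (show A →ₗ[F] W from φ) (mul_zero b)).trans (map_zero _)

instance : IsScalarTower F A (DomHom F A W) where
  smul_assoc c a φ := LinearMap.ext fun b =>
    (congrArg (show A →ₗ[F] W from φ) (mul_smul_comm c b a)).trans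
      (LinearMap.map_smul (show A →ₗ[F] W from φ) c (b * a))

/-- Evaluation at `1`. -/
def domHomEval : DomHom F A W →ₗ[F] W :=
  (LinearMap.applyₗ (1 : A) : (A →ₗ[F] W) →ₗ[F] W)

/-- The derivation `f ↦ B(·, f)` from `A` to `DomHom F A W`. -/
def flipDerivation (B : A →ₗ[F] A →ₗ[F] W)
    (hB : ∀ a f g, B a (f * g) = B (a * f) g + B (a * g) f) : Derivation F A (DomHom F A W) where
  toLinearMap := (B.flip : A →ₗ[F] A →ₗ[F] W)
  map_one_eq_zero' := LinearMap.ext fun a => by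
    have h := hB a 1 1
    rw [mul_one, mul_one, left_eq_add] at h
    exact h
  leibniz' f g := LinearMap.ext fun a => hB a f g

/-- The linear map `Ω(A) → W` with `a df ↦ B(a, f)`, for a bilinear map `B` such that
`B(a, f g) = B(a f, g) + B(a g, f)`. -/
def kaehlerLift (B : A →ₗ[F] A →ₗ[F] W)
    (hB : ∀ a f g, B a (f * g) = B (a * f) g + B (a * g) f) : Ω[A⁄F] →ₗ[F] W :=
  domHomEval ∘ₗ (flipDerivation B hB).liftKaehlerDifferential.restrictScalars F

theorem kaehlerLift_smul_D (B : A →ₗ[F] A →ₗ[F] W)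
    (hB : ∀ a f g, B a (f * g) = B (a * f) g + B (a * g) f) (a f : A) :
    kaehlerLift B hB (a • KaehlerDifferential.D F A f) = B a f := by
  have h : (flipDerivation B hB).liftKaehlerDifferential (a • KaehlerDifferential.D F A f)
      = a • flipDerivation B hB f := by
    rw [map_smul, Derivation.liftKaehlerDifferential_comp_D]
  change domHomEval ((flipDerivation B hB).liftKaehlerDifferential
    (a • KaehlerDifferential.D F A f)) = _
  rw [h]
  exact congrArg (B.flip f) (one_mul a)

/-- The action of `∂` on the Kähler differentials of a differential algebra:
`∂(a df) = (∂ a) df + a d(∂ f)`. -/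
def kaehlerDer (D : Derivation F A A) : Module.End F Ω[A⁄F] :=
  kaehlerLift
    (LinearMap.mk₂ F (fun a f => D a • KaehlerDifferential.D F A f +
        a • KaehlerDifferential.D F A (D f))
      (by intros; simp only [map_add, add_smul]; abel)
      (by intros; simp only [Derivation.map_smul, smul_assoc, smul_add])
      (by intros; simp only [map_add, smul_add]; abel)
      (by intro c a f; simp only [Derivation.map_smul, smul_add, smul_comm c]))
    (by
      intro a f g
      simp only [LinearMap.mk₂_apply, Derivation.leibniz, smul_add, add_smul, map_add, smul_smul,
        smul_eq_mul]
      simp only [mul_comm, add_assoc, add_left_comm, add_comm])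

theorem kaehlerDer_smul_D (D : Derivation F A A) (a f : A) :
    kaehlerDer D (a • KaehlerDifferential.D F A f) =
      D a • KaehlerDifferential.D F A f + a • KaehlerDifferential.D F A (D f) :=
  kaehlerLift_smul_D _ _ _ _

/-- The left `A[∂]`-module `Ω(A)` of Kähler differentials of the differential algebra `(A, D)`. -/
def kaehlerModule (D : Derivation F A A) : DiffModule D Ω[A⁄F] where
  der := kaehlerDer D
  der_smul b ω := by
    have hω : ω ∈ Submodule.span A (Set.range (KaehlerDifferential.D F A)) := by
      rw [KaehlerDifferential.span_range_derivation]
      trivial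
    induction hω using Submodule.span_induction generalizing b with
    | mem ω h =>
      obtain ⟨f, rfl⟩ := h
      have h := kaehlerDer_smul_D D 1 f
      simp only [one_smul, Derivation.map_one_eq_zero, zero_smul, zero_add] at h
      rw [kaehlerDer_smul_D, h]
    | zero => simp
    | add x y _ _ hx hy =>
      simp only [smul_add, map_add, hx, hy]
      abel
    | smul a x _ hx =>
      rw [smul_smul, hx, hx a, Derivation.leibniz]
      simp only [add_smul, smul_add, smul_smul, smul_eq_mul]
      rw [mul_comm a (D b)]
      abel

end Kaehler

/-! ### The two complexes -/

section Main

universe u v w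

variable {F : Type u} [Field F] {V : Type v} [CommRing V] [Algebra F V]
variable {M : Type w} [AddCommGroup M] [Module F M] [Module V M] [IsScalarTower F V M]

/-- The structure of a Lie conformal algebroid on `Ω(V)` extends the bracket of `V`:
`θ(df)_λ(g) = {f_λ g}` and `[df_λ dg] = d{f_λ g}`. -/
def IsKaehlerLCAd (P : PVA F V) (L : LCAd (kaehlerModule P.der)) : Prop :=
  let d := KaehlerDifferential.D F V
  (∀ f g : V, L.anchor.prod (d f) g = P.lca.prod f g) ∧
  ∀ f g : V, L.lca.prod (d f) (d g) = (d : V →ₗ[F] Ω[V⁄F]).lTensor F[X] (P.lca.prod f g)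

/-- The action of the Lie conformal algebroid `Ω(V)` on `M` extends that of `V`:
`(df)_λ m = f_λ m`. -/
def IsKaehlerAction {P : PVA F V} {L : LCAd (kaehlerModule P.der)} {dM : DiffModule P.der M}
    (ρ : PVAModule P dM) (R : LCAdModule L dM) : Prop :=
  ∀ (f : V) (m : M), R.prod (KaehlerDifferential.D F V f) m = ρ.prod f m

/-- The subspaces `Γ^k(V, M)` form a complex with respect to the differential. -/
abbrev IsPVAComplex {P : PVA F V} {dM : DiffModule P.der M} (ρ : PVAModule P dM) : Prop :=
  IsCochainComplex (X := fun k => PreCochain V dM.der k) (pvaCochains dM)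
    (differential P.lca.toLambdaProduct ρ.toLambdaProduct)

/-- The variational complex `Γ^•(V, M)` of a Poisson vertex algebra with coefficients in a
module. -/
def pvaComplex {P : PVA F V} {dM : DiffModule P.der M} (ρ : PVAModule P dM)
    (h : IsPVAComplex ρ) : CochainComplex (ModuleCat.{max u v w} F) ℕ :=
  h.toComplex

section

variable {E : Type v} [AddCommGroup E] [Module F E] [Module V E] [IsScalarTower F V E]
variable {D : Derivation F V V} {dE : DiffModule D E} {L : LCAd dE} {dM : DiffModule D M}

/-- The subspaces `C^k(E, M)` form a complex with respect to the differential. -/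
abbrev IsLCAdComplex (R : LCAdModule L dM) : Prop :=
  IsCochainComplex (X := fun k => PreCochain E dM.der k) (lcadCochains dE dM)
    (differential L.lca.toLambdaProduct R.toLambdaProduct)

/-- The complex `C^•(E, M)` of a Lie conformal algebroid with coefficients in a module. -/
def lcadComplex (R : LCAdModule L dM) (h : IsLCAdComplex R) :
    CochainComplex (ModuleCat.{max u v w} F) ℕ :=
  h.toComplex

/-- The component `Γ^k(V, M) → C^k(E, M)` of a morphism of complexes. -/
def component {P : PVA F V} {dM' : DiffModule P.der M} {ρ : PVAModule P dM'}
    {hΓ : IsPVAComplex ρ} {R : LCAdModule L dM} {hC : IsLCAdComplex R}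
    (Φ : pvaComplex ρ hΓ ⟶ lcadComplex R hC) (k : ℕ) :
    pvaCochains dM' k →ₗ[F] lcadCochains dE dM k :=
  (Φ.f k).hom

end

/-- The composition
`(|_{x₁=∂} a₁) ⋯ (|_{xₖ=∂} aₖ) γ_{λ₁+x₁,…,λₖ+xₖ}` of the operators `shiftCoeff dM i (a i)`. -/
def shiftAll {D : Derivation F V V} (dM : DiffModule D M) {k : ℕ} (a : Fin k → V) :
    Module.End F (Coeff dM.der k) :=
  (List.ofFn fun i => shiftCoeff dM i (a i)).prod

end Main

end LambdaCalc

end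

/-! As a V-module, Ω(V) is generated by the differentials df, and the algebroid axioms say how the
anchor, the bracket and the action behave when an argument is multiplied by a ∈ V. This gives
uniqueness at once, and it dictates the formulas for existence. The action is (a df)_λ m = (|_{x=∂}
a) f_{λ+x} m (`kaehlerActProd`), and the anchor is the case M = V. The bracket is built in two
stages: [df_λ b dg] is given by the Leibniz rule (`lieProd`), skewsymmetry turns this into [ω_λ dg],
and a second Leibniz rule gives [ω_λ b dg] (`kaehlerBracketProd`). Each formula respects d(fg) = f
dg + g df because of the Leibniz rules of V and M. The commutator identity for the action survives
multiplication of its second argument by elements of V and, by skewsymmetry, of its first, so it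
needs to be known on differentials only (`kaehler_commutator`), where it is the Jacobi identity of
the module over V. For the bracket itself, linearity is available in the third argument, and the
other arguments are moved there by skewsymmetry (`kaehler_jacobi`).

The map Φ is the inverse of the restriction of cochains along d : V → Ω(V). In each argument,
V-linear maps on Ω(V) correspond to derivations on V by the universal property of Kähler
differentials; this can be used one argument after another because the actions of V attached to
different arguments commute (`exists_mem_linMaps`). Sesquilinearity and skewsymmetry of a V-linear
cochain can be tested on differentials. Restriction commutes with the differentials since d is
compatible with brackets and actions (`differential_compLinearMap`).

It remains to see that C^•(E, M) is a complex for every algebroid E. The formal variables are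
replaced by elements of a commutative algebra S. A pair (s, x) with x ∈ S ⊗ E is regarded as x with
weight s; pairs have the bracket (s + t, [x_s y]) and act on the product over t of the quotients (S
⊗ M)/(∂ + t). A cochain becomes an ordinary function of such pairs, and its differential becomes the
Chevalley–Eilenberg differential (`cochainFun_differential`). There d is determined by Cartan's
formula ι_y d = L_y − d ι_y, and d² = 0 and the preservation of skewsymmetry follow from Cartan
calculus (`CE.diff_diff`, `CE.IsSkewFun.diff`). The bracket of pairs is skewsymmetric only modulo
elements (∂ + s) x of weight s, but sesquilinear cochains vanish on these. Taking S to be the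
polynomial algebra and the weights to be the variables recovers the statements about cochains.

Finally dφ is linear over V: by skewsymmetry the first argument is enough, and there the term in
which u_j acts on the coefficient a cancels the term that [a u_1, u_j] adds to the multiple of [u_1,
u_j] (`isLinearAt_zero_differential`). -/

noncomputable section

namespace LambdaCalc

/-! ### Induction principles for S ⊗ M and naturality in S. -/

section Toolkit

variable {F : Type*} [Field F]
variable {S : Type*} [CommRing S] [Algebra F S] {S' : Type*} [CommRing S'] [Algebra F S']
variable {E : Type*} [AddCommGroup E] [Module F E]
variable {M : Type*} [AddCommGroup M] [Module F M]
variable {N : Type*} [AddCommGroup N] [Module F N]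

/-- A predicate on `S ⊗ M` that holds for `1 ⊗ m` and is preserved by sums and by the
multiplication with elements of `F` and of a set of generators of the algebra `S` holds
everywhere. -/
theorem tensor_induction_adjoin {G : Set S} (hG : Algebra.adjoin F G = ⊤)
    {p : S ⊗[F] M → Prop} (one : ∀ m, p (1 ⊗ₜ m)) (add : ∀ x y, p x → p y → p (x + y))
    (gen : ∀ g ∈ G, ∀ x, p x → p (g • x)) (x : S ⊗[F] M) : p x := by
  have zero : p 0 := by simpa using one 0
  have key : ∀ s : S, ∀ m : M, p (s ⊗ₜ m) := by
    intro s
    have hs : s ∈ Submodule.span F (Submonoid.closure G : Set S) := by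
      rw [← Algebra.adjoin_eq_span, hG]; trivial
    have hmon : ∀ s ∈ Submonoid.closure G, ∀ m : M, p (s ⊗ₜ m) := by
      intro s hs
      induction hs using Submonoid.closure_induction_left with
      | one => exact one
      | mul_left g hg s _ ih => exact fun m => gen g hg _ (ih m)
    induction hs using Submodule.span_induction with
    | mem s hs => exact hmon s hs
    | zero => intro m; simpa using zero
    | add s t _ _ hs ht => intro m; rw [TensorProduct.add_tmul]; exact add _ _ (hs m) (ht m)
    | smul c s _ hs =>
      intro m; rw [TensorProduct.smul_tmul]; exact hs _
  induction x with
  | zero => exact zero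
  | tmul s m => exact key s m
  | add x y hx hy => exact add _ _ hx hy

theorem polynomial_tensor_induction {p : F[X] ⊗[F] M → Prop} (one : ∀ m, p (1 ⊗ₜ m))
    (add : ∀ x y, p x → p y → p (x + y))
    (X_smul : ∀ x, p x → p ((Polynomial.X : F[X]) • x)) (x : F[X] ⊗[F] M) : p x :=
  tensor_induction_adjoin (G := {Polynomial.X}) (Polynomial.adjoin_X) one add
    (by rintro _ rfl; exact X_smul) x

theorem addDer_apply (dM : Module.End F M) (s : S) (x : S ⊗[F] M) :
    addDer dM s x = s • x + dM.baseChange S x := rfl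

theorem changeVar_smul (f : S →ₐ[F] S') (p : S) (x : S ⊗[F] M) :
    changeVar M f (p • x) = f p • changeVar M f x := by
  induction x with
  | zero => simp
  | tmul q m => simp [TensorProduct.smul_tmul']
  | add x y hx hy => simp only [smul_add, map_add, hx, hy]

theorem changeVar_changeVar {S'' : Type*} [CommRing S''] [Algebra F S''] (g : S' →ₐ[F] S'')
    (f : S →ₐ[F] S') (x : S ⊗[F] M) :
    changeVar M g (changeVar M f x) = changeVar M (g.comp f) x := by
  induction x with
  | zero => simp
  | tmul q m => simp
  | add x y hx hy => simp only [map_add, hx, hy]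

theorem changeVar_id (x : S ⊗[F] M) : changeVar M (AlgHom.id F S) x = x := by
  induction x with
  | zero => simp
  | tmul q m => simp
  | add x y hx hy => simp only [map_add, hx, hy]

theorem changeVar_evalAt (f : S →ₐ[F] S') (s : S) (x : F[X] ⊗[F] M) :
    changeVar M f (evalAt s x) = evalAt (f s) x := by
  rw [evalAt, evalAt, changeVar_changeVar]
  congr 2
  ext
  simp

theorem evalAt_smul (s : S) (p : F[X]) (x : F[X] ⊗[F] M) :
    evalAt s (p • x) = Polynomial.aeval s p • evalAt s x := changeVar_smul _ _ _

theorem evalAt_addDer (dM : Module.End F M) (s : S) (p : F[X]) (x : F[X] ⊗[F] M) :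
    evalAt s (addDer dM p x) = addDer dM (Polynomial.aeval s p) (evalAt s x) :=
  changeVar_addDer _ _ _ _

/-- Naturality in S allows an identity proved over F[λ, μ] to be specialised to arbitrary elements
of any commutative algebra. -/
theorem changeVar_extend (b : E →ₗ[F] M →ₗ[F] F[X] ⊗[F] N) (f : S →ₐ[F] S') (s : S)
    (x : S ⊗[F] E) (y : S ⊗[F] M) :
    changeVar N f (extend b s x y) = extend b (f s) (changeVar E f x) (changeVar M f y) := by
  induction x with
  | zero => simp
  | add x x' hx hx' => simp only [map_add, LinearMap.add_apply, hx, hx']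
  | tmul p u =>
    induction y with
    | zero => simp
    | add y y' hy hy' => simp only [map_add, hy, hy']
    | tmul q m => simp only [extend_tmul, changeVar_smul, changeVar_evalAt, changeVar_tmul]

@[simp] theorem addDer_smul (dM : Module.End F M) (s p : S) (x : S ⊗[F] M) :
    addDer dM s (p • x) = p • addDer dM s x := map_smul _ _ _

theorem addDer_add_left (dM : Module.End F M) (s t : S) (x : S ⊗[F] M) :
    addDer dM (s + t) x = s • x + addDer dM t x := by
  rw [addDer_apply, addDer_apply, add_smul, add_assoc]

theorem tmul_eq_smul_one_tmul' (p : S) (m : M) : p ⊗ₜ[F] m = p • ((1 : S) ⊗ₜ[F] m) := by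
  simp [TensorProduct.smul_tmul']

theorem tensor_induction_smul {p : S ⊗[F] M → Prop} (one : ∀ m, p (1 ⊗ₜ m))
    (add : ∀ x y, p x → p y → p (x + y)) (smul : ∀ (s : S) x, p x → p (s • x))
    (x : S ⊗[F] M) : p x :=
  tensor_induction_adjoin (G := Set.univ) (Algebra.adjoin_univ F S) one add
    (fun s _ x => smul s x) x

end Toolkit

/-! ### Sesquilinearity for elements of S ⊗ E and S ⊗ M. -/

section Sesquilinear

variable {F : Type*} [Field F]
variable {S : Type*} [CommRing S] [Algebra F S]
variable {E : Type*} [AddCommGroup E] [Module F E]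
variable {M : Type*} [AddCommGroup M] [Module F M]
variable {dE : Module.End F E} {dM : Module.End F M}

theorem LambdaProduct.extend_addDer_right (b : LambdaProduct dE dM) (s t : S) (x : S ⊗[F] E)
    (y : S ⊗[F] M) :
    extend b.prod s x (addDer dM t y) = addDer dM (t + s) (extend b.prod s x y) := by
  induction x using tensor_induction_smul with
  | one u => exact b.extend_addDer s t u y
  | add x x' hx hx' => simp only [map_add, LinearMap.add_apply, hx, hx']
  | smul p x hx => simp only [map_smul, LinearMap.smul_apply, hx]

/-- Since (∂u)_s = −s u_s, the image of ∂ + s acts by zero at weight s. Hence an identity that holds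
only modulo this image, such as the skewsymmetry of the bracket, can still be used under an action.
-/
theorem LambdaProduct.extend_addDer_left (b : LambdaProduct dE dM) (s : S) (x : S ⊗[F] E)
    (y : S ⊗[F] M) : extend b.prod s (addDer dE s x) y = 0 := by
  induction x using tensor_induction_smul with
  | one u =>
    induction y using tensor_induction_smul with
    | one m =>
      rw [addDer_tmul, map_add, LinearMap.add_apply, extend_tmul, extend_tmul, b.sesq_left,
        map_neg, evalAt_smul]
      simp
    | add y y' hy hy' => simp only [map_add, hy, hy', add_zero]
    | smul p y hy => rw [map_smul, hy, smul_zero]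
  | add x x' hx hx' => simp only [map_add, LinearMap.add_apply, hx, hx', add_zero]
  | smul p x hx => rw [addDer_smul, map_smul, LinearMap.smul_apply, hx, smul_zero]

end Sesquilinear

/-! ### The substitution λ ↦ −λ − ∂ and skewsymmetry. -/

section NegSubst

variable {F : Type*} [Field F]
variable {S : Type*} [CommRing S] [Algebra F S]
variable {E : Type*} [AddCommGroup E] [Module F E]
variable (dE : Module.End F E)

theorem negSubst_tmul (p : F[X]) (c : E) :
    negSubst dE (p ⊗ₜ c) = (Polynomial.aeval (-(addDer dE (Polynomial.X : F[X]))) p :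
        Module.End F[X] (F[X] ⊗[F] E)) (1 ⊗ₜ[F] c) := rfl

@[simp] theorem negSubst_one_tmul (c : E) : negSubst dE (1 ⊗ₜ c) = 1 ⊗ₜ c := by
  simp [negSubst_tmul]

/-- With `negSubst_addDer` this says that the substitution exchanges the operators λ and −λ − ∂,
which makes it an involution. -/
theorem negSubst_X_smul (x : F[X] ⊗[F] E) :
    negSubst dE ((Polynomial.X : F[X]) • x)
      = -(addDer dE (Polynomial.X : F[X]) (negSubst dE x)) := by
  induction x with
  | zero => simp
  | add x y hx hy => rw [smul_add, map_add, hx, hy, map_add, map_add, neg_add]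
  | tmul p c =>
    rw [TensorProduct.smul_tmul', negSubst_tmul, negSubst_tmul, smul_eq_mul, map_mul,
      Polynomial.aeval_X]
    rfl

theorem negSubst_addDer (x : F[X] ⊗[F] E) :
    negSubst dE (addDer dE (Polynomial.X : F[X]) x)
      = -((Polynomial.X : F[X]) • negSubst dE x) := by
  induction x using polynomial_tensor_induction with
  | one m =>
    rw [addDer_tmul, map_add, mul_one, ← mul_one Polynomial.X, ← smul_eq_mul,
      ← TensorProduct.smul_tmul', negSubst_X_smul]
    simp [TensorProduct.smul_tmul']
  | add x y hx hy => simp only [map_add, smul_add, neg_add, hx, hy]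
  | X_smul x hx => rw [addDer_smul, negSubst_X_smul, hx, negSubst_X_smul, map_neg, addDer_smul,
      smul_neg]

theorem negSubst_negSubst (x : F[X] ⊗[F] E) : negSubst dE (negSubst dE x) = x := by
  induction x using polynomial_tensor_induction with
  | one m => simp
  | add x y hx hy => simp only [map_add, hx, hy]
  | X_smul x hx => rw [negSubst_X_smul, map_neg, negSubst_addDer, hx, neg_neg]

/-- Modulo the image of ∂ + s + t, the operator −t − ∂ is multiplication by s. -/
theorem evalAt_negSubst (s t : S) (x : F[X] ⊗[F] E) :
    evalAt s x - evalAt t (negSubst dE x) ∈ LinearMap.range (addDer dE (s + t)) := by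
  induction x using polynomial_tensor_induction with
  | one m => simp
  | add x y hx hy =>
    rw [map_add, map_add, map_add, add_sub_add_comm]
    exact add_mem hx hy
  | X_smul x hx =>
    rw [negSubst_X_smul, map_neg, evalAt_addDer, evalAt_smul, Polynomial.aeval_X,
      Polynomial.aeval_X]
    have h := Submodule.smul_mem _ s hx
    have h2 : addDer dE (s + t) (evalAt t (negSubst dE x)) ∈ LinearMap.range (addDer dE (s + t)) :=
      ⟨_, rfl⟩
    have := add_mem h h2
    rw [addDer_add_left, smul_sub] at this
    convert this using 1
    abel

-- Skewsymmetry without an operator substitution: the weights s and t are independent elements of S,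
-- and the price is that the identity holds only modulo ∂ plus the total weight.
variable {dE} in
theorem extend_skew {br : E →ₗ[F] E →ₗ[F] F[X] ⊗[F] E}
    (hbr : ∀ u v, br v u = -(negSubst dE (br u v))) (s t : S) (x y : S ⊗[F] E) :
    extend br s x y + extend br t y x ∈ LinearMap.range (addDer dE (s + t)) := by
  induction x using tensor_induction_smul with
  | one u =>
    induction y using tensor_induction_smul with
    | one v =>
      rw [extend_tmul, extend_tmul, hbr u v, map_neg]
      simpa [sub_eq_add_neg] using evalAt_negSubst dE s t (br u v)
    | add y y' hy hy' =>
      rw [map_add, map_add, LinearMap.add_apply, add_add_add_comm]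
      exact add_mem hy hy'
    | smul p y hy =>
      rw [map_smul, map_smul, LinearMap.smul_apply, ← smul_add]
      exact Submodule.smul_mem _ _ hy
  | add x x' hx hx' =>
    rw [map_add, map_add, LinearMap.add_apply, add_add_add_comm]
    exact add_mem hx hx'
  | smul p y hy =>
    rw [map_smul, map_smul, LinearMap.smul_apply, ← smul_add]
    exact Submodule.smul_mem _ _ hy

end NegSubst

/-! ### Products with coefficients in S ⊗ A and the substitution x = ∂. -/

section Product

variable {F : Type*} [Field F]
variable {S : Type*} [CommRing S] [Algebra F S] {S' : Type*} [CommRing S'] [Algebra F S']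
variable {A : Type*} [CommRing A] [Algebra F A]
variable {M : Type*} [AddCommGroup M] [Module F M] [Module A M] [IsScalarTower F A M]

/-- The `S`-bilinear product `S ⊗ A → S ⊗ M → S ⊗ M`, `(p ⊗ a, q ⊗ m) ↦ p q ⊗ a m`. -/
def coeffProd : S ⊗[F] A →ₗ[S] S ⊗[F] M →ₗ[S] S ⊗[F] M :=
  LinearMap.liftBaseChange S
    ((LinearMap.baseChangeHom F S M M) ∘ₗ (Algebra.lsmul F F M).toLinearMap)

@[simp] theorem coeffProd_tmul (p q : S) (a : A) (m : M) :
    coeffProd (p ⊗ₜ[F] a) (q ⊗ₜ[F] m) = (p * q) ⊗ₜ (a • m) := by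
  simp [coeffProd, TensorProduct.smul_tmul']

theorem coeffMul_tmul (a : A) (q : S) (m : M) :
    coeffMul a (q ⊗ₜ[F] m) = q ⊗ₜ (a • m) := by
  simp [coeffMul]

theorem mulVec_tmul (a : A) (q : S) (m : M) :
    mulVec (q ⊗ₜ[F] a) m = q ⊗ₜ (a • m) := by
  simp [mulVec]

theorem coeffMul_eq (a : A) (x : S ⊗[F] M) : coeffMul a x = coeffProd (1 ⊗ₜ a) x := by
  induction x with
  | zero => simp
  | tmul q m => simp [coeffMul_tmul]
  | add x y hx hy => simp only [map_add, hx, hy]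

theorem mulVec_eq (h : S ⊗[F] A) (m : M) : mulVec h m = coeffProd h (1 ⊗ₜ m) := by
  induction h with
  | zero => simp [mulVec]
  | tmul q a => simp [mulVec_tmul]
  | add x y hx hy => rw [map_add, LinearMap.add_apply, ← hx, ← hy, mulVec, map_add]; rfl

theorem changeVar_coeffProd (f : S →ₐ[F] S') (h : S ⊗[F] A) (x : S ⊗[F] M) :
    changeVar M f (coeffProd h x) = coeffProd (changeVar A f h) (changeVar M f x) := by
  induction h with
  | zero => simp
  | add h h' hh hh' => simp only [map_add, LinearMap.add_apply, hh, hh']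
  | tmul p a =>
    induction x with
    | zero => simp
    | tmul q m => simp
    | add x y hx hy => simp only [map_add, hx, hy]

theorem coeffProd_comm (h g : S ⊗[F] A) (x : S ⊗[F] M) :
    coeffProd h (coeffProd g x) = coeffProd g (coeffProd h x) := by
  induction h with
  | zero => simp
  | add h h' hh hh' => simp only [map_add, LinearMap.add_apply, hh, hh']
  | tmul p a =>
    induction g with
    | zero => simp
    | add h h' hh hh' => simp only [map_add, LinearMap.add_apply, hh, hh']
    | tmul q b =>
      induction x with
      | zero => simp
      | tmul q m => simp [smul_smul, mul_comm, mul_left_comm]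
      | add x y hx hy => simp only [map_add, hx, hy]

theorem coeffProd_coeffProd (h g : S ⊗[F] A) (x : S ⊗[F] M) :
    coeffProd (coeffProd h g) x = coeffProd h (coeffProd g x) := by
  induction h with
  | zero => simp
  | add h h' hh hh' => simp only [map_add, LinearMap.add_apply, hh, hh']
  | tmul p a =>
    induction g with
    | zero => simp
    | add h h' hh hh' => simp only [map_add, LinearMap.add_apply, hh, hh']
    | tmul q b =>
      induction x with
      | zero => simp
      | tmul q m => simp [smul_smul, mul_assoc]
      | add x y hx hy => simp only [map_add, hx, hy]

variable {D : Derivation F A A}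

theorem addDer_coeffProd (dM : DiffModule D M) (s t : S) (h : S ⊗[F] A) (x : S ⊗[F] M) :
    addDer dM.der (s + t) (coeffProd h x)
      = coeffProd (addDer (D : A →ₗ[F] A) s h) x + coeffProd h (addDer dM.der t x) := by
  induction h with
  | zero => simp
  | add h h' hh hh' =>
    simp only [map_add, LinearMap.add_apply, hh, hh']
    abel
  | tmul p a =>
    induction x with
    | zero => simp
    | tmul q m =>
      simp only [coeffProd_tmul, addDer_tmul, dM.der_smul, map_add, LinearMap.add_apply,
        TensorProduct.tmul_add, add_mul, mul_add, TensorProduct.add_tmul, Derivation.coeFn_coe,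
        mul_assoc, mul_left_comm]
      abel
    | add x y hx hy =>
      simp only [map_add, hx, hy]
      abel

/-- For `h ∈ S ⊗ A` and `w = ∑ xⁿ wₙ` with `wₙ ∈ S ⊗ M`, the element `∑ (∂ⁿ h) wₙ`, where `∂` acts
on the factor `A`. -/
def substDer (D : Derivation F A A) (h : S ⊗[F] A) : S[X] ⊗[F] M →ₗ[S] S ⊗[F] M :=
  TensorProduct.AlgebraTensorModule.lift
    { toFun := fun q =>
        { toFun := fun m => coeffProd
            ((Polynomial.aeval ((D : A →ₗ[F] A).baseChange S) q : Module.End S (S ⊗[F] A)) h)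
            (1 ⊗ₜ m)
          map_add' := fun m m' => by rw [TensorProduct.tmul_add, map_add]
          map_smul' := fun c m => by
            rw [TensorProduct.tmul_smul, LinearMap.map_smul_of_tower, RingHom.id_apply] }
      map_add' := fun q q' => by ext m; simp
      map_smul' := fun p q => by ext m; simp }

theorem substDer_tmul (h : S ⊗[F] A) (q : S[X]) (m : M) :
    substDer D h (q ⊗ₜ[F] m) = coeffProd
      ((Polynomial.aeval ((D : A →ₗ[F] A).baseChange S) q : Module.End S (S ⊗[F] A)) h)
      (1 ⊗ₜ m) := rfl

@[simp] theorem substDer_one_tmul (h : S ⊗[F] A) (m : M) :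
    substDer D h (1 ⊗ₜ[F] m) = coeffProd h (1 ⊗ₜ m) := by
  simp [substDer_tmul]

theorem substDer_X_smul (h : S ⊗[F] A) (w : S[X] ⊗[F] M) :
    substDer D h ((Polynomial.X : S[X]) • w)
      = substDer D ((D : A →ₗ[F] A).baseChange S h) w := by
  induction w with
  | zero => simp
  | add x y hx hy => simp only [smul_add, map_add, hx, hy]
  | tmul q m =>
    rw [TensorProduct.smul_tmul', substDer_tmul, substDer_tmul, smul_eq_mul, mul_comm, map_mul,
      Polynomial.aeval_X]
    rfl

theorem substDer_C_smul (h : S ⊗[F] A) (p : S) (w : S[X] ⊗[F] M) :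
    substDer D h ((Polynomial.C p : S[X]) • w) = p • substDer D h w := by
  rw [← map_smul]
  congr 1
  induction w with
  | zero => simp
  | add x y hx hy => simp only [smul_add, hx, hy]
  | tmul q m =>
    rw [TensorProduct.smul_tmul', TensorProduct.smul_tmul', smul_eq_mul, Polynomial.smul_eq_C_mul]

theorem substDer_add_left (h g : S ⊗[F] A) (w : S[X] ⊗[F] M) :
    substDer D (h + g) w = substDer D h w + substDer D g w := by
  induction w with
  | zero => simp
  | add x y hx hy =>
    simp only [map_add, hx, hy]
    abel
  | tmul q m => simp only [substDer_tmul, map_add, LinearMap.add_apply]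

theorem substDer_smul_left (p : S) (h : S ⊗[F] A) (w : S[X] ⊗[F] M) :
    substDer D (p • h) w = p • substDer D h w := by
  induction w with
  | zero => simp
  | add x y hx hy => simp only [map_add, smul_add, hx, hy]
  | tmul q m => simp only [substDer_tmul, map_smul, LinearMap.smul_apply]

/-- An induction principle for `S[x] ⊗ M`. -/
theorem polynomial_tensor_induction' {p : S[X] ⊗[F] M → Prop}
    (one : ∀ m : M, p ((1 : S[X]) ⊗ₜ[F] m))
    (add : ∀ x y, p x → p y → p (x + y))
    (C_smul : ∀ (s : S) x, p x → p ((Polynomial.C s : S[X]) • x))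
    (X_smul : ∀ x, p x → p ((Polynomial.X : S[X]) • x)) (x : S[X] ⊗[F] M) : p x := by
  refine tensor_induction_adjoin (G := Set.range Polynomial.C ∪ {Polynomial.X}) ?_ one add ?_ x
  · rw [eq_top_iff]
    intro q _
    induction q using Polynomial.induction_on with
    | C a => exact Algebra.subset_adjoin (Or.inl ⟨a, rfl⟩)
    | add p q hp hq => exact add_mem (hp trivial) (hq trivial)
    | monomial n a _ =>
      exact mul_mem (Algebra.subset_adjoin (Set.mem_union_left _ ⟨a, rfl⟩))
        (pow_mem (Algebra.subset_adjoin (Set.mem_union_right _ (Set.mem_singleton _))) _)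
  · rintro _ (⟨s, rfl⟩ | rfl)
    · exact C_smul s
    · exact X_smul

/-- The inclusion `S ⊗ M → S[x] ⊗ M`. -/
abbrev inclC (S : Type*) [CommRing S] [Algebra F S] (M : Type*) [AddCommGroup M] [Module F M] :
    S ⊗[F] M →ₗ[F] S[X] ⊗[F] M :=
  changeVar M (Polynomial.CAlgHom : S →ₐ[F] S[X])

/-- The change of variables `x ↦ x + s` of `S[x]`. -/
def translate (s : S) : S[X] →ₐ[F] S[X] :=
  (Polynomial.aeval (Polynomial.X + Polynomial.C s : S[X]) : S[X] →ₐ[S] S[X]).restrictScalars F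

@[simp] theorem translate_C (s p : S) : translate (F := F) s (Polynomial.C p) = Polynomial.C p := by
  simp [translate]

@[simp] theorem translate_X (s : S) :
    translate (F := F) s Polynomial.X = Polynomial.X + Polynomial.C s := by
  simp [translate]

theorem translate_comp_CAlgHom (s : S) :
    (translate s).comp (Polynomial.CAlgHom : S →ₐ[F] S[X]) = Polynomial.CAlgHom :=
  AlgHom.ext fun p => translate_C (F := F) s p

/-- A shift splits into a change of variables, which is an algebra homomorphism, and the
substitution x = ∂, which is governed by its rules on generators of S[x]. -/
theorem shift_eq_substDer (τ : S →ₐ[F] S[X]) (a : A) (x : S ⊗[F] M) :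
    shift D τ a x = substDer D (1 ⊗ₜ a) (changeVar M τ x) := by
  have hpow : ∀ n : ℕ, (((D : A →ₗ[F] A).baseChange S) ^ n) ((1 : S) ⊗ₜ[F] a)
      = 1 ⊗ₜ ((D : A →ₗ[F] A)^[n] a) := by
    intro n
    induction n with
    | zero => simp
    | succ n ih => rw [pow_succ', Module.End.mul_apply, ih, Function.iterate_succ_apply']; simp
  induction x with
  | zero => simp
  | add x y hx hy => simp only [map_add, hx, hy]
  | tmul p m =>
    rw [shift_tmul, changeVar_tmul, substDer_tmul, Polynomial.aeval_def, Polynomial.eval₂_eq_sum,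
      Polynomial.sum_def, Polynomial.sum_def, LinearMap.sum_apply, map_sum, LinearMap.sum_apply]
    refine Finset.sum_congr rfl fun n _ => ?_
    rw [Module.End.mul_apply, hpow]
    simp [TensorProduct.smul_tmul']

theorem changeVar_substDer (f : S →ₐ[F] S') (a : A) (w : S[X] ⊗[F] M) :
    changeVar M f (substDer D (1 ⊗ₜ a) w)
      = substDer D (1 ⊗ₜ a) (changeVar M (Polynomial.mapAlgHom f) w) := by
  induction w using polynomial_tensor_induction' generalizing a with
  | one m => simp
  | add x y hx hy => simp only [map_add, hx, hy]
  | C_smul p x hx =>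
    rw [substDer_C_smul, changeVar_smul, hx, changeVar_smul]
    simp [substDer_C_smul]
  | X_smul x hx =>
    rw [changeVar_smul, substDer_X_smul]
    have := hx (D a)
    simp [substDer_X_smul, this]

end Product

/-! ### The Leibniz rules of an algebroid for elements of S ⊗ E, S ⊗ A and S ⊗ M. -/

section Algebroid

variable {F : Type*} [Field F]
variable {S : Type*} [CommRing S] [Algebra F S]
variable {A : Type*} [CommRing A] [Algebra F A]
variable {E : Type*} [AddCommGroup E] [Module F E]
variable {M : Type*} [AddCommGroup M] [Module F M] [Module A M] [IsScalarTower F A M]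

/-- The rule `u_λ (a m) = a (u_λ m) + θ(u)_λ(a) m`, for elements of `S ⊗ E`, `S ⊗ A` and `S ⊗ M`. -/
theorem extend_coeffProd {act : E →ₗ[F] M →ₗ[F] F[X] ⊗[F] M} {θ : E →ₗ[F] A →ₗ[F] F[X] ⊗[F] A}
    (hact : ∀ u (a : A) m, act u (a • m) = coeffMul a (act u m) + mulVec (θ u a) m)
    (s : S) (x : S ⊗[F] E) (h : S ⊗[F] A) (y : S ⊗[F] M) :
    extend act s x (coeffProd h y)
      = coeffProd h (extend act s x y) + coeffProd (extend θ s x h) y := by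
  induction x using tensor_induction_smul with
  | add x x' hx hx' =>
    simp only [map_add, LinearMap.add_apply, hx, hx']
    abel
  | smul p x hx => simp only [map_smul, LinearMap.smul_apply, smul_add, hx]
  | one u =>
    induction h using tensor_induction_smul with
    | add h h' hh hh' =>
      simp only [map_add, LinearMap.add_apply, hh, hh']
      abel
    | smul p x hx => simp only [map_smul, LinearMap.smul_apply, smul_add, hx]
    | one a =>
      induction y using tensor_induction_smul with
      | add h h' hh hh' =>
        simp only [map_add, hh, hh']
        abel
      | smul p x hx => simp only [map_smul, smul_add, hx]
      | one m =>
        rw [coeffProd_tmul, mul_one, extend_tmul, hact, coeffMul_eq, mulVec_eq, map_add]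
        simp only [evalAt, changeVar_coeffProd, changeVar_tmul, map_one, one_smul, extend_tmul]

variable {D : Derivation F A A}

/-- The rule `u_λ ((|_{x=∂} h) w_x) = (|_{x=∂} h) (u_λ w_x) + (|_{x=∂} θ(u)_λ(h)) w_{x+λ}`. -/
theorem extend_substDer {dE : Module.End F E} {dM : DiffModule D M}
    (act : LambdaProduct dE dM.der) (θ : LambdaProduct dE (D : Module.End F A))
    (hact : ∀ u (a : A) m,
      act.prod u (a • m) = coeffMul a (act.prod u m) + mulVec (θ.prod u a) m)
    (s : S) (x : S ⊗[F] E) (h : S ⊗[F] A) (w : S[X] ⊗[F] M) :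
    extend act.prod s x (substDer D h w)
      = substDer D h (extend act.prod (Polynomial.C s) (inclC S E x) w)
        + substDer D (extend θ.prod s x h) (changeVar M (translate s) w) := by
  induction w using polynomial_tensor_induction' generalizing h with
  | one m =>
    have h1 : ∀ y : S ⊗[F] M, substDer D h (inclC S M y) = coeffProd h y := by
      intro y
      induction y using tensor_induction_smul with
      | one m => simp
      | add x y hx hy => simp only [map_add, hx, hy]
      | smul p x hx => simp only [changeVar_smul, Polynomial.CAlgHom_apply, substDer_C_smul, hx,
          map_smul]
    have h2 : extend act.prod (Polynomial.C s) (inclC S E x) ((1 : S[X]) ⊗ₜ[F] m)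
        = inclC S M (extend act.prod s x (1 ⊗ₜ m)) := by
      rw [changeVar_extend]
      simp
    rw [h2, h1, substDer_one_tmul, extend_coeffProd hact]
    simp
  | add x y hx hy =>
    simp only [map_add, hx, hy]
    abel
  | C_smul p x hx =>
    simp only [substDer_C_smul, map_smul, hx, changeVar_smul, translate_C, smul_add]
  | X_smul x hx =>
    -- Reading ∂ as ∂ + 0 makes the sesquilinearity of θ applicable: θ(x)_s(∂h) = (∂ + s) θ(x)_s(h),
    -- which matches the translation of x by s in the last term.
    have h1 : (D : A →ₗ[F] A).baseChange S h = addDer (D : A →ₗ[F] A) (0 : S) h := by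
      simp [addDer_apply]
    rw [substDer_X_smul, hx, map_smul, substDer_X_smul, changeVar_smul, translate_X, add_smul,
      map_add, substDer_X_smul, substDer_C_smul, h1, θ.extend_addDer_right, zero_add,
      ← substDer_smul_left, ← substDer_add_left, addDer_apply _ s, add_comm (s • _)]

variable [Module A E] [IsScalarTower F A E]

/-- The rule `(a u)_λ m = (|_{x=∂} a) u_{λ+x} m`, for elements of `S ⊗ A`, `S ⊗ E` and `S ⊗ M`. -/
theorem extend_coeffProd_left {act : E →ₗ[F] M →ₗ[F] F[X] ⊗[F] M}
    (hact : ∀ (a : A) u m, act (a • u) m = shift D addVar a (act u m))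
    (s : S) (h : S ⊗[F] A) (x : S ⊗[F] E) (y : S ⊗[F] M) :
    extend act s (coeffProd h x) y = substDer D h
      (extend act (Polynomial.C s + Polynomial.X) (inclC S E x) (inclC S M y)) := by
  induction x using tensor_induction_smul with
  | add x x' hx hx' => simp only [map_add, LinearMap.add_apply, hx, hx']
  | smul p x hx =>
    simp only [map_smul, LinearMap.smul_apply, hx, changeVar_smul,
      Polynomial.CAlgHom_apply, substDer_C_smul]
  | one u =>
    induction y using tensor_induction_smul with
    | add h h' hh hh' => simp only [map_add, hh, hh']
    | smul p x hx =>
      simp only [map_smul, hx, changeVar_smul, Polynomial.CAlgHom_apply, substDer_C_smul]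
    | one m =>
      induction h using tensor_induction_smul with
      | add h h' hh hh' =>
        simp only [map_add, LinearMap.add_apply, hh, hh', substDer_add_left]
      | smul p x hx => simp only [map_smul, LinearMap.smul_apply, hx, substDer_smul_left]
      | one a =>
        rw [coeffProd_tmul, mul_one, extend_tmul, hact, shift_eq_substDer, evalAt,
          changeVar_substDer, changeVar_changeVar]
        have : (Polynomial.mapAlgHom (Polynomial.aeval s)).comp addVar
            = (Polynomial.aeval (Polynomial.C s + Polynomial.X : S[X]) : F[X] →ₐ[F] S[X]) := by
          ext
          simp [addVar]
        rw [this]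
        simp [evalAt]

end Algebroid


/-! ### Shifts as an action of the differential algebra. -/

section Shift

variable {F : Type*} [Field F]
variable {S : Type*} [CommRing S] [Algebra F S]
variable {A : Type*} [CommRing A] [Algebra F A] {D : Derivation F A A}
variable {M : Type*} [AddCommGroup M] [Module F M] [Module A M] [IsScalarTower F A M]

theorem shift_one_tmul (τ : S →ₐ[F] S[X]) (a : A) (m : M) :
    shift D τ a ((1 : S) ⊗ₜ[F] m) = 1 ⊗ₜ (a • m) := by
  simp [shift_eq_substDer]

/-- A variable that is translated by c x produces the additional term c ∂a. The identities for
shifts are proved by induction on monomials with this recursion. -/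
theorem shift_smul_of_eq {τ : S →ₐ[F] S[X]} {g : S} {c : F}
    (hg : τ g = Polynomial.C g + c • Polynomial.X) (a : A) (x : S ⊗[F] M) :
    shift D τ a (g • x) = g • shift D τ a x + c • shift D τ (D a) x := by
  have h : (c • Polynomial.X : S[X]) = Polynomial.C (algebraMap F S c) * Polynomial.X := by
    rw [← Polynomial.smul_eq_C_mul, algebraMap_smul]
  simp only [shift_eq_substDer]
  rw [changeVar_smul, hg, add_smul, map_add, substDer_C_smul, h, mul_smul, substDer_C_smul,
    substDer_X_smul, algebraMap_smul]
  simp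

theorem shift_add_left (τ : S →ₐ[F] S[X]) (a b : A) (x : S ⊗[F] M) :
    shift D τ (a + b) x = shift D τ a x + shift D τ b x := by
  simp only [shift_eq_substDer, TensorProduct.tmul_add, substDer_add_left]

theorem shift_smul_left (τ : S →ₐ[F] S[X]) (c : F) (a : A) (x : S ⊗[F] M) :
    shift D τ (c • a) x = c • shift D τ a x := by
  simp only [shift_eq_substDer]
  rw [← algebraMap_smul S c (substDer D _ _), ← substDer_smul_left, algebraMap_smul,
    TensorProduct.tmul_smul]

/-- The set of variables `G` generates `S`, and `τ` takes each of them to its sum with a multiple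
of `x`. -/
structure IsTranslation (G : Set S) (τ : S →ₐ[F] S[X]) : Prop where
  adjoin_eq_top : Algebra.adjoin F G = ⊤
  exists_eq : ∀ g ∈ G, ∃ c : F, τ g = Polynomial.C g + c • Polynomial.X

theorem isTranslation_addVar : IsTranslation {(Polynomial.X : F[X])} addVar :=
  ⟨Polynomial.adjoin_X, by rintro _ rfl; exact ⟨1, by simp [addVar]⟩⟩

theorem isTranslation_addVarAt {k : ℕ} (i : Fin k) :
    IsTranslation (Set.range (MvPolynomial.X : Fin k → MvPolynomial (Fin k) F)) (addVarAt i) :=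
  ⟨MvPolynomial.adjoin_range_X, by
    rintro _ ⟨j, rfl⟩
    refine ⟨if j = i then 1 else 0, ?_⟩
    by_cases h : j = i <;> simp [addVarAt, h]⟩

theorem IsTranslation.shift_one {G : Set S} {τ : S →ₐ[F] S[X]} (hτ : IsTranslation G τ)
    (x : S ⊗[F] M) : shift D τ 1 x = x := by
  induction x using tensor_induction_adjoin hτ.adjoin_eq_top with
  | one m => simp [shift_eq_substDer]
  | add x y hx hy => rw [map_add, hx, hy]
  | gen g hg x hx =>
    obtain ⟨c, hc⟩ := hτ.exists_eq g hg
    rw [shift_smul_of_eq hc, hx]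
    simp [shift_eq_substDer]
    -- The remaining term is the shift by ∂1 = 0, which vanishes by homogeneity in the coefficient.
    have := shift_smul_left (D := D) τ 0 0 x
    simpa [shift_eq_substDer] using Or.inr this

/-- Multiplication by a variable produces the shift by ∂(ab), and the Leibniz rule for ∂ splits it
into the two terms produced by the successive shifts. Thus shifts are an action of the algebra A. -/
theorem IsTranslation.shift_mul {G : Set S} {τ : S →ₐ[F] S[X]} (hτ : IsTranslation G τ) (a b : A)
    (x : S ⊗[F] M) : shift D τ (a * b) x = shift D τ a (shift D τ b x) := by
  induction x using tensor_induction_adjoin hτ.adjoin_eq_top generalizing a b with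
  | one m => simp only [shift_one_tmul, mul_smul]
  | add x y hx hy => simp only [map_add, hx, hy]
  | gen g hg x hx =>
    obtain ⟨c, hc⟩ := hτ.exists_eq g hg
    simp only [shift_smul_of_eq hc, hx, map_add, Derivation.leibniz, smul_eq_mul, shift_add_left,
      smul_add, map_smul]
    rw [← hx b, mul_comm b, hx]
    abel

/-- This makes the actions of A that belong to different arguments of a cochain commute. -/
theorem IsTranslation.shift_comm {G : Set S} {τ τ' : S →ₐ[F] S[X]} (hτ : IsTranslation G τ)
    (hτ' : IsTranslation G τ') (a b : A) (x : S ⊗[F] M) :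
    shift D τ a (shift D τ' b x) = shift D τ' b (shift D τ a x) := by
  induction x using tensor_induction_adjoin hτ.adjoin_eq_top generalizing a b with
  | one m => simp only [shift_one_tmul, smul_smul, mul_comm]
  | add x y hx hy => simp only [map_add, hx, hy]
  | gen g hg x hx =>
    obtain ⟨c, hc⟩ := hτ.exists_eq g hg
    obtain ⟨c', hc'⟩ := hτ'.exists_eq g hg
    simp only [shift_smul_of_eq hc, shift_smul_of_eq hc', hx, map_add, map_smul]
    abel

theorem IsTranslation.shift_coeffMul {G : Set S} {τ : S →ₐ[F] S[X]} (hτ : IsTranslation G τ)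
    (a b : A) (x : S ⊗[F] M) :
    shift D τ a (coeffMul b x) = coeffMul b (shift D τ a x) := by
  induction x using tensor_induction_adjoin hτ.adjoin_eq_top generalizing a with
  | one m => simp only [shift_one_tmul, coeffMul_tmul, smul_smul, mul_comm]
  | add x y hx hy => simp only [map_add, hx, hy]
  | gen g hg x hx =>
    obtain ⟨c, hc⟩ := hτ.exists_eq g hg
    simp only [coeffMul_eq, map_smul] at hx ⊢
    simp only [shift_smul_of_eq hc, hx, map_add, map_smul, LinearMap.map_smul_of_tower]

theorem IsTranslation.shift_mulVec {G : Set S} {τ : S →ₐ[F] S[X]} (hτ : IsTranslation G τ)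
    (a : A) (h : S ⊗[F] A) (m : M) :
    shift D τ a (mulVec h m) = mulVec (shift D τ a h) m := by
  simp only [mulVec_eq]
  induction h using tensor_induction_adjoin (M := A) hτ.adjoin_eq_top generalizing a with
  | one b =>
    rw [coeffProd_tmul, mul_one, shift_one_tmul, shift_one_tmul, coeffProd_tmul, smul_smul,
      smul_eq_mul, mul_one]
  | add x y hx hy => simp only [map_add, LinearMap.add_apply, hx, hy]
  | gen g hg x hx =>
    obtain ⟨c, hc⟩ := hτ.exists_eq g hg
    simp only [map_smul, LinearMap.smul_apply, shift_smul_of_eq hc, hx, map_add,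
      LinearMap.add_apply]
    rw [LinearMap.map_smul_of_tower, LinearMap.smul_apply]

theorem shift_X_smul (a : A) (x : F[X] ⊗[F] M) :
    shift D addVar a ((Polynomial.X : F[X]) • x)
      = (Polynomial.X : F[X]) • shift D addVar a x + shift D addVar (D a) x := by
  rw [shift_smul_of_eq (c := 1) (by simp [addVar]), one_smul]

theorem shift_addVar_addDer (dM : DiffModule D M) (a : A) (x : F[X] ⊗[F] M) :
    shift D addVar a (addDer dM.der (Polynomial.X : F[X]) x)
      = addDer dM.der (Polynomial.X : F[X]) (shift D addVar a x) :=
  shift_addDer dM _ _ (by simp [addVar]) a x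

theorem mulVec_smul (p : S) (h : S ⊗[F] A) (m : M) : mulVec (p • h) m = p • mulVec h m := by
  simp only [mulVec_eq, map_smul, LinearMap.smul_apply]

theorem mulVec_add (h h' : S ⊗[F] A) (m : M) :
    mulVec (h + h') m = mulVec h m + mulVec h' m := by
  simp only [mulVec_eq, map_add, LinearMap.add_apply]

theorem mulVec_neg (h : S ⊗[F] A) (m : M) : mulVec (-h) m = -mulVec h m := by
  simp only [mulVec_eq, map_neg, LinearMap.neg_apply]

theorem mulVec_add_right (h : S ⊗[F] A) (m m' : M) :
    mulVec h (m + m') = mulVec h m + mulVec h m' := by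
  simp only [mulVec_eq, map_add, TensorProduct.tmul_add]

theorem mulVec_coeffMul (a : A) (h : S ⊗[F] A) (m : M) :
    mulVec (coeffMul a h) m = coeffMul a (mulVec h m) := by
  simp only [mulVec_eq, coeffMul_eq, coeffProd_coeffProd]

theorem mulVec_smul_right (a : A) (h : S ⊗[F] A) (m : M) :
    mulVec h (a • m) = coeffMul a (mulVec h m) := by
  rw [mulVec_eq, mulVec_eq, coeffMul_eq, coeffProd_comm, coeffProd_tmul, mul_one]

theorem coeffMul_mul (a b : A) (x : S ⊗[F] M) :
    coeffMul (a * b) x = coeffMul a (coeffMul b x) := by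
  rw [coeffMul_eq, coeffMul_eq, coeffMul_eq, ← coeffProd_coeffProd, coeffProd_tmul, mul_one,
    smul_eq_mul]

theorem coeffMul_add_left (a b : A) (x : S ⊗[F] M) :
    coeffMul (a + b) x = coeffMul a x + coeffMul b x := by
  simp only [coeffMul_eq, TensorProduct.tmul_add, map_add, LinearMap.add_apply]

theorem coeffMul_smul_left (c : F) (a : A) (x : S ⊗[F] M) :
    coeffMul (c • a) x = c • coeffMul a x := by
  rw [coeffMul_eq, coeffMul_eq, TensorProduct.tmul_smul, LinearMap.map_smul_of_tower,
    LinearMap.smul_apply]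

theorem addDer_mulVec (dM : DiffModule D M) (s : S) (h : S ⊗[F] A) (m : M) :
    addDer dM.der s (mulVec h m)
      = mulVec (addDer (D : A →ₗ[F] A) s h) m + mulVec h (dM.der m) := by
  have := addDer_coeffProd dM s 0 h ((1 : S) ⊗ₜ[F] m)
  simpa [mulVec_eq] using this

theorem addDer_coeffMul (dM : DiffModule D M) (s : S) (a : A) (x : S ⊗[F] M) :
    addDer dM.der s (coeffMul a x) = coeffMul (D a) x + coeffMul a (addDer dM.der s x) := by
  have := addDer_coeffProd dM 0 s ((1 : S) ⊗ₜ[F] a) x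
  simpa [coeffMul_eq] using this

/-- In −λ − ∂ the derivation also hits the coefficient a, and the shift records exactly this.
Skewsymmetry therefore exchanges the Leibniz rules for the left and the right argument. -/
theorem negSubst_coeffMul (dM : DiffModule D M) (a : A) (x : F[X] ⊗[F] M) :
    negSubst dM.der (coeffMul a x) = shift D addVar a (negSubst dM.der x) := by
  induction x using polynomial_tensor_induction generalizing a with
  | one m => rw [coeffMul_tmul, negSubst_one_tmul, negSubst_one_tmul, shift_one_tmul]
  | add x y hx hy => simp only [map_add, hx, hy]
  | X_smul x hx =>
    rw [coeffMul_eq, map_smul, negSubst_X_smul, negSubst_X_smul, map_neg, shift_addVar_addDer,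
      ← coeffMul_eq, hx]

theorem negSubst_shift (dM : DiffModule D M) (a : A) (x : F[X] ⊗[F] M) :
    negSubst dM.der (shift D addVar a x) = coeffMul a (negSubst dM.der x) := by
  conv_lhs => rw [← negSubst_negSubst dM.der x, ← negSubst_coeffMul, negSubst_negSubst]

end Shift

/-! ### Generation of Ω(A) by differentials. -/

section Kaehler

variable {F : Type*} [Field F] {A : Type*} [CommRing A] [Algebra F A]

theorem kaehler_induction {p : Ω[A⁄F] → Prop} (D : ∀ f, p (KaehlerDifferential.D F A f))
    (add : ∀ x y, p x → p y → p (x + y)) (smul : ∀ (a : A) x, p x → p (a • x)) (ω : Ω[A⁄F]) :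
    p ω := by
  have hω : ω ∈ Submodule.span A (Set.range (KaehlerDifferential.D F A)) := by
    rw [KaehlerDifferential.span_range_derivation]
    trivial
  induction hω using Submodule.span_induction with
  | mem ω h => obtain ⟨f, rfl⟩ := h; exact D f
  | zero => simpa using D 0
  | add x y _ _ hx hy => exact add x y hx hy
  | smul a x _ hx => exact smul a x hx

theorem kaehler_induction_smul_D {p : Ω[A⁄F] → Prop}
    (D : ∀ a f : A, p (a • KaehlerDifferential.D F A f))
    (add : ∀ x y, p x → p y → p (x + y)) (ω : Ω[A⁄F]) : p ω := by
  suffices ∀ a : A, p (a • ω) by simpa using this 1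
  induction ω using kaehler_induction with
  | D f => exact fun a => D a f
  | add x y hx hy => intro a; rw [smul_add]; exact add _ _ (hx a) (hy a)
  | smul b x hx => intro a; rw [smul_smul]; exact hx _

theorem kaehlerLift_D {W : Type*} [AddCommGroup W] [Module F W] (B : A →ₗ[F] A →ₗ[F] W)
    (hB : ∀ a f g, B a (f * g) = B (a * f) g + B (a * g) f) (f : A) :
    kaehlerLift B hB (KaehlerDifferential.D F A f) = B 1 f := by
  rw [← kaehlerLift_smul_D B hB 1 f, one_smul]

theorem kaehlerDer_D (D : Derivation F A A) (f : A) :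
    kaehlerDer D (KaehlerDifferential.D F A f) = KaehlerDifferential.D F A (D f) := by
  have h := kaehlerDer_smul_D D 1 f
  simpa using h

end Kaehler

/-! ### The action of Ω(V) on a module over V, and the anchor. -/

section Action

variable {F : Type*} [Field F] {V : Type*} [CommRing V] [Algebra F V] {P : PVA F V}
variable {M : Type*} [AddCommGroup M] [Module F M] [Module V M] [IsScalarTower F V M]
variable {dM : DiffModule P.der M}

/-- `{f g_λ h} = (|_{x=∂} f) {g_{λ+x} h} + (|_{x=∂} g) {f_{λ+x} h}` -/
theorem PVA.leibniz_left (P : PVA F V) (f g h : V) :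
    P.lca.prod (f * g) h
      = shift P.der addVar f (P.lca.prod g h) + shift P.der addVar g (P.lca.prod f h) := by
  let dV : DiffModule P.der V := ⟨P.der, fun a m => by simp [mul_comm, add_comm]⟩
  rw [P.lca.skew h, P.leibniz, map_add, neg_add, P.lca.skew h, P.lca.skew h, map_neg, map_neg]
  congr 2
  · exact negSubst_coeffMul dV _ _
  · exact negSubst_coeffMul dV _ _

/-- A differential algebra as a module over itself. -/
abbrev selfDiffModule (D : Derivation F V V) : DiffModule D V where
  der := D
  der_smul a m := by simp [mul_comm, add_comm]

/-- A Poisson vertex algebra as a module over itself. -/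
def adjointModule (P : PVA F V) : PVAModule P (selfDiffModule P.der) where
  toLambdaProduct := P.lca.toLambdaProduct
  jacobi := P.lca.jacobi
  leibniz_left f g m := by
    have : mulVec (P.lca.prod f g) m = coeffMul m (P.lca.prod f g) := by
      rw [mulVec_eq, coeffMul_eq]
      induction P.lca.prod f g with
      | zero => simp
      | add x y hx hy => simp only [map_add, LinearMap.add_apply, hx, hy]
      | tmul p a => simp [mul_comm]
    rw [this, smul_eq_mul, P.leibniz, add_comm]
  leibniz_right := P.leibniz_left

/-- The bilinear map `(a df, m) ↦ (|_{x=∂} a) f_{λ+x} m`. -/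
def kaehlerActProd (ρ : PVAModule P dM) : Ω[V⁄F] →ₗ[F] M →ₗ[F] F[X] ⊗[F] M :=
  kaehlerLift
    (LinearMap.mk₂ F (fun a f => shift P.der addVar a ∘ₗ ρ.prod f)
      (fun a b f => by ext m; simp [shift_add_left])
      (fun c a f => by ext m; simp [shift_smul_left])
      (fun a f g => by ext m; simp)
      (fun c a f => by ext m; simp))
    -- Compatibility with d(fg) = f dg + g df is the right Leibniz rule of the module.
    (fun a f g => by
      ext m
      simp [ρ.leibniz_right, isTranslation_addVar.shift_mul])

theorem kaehlerActProd_smul_D (ρ : PVAModule P dM) (a f : V) (m : M) :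
    kaehlerActProd ρ (a • KaehlerDifferential.D F V f) m
      = shift P.der addVar a (ρ.prod f m) := by
  rw [kaehlerActProd, kaehlerLift_smul_D]
  rfl

theorem kaehlerActProd_D (ρ : PVAModule P dM) (f : V) (m : M) :
    kaehlerActProd ρ (KaehlerDifferential.D F V f) m = ρ.prod f m := by
  have := kaehlerActProd_smul_D ρ 1 f m
  rwa [one_smul, isTranslation_addVar.shift_one] at this

theorem kaehlerActProd_smul (ρ : PVAModule P dM) (a : V) (ω : Ω[V⁄F]) (m : M) :
    kaehlerActProd ρ (a • ω) m = shift P.der addVar a (kaehlerActProd ρ ω m) := by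
  induction ω using kaehler_induction_smul_D with
  | D b f => rw [smul_smul, kaehlerActProd_smul_D, kaehlerActProd_smul_D,
      isTranslation_addVar.shift_mul]
  | add x y hx hy => simp only [smul_add, map_add, LinearMap.add_apply, hx, hy]

/-- The action of `Ω(V)` on a module over `V`. -/
def kaehlerAct (ρ : PVAModule P dM) : LambdaProduct (kaehlerModule P.der).der dM.der where
  prod := kaehlerActProd ρ
  sesq_left ω m := by
    induction ω using kaehler_induction with
    | D f =>
      change kaehlerActProd ρ (kaehlerDer _ _) m = _
      rw [kaehlerDer_D, kaehlerActProd_D, kaehlerActProd_D]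
      exact ρ.sesq_left f m
    | add x y hx hy => simp only [map_add, LinearMap.add_apply, hx, hy, smul_add, neg_add]
    | smul a x hx =>
      rw [(kaehlerModule P.der).der_smul, map_add, LinearMap.add_apply, kaehlerActProd_smul,
        kaehlerActProd_smul, hx, kaehlerActProd_smul, map_neg, shift_X_smul]
      abel
  sesq_right ω m := by
    induction ω using kaehler_induction with
    | D f =>
      rw [kaehlerActProd_D, kaehlerActProd_D]
      exact ρ.sesq_right f m
    | add x y hx hy => simp only [map_add, LinearMap.add_apply, hx, hy]
    | smul a x hx => rw [kaehlerActProd_smul, hx, kaehlerActProd_smul, shift_addVar_addDer]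

theorem kaehlerAct_prod (ρ : PVAModule P dM) : (kaehlerAct ρ).prod = kaehlerActProd ρ := rfl

/-- The anchor enters as the action of Ω(V) on V itself, so that its commutator identity will be a
special case of the one for actions. Both sides shift in the same way when ω is multiplied by b, and
on df the rule is the left Leibniz rule of the module. -/
theorem kaehlerAct_act_smul (ρ : PVAModule P dM) (ω : Ω[V⁄F]) (a : V) (m : M) :
    (kaehlerAct ρ).prod ω (a • m) = coeffMul a ((kaehlerAct ρ).prod ω m)
      + mulVec ((kaehlerAct (adjointModule P)).prod ω a) m := by
  simp only [kaehlerAct_prod]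
  induction ω using kaehler_induction with
  | D f =>
    rw [kaehlerActProd_D, kaehlerActProd_D, kaehlerActProd_D, ρ.leibniz_left, add_comm]
    rfl
  | add x y hx hy =>
    simp only [map_add, LinearMap.add_apply, hx, hy, mulVec_add]
    abel
  | smul b x hx =>
    rw [kaehlerActProd_smul, kaehlerActProd_smul, kaehlerActProd_smul, hx, map_add,
      isTranslation_addVar.shift_coeffMul, isTranslation_addVar.shift_mulVec]

end Action


/-! ### The λ-bracket of Ω(V). -/

section Bracket

variable {F : Type*} [Field F] {V : Type*} [CommRing V] [Algebra F V]

local notation "dK" => KaehlerDifferential.D F V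

/-- The linear extension of `d : V → Ω(V)` to `S ⊗ V`. -/
abbrev diffCoeff (F : Type*) [Field F] (V : Type*) [CommRing V] [Algebra F V] (S : Type*)
    [CommRing S] [Algebra F S] : S ⊗[F] V →ₗ[F] S ⊗[F] Ω[V⁄F] :=
  (KaehlerDifferential.D F V : V →ₗ[F] Ω[V⁄F]).lTensor S

theorem diffCoeff_smul {S : Type*} [CommRing S] [Algebra F S] (p : S) (x : S ⊗[F] V) :
    diffCoeff F V S (p • x) = p • diffCoeff F V S x := by
  induction x with
  | zero => simp
  | add x y hx hy => simp only [smul_add, map_add, hx, hy]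
  | tmul q v => simp [TensorProduct.smul_tmul']

theorem changeVar_diffCoeff {S S' : Type*} [CommRing S] [Algebra F S] [CommRing S'] [Algebra F S']
    (f : S →ₐ[F] S') (x : S ⊗[F] V) :
    changeVar _ f (diffCoeff F V S x) = diffCoeff F V S' (changeVar _ f x) := by
  induction x with
  | zero => simp
  | add x y hx hy => simp only [map_add, hx, hy]
  | tmul q v => simp

theorem diffCoeff_coeffMul (g : V) (x : F[X] ⊗[F] V) :
    diffCoeff F V F[X] (coeffMul g x) = coeffMul g (diffCoeff F V F[X] x) + mulVec x (dK g) := by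
  induction x with
  | zero => simp [mulVec_eq]
  | add x y hx hy =>
    simp only [map_add, hx, hy, mulVec_add]
    abel
  | tmul p v => simp [coeffMul_tmul, mulVec_tmul, TensorProduct.tmul_add]

variable (P : PVA F V)

theorem diffCoeff_addDer (x : F[X] ⊗[F] V) (s : F[X]) :
    diffCoeff F V F[X] (addDer (P.der : Module.End F V) s x)
      = addDer (kaehlerModule P.der).der s (diffCoeff F V F[X] x) := by
  induction x with
  | zero => simp
  | add x y hx hy => simp only [map_add, hx, hy]
  | tmul p v =>
    have : (kaehlerModule P.der).der (dK v) = dK (P.der v) := kaehlerDer_D _ _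
    simp [this]

theorem diffCoeff_negSubst (x : F[X] ⊗[F] V) :
    diffCoeff F V F[X] (negSubst (P.der : Module.End F V) x)
      = negSubst (kaehlerModule P.der).der (diffCoeff F V F[X] x) := by
  induction x using polynomial_tensor_induction with
  | one m => simp
  | add x y hx hy => simp only [map_add, hx, hy]
  | X_smul x hx =>
    rw [negSubst_X_smul, map_neg, diffCoeff_addDer, hx, diffCoeff_smul, negSubst_X_smul]

/-- `d((|_{x=∂} f) w_{λ+x}) = (|_{x=∂} f) dw_{λ+x} + (w_{-λ-∂} df)_{-λ-∂}` -/
theorem diffCoeff_shift (f : V) (w : F[X] ⊗[F] V) :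
    diffCoeff F V F[X] (shift P.der addVar f w)
      = shift P.der addVar f (diffCoeff F V F[X] w)
        + negSubst (kaehlerModule P.der).der
          (mulVec (negSubst (P.der : Module.End F V) w) (dK f)) := by
  induction w using polynomial_tensor_induction generalizing f with
  | one v =>
    rw [shift_one_tmul, negSubst_one_tmul, mulVec_tmul, negSubst_one_tmul, LinearMap.lTensor_tmul,
      LinearMap.lTensor_tmul, shift_one_tmul, ← TensorProduct.tmul_add]
    simp
  | add x y hx hy =>
    simp only [map_add, hx, hy, mulVec_add]
    abel
  | X_smul x hx =>
    have h := addDer_mulVec (kaehlerModule P.der) (Polynomial.X : F[X])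
      (negSubst (P.der : Module.End F V) x) (dK f)
    have hd : (kaehlerModule P.der).der (dK f) = dK (P.der f) := kaehlerDer_D _ _
    rw [hd, ← sub_eq_iff_eq_add] at h
    rw [shift_X_smul, map_add, hx, diffCoeff_smul, hx, diffCoeff_smul, shift_X_smul,
      negSubst_X_smul, mulVec_neg, ← h, neg_sub, map_sub, negSubst_addDer, smul_add]
    abel

/-- The bilinear map `(f, b dg) ↦ b d{f_λ g} + {f_λ b} dg`. -/
def lieProd : V →ₗ[F] Ω[V⁄F] →ₗ[F] F[X] ⊗[F] Ω[V⁄F] :=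
  (kaehlerLift (W := V →ₗ[F] F[X] ⊗[F] Ω[V⁄F])
    (LinearMap.mk₂ F
      (fun b g => coeffMul b ∘ₗ diffCoeff F V F[X] ∘ₗ P.lca.prod.flip g
        + ((LinearMap.toSpanSingleton V Ω[V⁄F] (dK g)).restrictScalars F).lTensor F[X] ∘ₗ
          P.lca.prod.flip b)
      (fun a b f => by ext m; simp [coeffMul_add_left]; abel)
      (fun c a f => by ext m; simp [coeffMul_smul_left])
      (fun a f g => by
        refine LinearMap.ext fun m => ?_
        have := mulVec_add_right (P.lca.prod m a) (dK f) (dK g)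
        simp only [mulVec] at this
        simp [this]; abel)
      (fun c a f => by
        refine LinearMap.ext fun m => ?_
        have : mulVec (P.lca.prod m a) (c • dK f) = c • mulVec (P.lca.prod m a) (dK f) := by
          rw [mulVec_eq, mulVec_eq, TensorProduct.tmul_smul, LinearMap.map_smul_of_tower]
        simp only [mulVec] at this
        simp [this]))
    (fun a f g => by
      refine LinearMap.ext fun m => ?_
      change coeffMul a (diffCoeff F V F[X] (P.lca.prod m (f * g)))
          + mulVec (P.lca.prod m a) (dK (f * g))
        = (coeffMul (a * f) (diffCoeff F V F[X] (P.lca.prod m g))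
          + mulVec (P.lca.prod m (a * f)) (dK g))
          + (coeffMul (a * g) (diffCoeff F V F[X] (P.lca.prod m f))
          + mulVec (P.lca.prod m (a * g)) (dK f))
      simp only [P.leibniz, map_add, diffCoeff_coeffMul, coeffMul_mul, mulVec_add,
        Derivation.leibniz, mulVec_add_right, mulVec_smul_right, mulVec_coeffMul]
      abel)).flip

theorem lieProd_smul_D (f b g : V) :
    lieProd P f (b • dK g) = coeffMul b (diffCoeff F V F[X] (P.lca.prod f g))
      + mulVec (P.lca.prod f b) (dK g) := by
  rw [lieProd, LinearMap.flip_apply, kaehlerLift_smul_D]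
  rfl

theorem pva_prod_one (f : V) : P.lca.prod f 1 = 0 := by
  have h := P.leibniz f 1 1
  simp only [mul_one, coeffMul_eq] at h
  have h1 : ∀ x : F[X] ⊗[F] V, coeffProd ((1 : F[X]) ⊗ₜ[F] (1 : V)) x = x := by
    intro x
    induction x with
    | zero => simp
    | add x y hx hy => simp only [map_add, hx, hy]
    | tmul p v => simp
  rw [h1] at h
  simpa using h

theorem coeffMul_one {S : Type*} [CommRing S] [Algebra F S] {A : Type*} [CommRing A] [Algebra F A]
    {M : Type*} [AddCommGroup M] [Module F M] [Module A M] [IsScalarTower F A M]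
    (x : S ⊗[F] M) : coeffMul (1 : A) x = x := by
  induction x with
  | zero => simp
  | add x y hx hy => simp only [map_add, hx, hy]
  | tmul p v => simp [coeffMul_tmul]

theorem lieProd_D (f g : V) : lieProd P f (dK g) = diffCoeff F V F[X] (P.lca.prod f g) := by
  have h := lieProd_smul_D P f 1 g
  rw [one_smul, coeffMul_one, pva_prod_one] at h
  simpa [mulVec_eq] using h

theorem lieProd_smul (f c : V) (ω : Ω[V⁄F]) :
    lieProd P f (c • ω) = coeffMul c (lieProd P f ω) + mulVec (P.lca.prod f c) ω := by
  induction ω using kaehler_induction_smul_D with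
  | D b g =>
    rw [smul_smul, lieProd_smul_D, lieProd_smul_D, P.leibniz, mulVec_add, mulVec_coeffMul,
      mulVec_coeffMul, map_add, coeffMul_mul, mulVec_smul_right]
    abel
  | add x y hx hy =>
    rw [smul_add, map_add, hx, hy, map_add, map_add, mulVec_add_right]
    abel

theorem lieProd_der (f : V) (ω : Ω[V⁄F]) :
    lieProd P (P.der f) ω = -((Polynomial.X : F[X]) • lieProd P f ω) := by
  have hs : ∀ g, P.lca.prod (P.der f) g = -((Polynomial.X : F[X]) • P.lca.prod f g) :=
    fun g => P.lca.sesq_left f g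
  induction ω using kaehler_induction_smul_D with
  | D b g =>
    rw [lieProd_smul_D, lieProd_smul_D, hs, hs, mulVec_neg, mulVec_smul, map_neg, diffCoeff_smul,
      map_neg, coeffMul_eq, map_smul, ← coeffMul_eq, smul_add, neg_add]
  | add x y hx hy => rw [map_add, hx, hy, map_add, smul_add, neg_add]

/-- The anchor of `Ω(V)`. -/
abbrev kaehlerAnchor : LambdaProduct (kaehlerModule P.der).der (P.der : Module.End F V) :=
  kaehlerAct (adjointModule P)

theorem kaehlerAnchor_smul (a : V) (ω : Ω[V⁄F]) (b : V) :
    (kaehlerAnchor P).prod (a • ω) b = shift P.der addVar a ((kaehlerAnchor P).prod ω b) :=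
  kaehlerActProd_smul _ _ _ _

theorem kaehlerAnchor_D (f g : V) : (kaehlerAnchor P).prod (dK f) g = P.lca.prod f g :=
  kaehlerActProd_D _ _ _

theorem kaehlerAnchor_mul (ω : Ω[V⁄F]) (a b : V) :
    (kaehlerAnchor P).prod ω (a * b) = coeffMul a ((kaehlerAnchor P).prod ω b)
      + coeffMul b ((kaehlerAnchor P).prod ω a) := by
  induction ω using kaehler_induction with
  | D f => simp only [kaehlerAnchor_D, P.leibniz]
  | add x y hx hy =>
    simp only [map_add, LinearMap.add_apply, hx, hy]
    abel
  | smul c x hx =>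
    simp only [kaehlerAnchor_smul, hx, map_add, isTranslation_addVar.shift_coeffMul]

/-- On differentials the anchor terms come from d applied to the shifted coefficients
(`diffCoeff_shift`); both sides obey the same Leibniz rule in ω, which gives the general case. These
terms are what makes the second stage of the bracket well defined. -/
theorem lieProd_mul (f g : V) (ω : Ω[V⁄F]) :
    lieProd P (f * g) ω = shift P.der addVar f (lieProd P g ω)
      + shift P.der addVar g (lieProd P f ω)
      - negSubst (kaehlerModule P.der).der (mulVec ((kaehlerAnchor P).prod ω f) (dK g)
        + mulVec ((kaehlerAnchor P).prod ω g) (dK f)) := by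
  induction ω using kaehler_induction with
  | D h =>
    rw [lieProd_D, P.leibniz_left, map_add, diffCoeff_shift, diffCoeff_shift, lieProd_D, lieProd_D,
      kaehlerAnchor_D, kaehlerAnchor_D, P.lca.skew f h, P.lca.skew g h, mulVec_neg, mulVec_neg,
      map_add, map_neg, map_neg]
    abel
  | add x y hx hy =>
    simp only [map_add, LinearMap.add_apply, hx, hy, mulVec_add]
    abel
  | smul c x hx =>
    simp only [lieProd_smul, hx, kaehlerAnchor_smul, P.leibniz_left, map_add, map_sub, mulVec_add,
      isTranslation_addVar.shift_coeffMul, ← isTranslation_addVar.shift_mulVec, negSubst_shift]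
    abel

/-- The bilinear map `(ω, b dg) ↦ b [ω_λ dg] + θ(ω)_λ(b) dg`, where
`[ω_λ dg] = -[dg_{-λ-∂} ω]`. -/
def kaehlerBracketProd : Ω[V⁄F] →ₗ[F] Ω[V⁄F] →ₗ[F] F[X] ⊗[F] Ω[V⁄F] :=
  (kaehlerLift (W := Ω[V⁄F] →ₗ[F] F[X] ⊗[F] Ω[V⁄F])
    (LinearMap.mk₂ F
      (fun b g => -(coeffMul b ∘ₗ negSubst (kaehlerModule P.der).der ∘ₗ lieProd P g)
        + ((LinearMap.toSpanSingleton V Ω[V⁄F] (dK g)).restrictScalars F).lTensor F[X] ∘ₗ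
          (kaehlerAnchor P).prod.flip b)
      (fun a b f => by
        refine LinearMap.ext fun m => ?_
        simp [coeffMul_add_left]; abel)
      (fun c a f => by
        refine LinearMap.ext fun m => ?_
        simp [coeffMul_smul_left])
      (fun a f g => by
        refine LinearMap.ext fun m => ?_
        have := mulVec_add_right ((kaehlerAnchor P).prod m a) (dK f) (dK g)
        simp only [mulVec] at this
        simp [this]; abel)
      (fun c a f => by
        refine LinearMap.ext fun m => ?_
        have : mulVec ((kaehlerAnchor P).prod m a) (c • dK f)
            = c • mulVec ((kaehlerAnchor P).prod m a) (dK f) := by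
          rw [mulVec_eq, mulVec_eq, TensorProduct.tmul_smul, LinearMap.map_smul_of_tower]
        simp only [mulVec] at this
        simp [this]))
    -- With ω = m, the correction terms of `lieProd_mul` contribute a θ(ω)(f) dg + a θ(ω)(g) df.
    -- These are the parts of θ(ω)(a f) dg and θ(ω)(a g) df in which a is not differentiated.
    (fun a f g => by
      refine LinearMap.ext fun m => ?_
      change -coeffMul a (negSubst (kaehlerModule P.der).der (lieProd P (f * g) m))
          + mulVec ((kaehlerAnchor P).prod m a) (dK (f * g))
        = (-coeffMul (a * f) (negSubst (kaehlerModule P.der).der (lieProd P g m))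
          + mulVec ((kaehlerAnchor P).prod m (a * f)) (dK g))
          + (-coeffMul (a * g) (negSubst (kaehlerModule P.der).der (lieProd P f m))
          + mulVec ((kaehlerAnchor P).prod m (a * g)) (dK f))
      simp only [kaehlerAnchor_mul, map_add, map_sub, coeffMul_mul, mulVec_add, lieProd_mul,
        Derivation.leibniz, mulVec_add_right, mulVec_smul_right, mulVec_coeffMul, negSubst_shift,
        negSubst_negSubst]
      abel)).flip

theorem kaehlerBracketProd_smul_D (ω : Ω[V⁄F]) (b g : V) :
    kaehlerBracketProd P ω (b • dK g)
      = -coeffMul b (negSubst (kaehlerModule P.der).der (lieProd P g ω))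
        + mulVec ((kaehlerAnchor P).prod ω b) (dK g) := by
  rw [kaehlerBracketProd, LinearMap.flip_apply, kaehlerLift_smul_D]
  rfl

theorem kaehlerAnchor_one (ω : Ω[V⁄F]) : (kaehlerAnchor P).prod ω 1 = 0 := by
  have h := kaehlerAnchor_mul P ω 1 1
  rw [mul_one, coeffMul_one] at h
  simpa using h

theorem kaehlerBracketProd_D (ω : Ω[V⁄F]) (g : V) :
    kaehlerBracketProd P ω (dK g)
      = -negSubst (kaehlerModule P.der).der (lieProd P g ω) := by
  have h := kaehlerBracketProd_smul_D P ω 1 g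
  rw [one_smul, coeffMul_one, kaehlerAnchor_one] at h
  simpa [mulVec_eq] using h

theorem kaehlerBracketProd_smul (ω : Ω[V⁄F]) (c : V) (η : Ω[V⁄F]) :
    kaehlerBracketProd P ω (c • η) = coeffMul c (kaehlerBracketProd P ω η)
      + mulVec ((kaehlerAnchor P).prod ω c) η := by
  induction η using kaehler_induction_smul_D with
  | D b g =>
    rw [smul_smul, kaehlerBracketProd_smul_D, kaehlerBracketProd_smul_D, kaehlerAnchor_mul,
      mulVec_add, mulVec_coeffMul, mulVec_coeffMul, map_add, coeffMul_mul, mulVec_smul_right,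
      map_neg]
    abel
  | add x y hx hy =>
    rw [smul_add, map_add, hx, hy, map_add, map_add, mulVec_add_right]
    abel

/-- The two stages of the construction agree: both sides satisfy the same Leibniz rule in η, and for
η = dg the equality is the skewsymmetry of the bracket of V. -/
theorem kaehlerBracketProd_D_left (f : V) (η : Ω[V⁄F]) :
    kaehlerBracketProd P (dK f) η = lieProd P f η := by
  induction η using kaehler_induction_smul_D with
  | D b g =>
    rw [kaehlerBracketProd_smul_D, lieProd_smul_D, lieProd_D, kaehlerAnchor_D, P.lca.skew g f,
      map_neg, diffCoeff_negSubst, map_neg]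
  | add x y hx hy => rw [map_add, hx, hy, map_add]

/-- The construction is asymmetric in its arguments, so skewsymmetry has to be proved. On a df and b
dg the two Leibniz expansions are interchanged, because λ ↦ −λ − ∂ exchanges coefficient products
with shifts; what remains is the skewsymmetry of {f_λ g}. -/
theorem kaehlerBracketProd_skew (ω η : Ω[V⁄F]) :
    kaehlerBracketProd P η ω
      = -negSubst (kaehlerModule P.der).der (kaehlerBracketProd P ω η) := by
  induction η using kaehler_induction_smul_D with
  | add x y hx hy => rw [map_add, LinearMap.add_apply, hx, hy, map_add, map_add, neg_add]
  | D b g =>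
    induction ω using kaehler_induction_smul_D with
    | add x y hx hy => rw [map_add, map_add, LinearMap.add_apply, hx, hy, map_add, neg_add]
    | D a f =>
      rw [kaehlerBracketProd_smul_D, kaehlerBracketProd_smul_D, lieProd_smul, lieProd_smul,
        kaehlerAnchor_smul, kaehlerAnchor_smul, kaehlerAnchor_D, kaehlerAnchor_D, lieProd_D,
        lieProd_D]
      simp only [map_add, map_neg, negSubst_coeffMul, negSubst_negSubst,
        ← isTranslation_addVar.shift_mulVec, negSubst_shift, isTranslation_addVar.shift_coeffMul]
      rw [P.lca.skew f g, map_neg, diffCoeff_negSubst]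
      simp only [map_neg]
      abel

/-- The `λ`-bracket of `Ω(V)`. -/
def kaehlerBracket :
    LambdaProduct (kaehlerModule P.der).der (kaehlerModule P.der).der :=
  have right : ∀ u m, kaehlerBracketProd P u ((kaehlerModule P.der).der m)
      = addDer (kaehlerModule P.der).der (Polynomial.X : F[X]) (kaehlerBracketProd P u m) := by
    intro ω η
    induction η using kaehler_induction with
    | D g =>
      have hd : (kaehlerModule P.der).der (dK g) = dK (P.der g) := kaehlerDer_D _ _
      rw [hd, kaehlerBracketProd_D, kaehlerBracketProd_D, lieProd_der, map_neg, negSubst_X_smul,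
        map_neg, neg_neg]
    | add x y hx hy => simp only [map_add, hx, hy]
    | smul c x hx =>
      have hθ : (kaehlerAnchor P).prod ω (P.der c)
          = addDer (P.der : Module.End F V) (Polynomial.X : F[X]) ((kaehlerAnchor P).prod ω c) :=
        (kaehlerAnchor P).sesq_right ω c
      rw [(kaehlerModule P.der).der_smul, map_add, kaehlerBracketProd_smul,
        kaehlerBracketProd_smul, kaehlerBracketProd_smul, hx, map_add, addDer_coeffMul,
        addDer_mulVec, hθ]
      abel
  { prod := kaehlerBracketProd P
    -- Under skewsymmetry, sesquilinearity on the right becomes sesquilinearity on the left.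
    sesq_left := fun u m => by
      rw [kaehlerBracketProd_skew P m, right, negSubst_addDer, neg_neg,
        kaehlerBracketProd_skew P m, smul_neg, neg_neg]
    sesq_right := right }

end Bracket


universe u v w x

/-! ### The commutator identity and its symmetries. -/

section Commutator

variable {F : Type u} [Field F]
variable {E : Type v} [AddCommGroup E] [Module F E]
variable {M : Type w} [AddCommGroup M] [Module F M]

/-- The identity `[u_λ v]_{λ+μ} m = u_λ (v_μ m) - v_μ (u_λ m)` for given `u`, `v`, `m`, where `λ`
and `μ` are elements of any commutative algebra. -/
def CommutatorAt (br : E →ₗ[F] E →ₗ[F] F[X] ⊗[F] E) (act : E →ₗ[F] M →ₗ[F] F[X] ⊗[F] M)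
    (a b : E) (m : M) : Prop :=
  ∀ (S : Type u) [CommRing S] [Algebra F S] (s t : S),
    extend act (s + t) (extend br s (1 ⊗ₜ a) (1 ⊗ₜ b)) (1 ⊗ₜ m)
      = extend act s (1 ⊗ₜ a) (extend act t (1 ⊗ₜ b) (1 ⊗ₜ m))
        - extend act t (1 ⊗ₜ b) (extend act s (1 ⊗ₜ a) (1 ⊗ₜ m))

variable {br : E →ₗ[F] E →ₗ[F] F[X] ⊗[F] E} {act : E →ₗ[F] M →ₗ[F] F[X] ⊗[F] M}

/-- The algebra F[λ, μ] is universal, through λ ↦ s and μ ↦ t. Having the identity over every S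
permits the later introduction of auxiliary variables. -/
theorem commutatorAt_iff {a b : E} {m : M} : CommutatorAt br act a b m ↔
    let l : MvPolynomial (Fin 2) F := MvPolynomial.X 0
    let μ : MvPolynomial (Fin 2) F := MvPolynomial.X 1
    extend act l (1 ⊗ₜ a) (extend act μ (1 ⊗ₜ b) (1 ⊗ₜ m))
        - extend act μ (1 ⊗ₜ b) (extend act l (1 ⊗ₜ a) (1 ⊗ₜ m))
      = extend act (l + μ) (extend br l (1 ⊗ₜ a) (1 ⊗ₜ b)) (1 ⊗ₜ m) := by
  refine ⟨fun h => (h _ _ _).symm, fun h S _ _ s t => ?_⟩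
  have := congrArg (changeVar M (MvPolynomial.aeval ![s, t])) h
  simpa [changeVar_extend, changeVar_evalAt] using this.symm

/-- Here μ stands for the total weight, as in the algebroid axioms, so the specialisation is λ ↦ s,
μ ↦ s + t. -/
theorem commutatorAt_iff_sub {a b : E} {m : M} : CommutatorAt br act a b m ↔
    let l : MvPolynomial (Fin 2) F := MvPolynomial.X 0
    let μ : MvPolynomial (Fin 2) F := MvPolynomial.X 1
    extend act μ (extend br l (1 ⊗ₜ a) (1 ⊗ₜ b)) (1 ⊗ₜ m)
      = extend act l (1 ⊗ₜ a) (extend act (μ - l) (1 ⊗ₜ b) (1 ⊗ₜ m))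
        - extend act (μ - l) (1 ⊗ₜ b) (extend act l (1 ⊗ₜ a) (1 ⊗ₜ m)) := by
  refine ⟨fun h => ?_, fun h S _ _ s t => ?_⟩
  · have := h (MvPolynomial (Fin 2) F) (MvPolynomial.X 0) (MvPolynomial.X 1 - MvPolynomial.X 0)
    rwa [add_sub_cancel] at this
  · have := congrArg (changeVar M (MvPolynomial.aeval ![s, s + t])) h
    simpa [changeVar_extend, changeVar_evalAt] using this

theorem CommutatorAt.add_fst {a a' b : E} {m : M} (h : CommutatorAt br act a b m)
    (h' : CommutatorAt br act a' b m) : CommutatorAt br act (a + a') b m := by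
  intro S _ _ s t
  simp only [TensorProduct.tmul_add, map_add, LinearMap.add_apply, h S s t, h' S s t]
  abel

theorem CommutatorAt.add_snd {a b b' : E} {m : M} (h : CommutatorAt br act a b m)
    (h' : CommutatorAt br act a b' m) : CommutatorAt br act a (b + b') m := by
  intro S _ _ s t
  simp only [TensorProduct.tmul_add, map_add, LinearMap.add_apply, h S s t, h' S s t]
  abel

theorem CommutatorAt.add_trd {a b : E} {m m' : M} (h : CommutatorAt br act a b m)
    (h' : CommutatorAt br act a b m') : CommutatorAt br act a b (m + m') := by
  intro S _ _ s t
  simp only [TensorProduct.tmul_add, map_add, h S s t, h' S s t]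
  abel

theorem extend_commutator_of_forall {S : Type u} [CommRing S] [Algebra F S] {a b : E}
    (h : ∀ m, CommutatorAt br act a b m) (s t : S) (z : S ⊗[F] M) :
    extend act (s + t) (extend br s (1 ⊗ₜ a) (1 ⊗ₜ b)) z
      = extend act s (1 ⊗ₜ a) (extend act t (1 ⊗ₜ b) z)
        - extend act t (1 ⊗ₜ b) (extend act s (1 ⊗ₜ a) z) := by
  induction z using tensor_induction_smul with
  | one m => exact h m S s t
  | add z z' hz hz' =>
    simp only [map_add, hz, hz']
    abel
  | smul p z hz => simp only [map_smul, hz, smul_sub]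

theorem extend_commutator {S : Type u} [CommRing S] [Algebra F S]
    (h : ∀ a b m, CommutatorAt br act a b m) (s t : S) (x y : S ⊗[F] E) (z : S ⊗[F] M) :
    extend act (s + t) (extend br s x y) z
      = extend act s x (extend act t y z) - extend act t y (extend act s x z) := by
  induction x using tensor_induction_smul with
  | one a =>
    induction y using tensor_induction_smul with
    | one b => exact extend_commutator_of_forall (h a b) s t z
    | add z z' hz hz' =>
      simp only [map_add, LinearMap.add_apply, hz, hz']
      abel
    | smul p z hz => simp only [map_smul, LinearMap.smul_apply, hz, smul_sub]
  | add z z' hz hz' =>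
    simp only [map_add, LinearMap.add_apply, hz, hz']
    abel
  | smul p z hz => simp only [map_smul, LinearMap.smul_apply, hz, smul_sub]

variable {dE : Module.End F E} {dM : Module.End F M}

/-- The brackets of a, b in the two orders add up to an element of the image of ∂ + s + t, which
acts by zero at weight s + t. -/
theorem CommutatorAt.symm {act : LambdaProduct dE dM}
    (hbr : ∀ a b, br b a = -(negSubst dE (br a b))) {a b : E} {m : M}
    (h : CommutatorAt br act.prod a b m) : CommutatorAt br act.prod b a m := by
  intro S _ _ s t
  obtain ⟨z, hz⟩ := extend_skew hbr s t ((1 : S) ⊗ₜ[F] b) (1 ⊗ₜ a)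
  have h0 := act.extend_addDer_left (s + t) z (1 ⊗ₜ m)
  rw [hz, map_add, LinearMap.add_apply, add_comm s t, h S t s] at h0
  rw [add_comm s t, eq_neg_of_add_eq_zero_left h0, neg_sub]

section Retraction

variable {S : Type*} [CommRing S] [Algebra F S]

variable (dE) in
/-- The map `S[x] ⊗ E → S ⊗ E` that replaces `x` by `-∂ - s`. -/
def substNegDer (s : S) : S[X] ⊗[F] E →ₗ[S] S ⊗[F] E :=
  TensorProduct.AlgebraTensorModule.lift
    { toFun := fun q =>
        { toFun := fun m =>
            (Polynomial.aeval (-(addDer dE s)) q : Module.End S (S ⊗[F] E)) (1 ⊗ₜ m)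
          map_add' := fun m m' => by rw [TensorProduct.tmul_add, map_add]
          map_smul' := fun c m => by
            rw [TensorProduct.tmul_smul, LinearMap.map_smul_of_tower, RingHom.id_apply] }
      map_add' := fun q q' => by ext m; simp
      map_smul' := fun p q => by ext m; simp }

theorem substNegDer_tmul (s : S) (q : S[X]) (m : E) :
    substNegDer dE s (q ⊗ₜ m)
      = (Polynomial.aeval (-(addDer dE s)) q : Module.End S (S ⊗[F] E)) (1 ⊗ₜ m) := rfl

theorem substNegDer_mul_smul (s : S) (p : S[X]) (w : S[X] ⊗[F] E) :
    substNegDer dE s (p • w)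
      = (Polynomial.aeval (-(addDer dE s)) p : Module.End S (S ⊗[F] E)) (substNegDer dE s w) := by
  induction w with
  | zero => simp
  | add x y hx hy => simp only [smul_add, map_add, hx, hy]
  | tmul q m =>
    rw [TensorProduct.smul_tmul', substNegDer_tmul, substNegDer_tmul, smul_eq_mul, map_mul]
    rfl

theorem substNegDer_addDer (s : S) (w : S[X] ⊗[F] E) :
    substNegDer dE s (addDer dE (Polynomial.C s + Polynomial.X) w) = 0 := by
  induction w using tensor_induction_smul with
  | one m =>
    rw [addDer_tmul, map_add, substNegDer_tmul, substNegDer_tmul]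
    simp [TensorProduct.smul_tmul']
  | add x y hx hy => rw [map_add, map_add, hx, hy, add_zero]
  | smul p x hx => rw [addDer_smul, substNegDer_mul_smul, hx, map_zero]

theorem substNegDer_inclC (s : S) (x : S ⊗[F] E) : substNegDer dE s (inclC S E x) = x := by
  induction x using tensor_induction_smul with
  | one m => simp [substNegDer_tmul]
  | add x y hx hy => rw [map_add, map_add, hx, hy]
  | smul p x hx =>
    rw [changeVar_smul, substNegDer_mul_smul, hx]
    simp

/-- The substitution x = −∂ − s is a retraction of S ⊗ E → S[x] ⊗ E that kills the image of ∂ + s +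
x. A congruence modulo ∂ plus a total weight thus becomes an equality as soon as a fresh variable
occurs in that weight. -/
theorem eq_zero_of_inclC_mem_range {s : S} {x : S ⊗[F] E}
    (h : inclC S E x ∈ LinearMap.range (addDer dE (Polynomial.C s + Polynomial.X : S[X]))) :
    x = 0 := by
  obtain ⟨w, hw⟩ := h
  rw [← substNegDer_inclC (dE := dE) s x, ← hw, substNegDer_addDer]

end Retraction

/-- The Jacobi identity for `a`, `b`, `c` implies that for `a`, `c`, `b`. -/
theorem CommutatorAt.swap_right {br : LambdaProduct dE dE}
    (hbr : ∀ a b, br.prod b a = -(negSubst dE (br.prod a b))) {a b c : E}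
    (h : CommutatorAt br.prod br.prod a b c) : CommutatorAt br.prod br.prod a c b := by
  intro S _ _ s r
  rw [← sub_eq_zero]
  -- The last argument b carries no weight in the identity to be proved; it receives the fresh
  -- weight τ = x. Modulo ∂ + s + r + x every outer bracket may then be reversed by skewsymmetry,
  -- and the identity becomes the given one with weights s for a and x for b.
  refine eq_zero_of_inclC_mem_range (dE := dE) (s := s + r) ?_
  have h := h S[X] (Polynomial.C s) Polynomial.X
  simp only [map_sub, changeVar_extend, Polynomial.CAlgHom_apply, changeVar_tmul, map_one, map_add]
  set A : S[X] ⊗[F] E := 1 ⊗ₜ a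
  set B : S[X] ⊗[F] E := 1 ⊗ₜ b
  set C : S[X] ⊗[F] E := 1 ⊗ₜ c
  set σ : S[X] := Polynomial.C s
  set ρ : S[X] := Polynomial.C r
  set τ : S[X] := Polynomial.X
  obtain ⟨z, hz⟩ := extend_skew hbr ρ τ C B
  have h1 : extend br.prod σ A (extend br.prod ρ C B) + extend br.prod σ A (extend br.prod τ B C)
      ∈ LinearMap.range (addDer dE (σ + ρ + τ)) := by
    rw [← map_add (extend br.prod σ A), ← hz, br.extend_addDer_right]
    exact ⟨_, by congr 2; ring⟩
  have h2 := extend_skew hbr ρ (σ + τ) C (extend br.prod σ A B)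
  have h3 := extend_skew hbr τ (σ + ρ) B (extend br.prod σ A C)
  rw [show ρ + (σ + τ) = σ + ρ + τ by ring] at h2
  rw [show τ + (σ + ρ) = σ + ρ + τ by ring] at h3
  convert sub_mem (add_mem h2 h3) h1 using 1
  rw [h]
  abel

end Commutator

/-! ### Stability of the commutator identity under multiplication by A. -/

section Smul

variable {F : Type u} [Field F] {A : Type*} [CommRing A] [Algebra F A] {D : Derivation F A A}
variable {E : Type v} [AddCommGroup E] [Module F E]
variable {M : Type w} [AddCommGroup M] [Module F M] [Module A M] [IsScalarTower F A M]
variable {dE : Module.End F E} {dM : DiffModule D M}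

/-- The cross terms θ(u)(a) v m and θ(v)(a) u m occur in both iterated actions and cancel. There
remain the identity at m and the identity of the anchor at a. -/
theorem CommutatorAt.smul_trd {br : LambdaProduct dE dE} {θ : LambdaProduct dE (D : Module.End F A)}
    {act : LambdaProduct dE dM.der}
    (act_smul : ∀ u (a : A) m, act.prod u (a • m)
      = coeffMul a (act.prod u m) + mulVec (θ.prod u a) m)
    {u v : E} {m : M} (h : CommutatorAt br.prod act.prod u v m) (a : A)
    (hθ : CommutatorAt br.prod θ.prod u v a) :
    CommutatorAt br.prod act.prod u v (a • m) := by
  intro S _ _ s t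
  have e : (1 : S) ⊗ₜ[F] (a • m) = coeffProd ((1 : S) ⊗ₜ[F] a) (1 ⊗ₜ m) := by simp
  rw [e]
  simp only [extend_coeffProd act_smul, map_add, h S s t, hθ S s t, map_sub, LinearMap.sub_apply]
  abel

variable [Module A E] [IsScalarTower F A E]

/-- The identity for u, v is used over S[x] with weights s and t + x, before x is replaced by ∂
acting on a. The term θ(u)_s(a) v of the bracket [u_s a v] matches the one that arises when u_s is
moved past the coefficient (`extend_substDer`). -/
theorem CommutatorAt.smul_snd {br : LambdaProduct dE dE} {θ : LambdaProduct dE (D : Module.End F A)}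
    {act : LambdaProduct dE dM.der}
    (br_smul : ∀ u (a : A) v, br.prod u (a • v)
      = coeffMul a (br.prod u v) + mulVec (θ.prod u a) v)
    (act_smul : ∀ u (a : A) m, act.prod u (a • m)
      = coeffMul a (act.prod u m) + mulVec (θ.prod u a) m)
    (smul_act : ∀ (a : A) u m, act.prod (a • u) m = shift D addVar a (act.prod u m))
    {u v : E} (h : ∀ m, CommutatorAt br.prod act.prod u v m) (a : A) (m : M) :
    CommutatorAt br.prod act.prod u (a • v) m := by
  intro S _ _ s t
  have e : ∀ x : E, (1 : S) ⊗ₜ[F] (a • x) = coeffProd ((1 : S) ⊗ₜ[F] a) (1 ⊗ₜ x) := by simp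
  have hι : ∀ x : E, inclC S E ((1 : S) ⊗ₜ[F] x) = 1 ⊗ₜ x := by simp
  rw [e, extend_coeffProd br_smul, map_add, LinearMap.add_apply, extend_coeffProd_left smul_act,
    extend_coeffProd_left smul_act, extend_coeffProd_left smul_act,
    extend_coeffProd_left smul_act, extend_substDer act θ act_smul]
  have h1 := extend_commutator_of_forall h (Polynomial.C s : S[X]) (Polynomial.C t + Polynomial.X)
    (inclC S M (1 ⊗ₜ m))
  simp only [changeVar_extend, Polynomial.CAlgHom_apply, hι, translate_C, translate_X, map_add,
    changeVar_changeVar, translate_comp_CAlgHom] at h1 ⊢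
  simp only [changeVar_tmul, map_one] at h1 ⊢
  rw [← add_assoc] at h1
  rw [h1, map_sub, show Polynomial.C t + (Polynomial.X + Polynomial.C s)
    = Polynomial.C s + Polynomial.C t + Polynomial.X by ring]
  abel

end Smul

/-! ### Existence and uniqueness of the algebroid and module structures. -/

section Existence

variable {F : Type u} [Field F] {V : Type v} [CommRing V] [Algebra F V] (P : PVA F V)
variable {M : Type w} [AddCommGroup M] [Module F M] [Module V M] [IsScalarTower F V M]
variable {P} {dM : DiffModule P.der M}

/-- The identity is stable under V-multiples of η by `CommutatorAt.smul_snd`, hence under those of ω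
by symmetry. On differentials, d intertwines brackets and actions with those of V, and the identity
is the Jacobi identity of the module. -/
theorem kaehler_commutator (ρ : PVAModule P dM) (ω η : Ω[V⁄F]) (m : M) :
    CommutatorAt (kaehlerBracket P).prod (kaehlerAct ρ).prod ω η m := by
  have smul : ∀ {ω η : Ω[V⁄F]},
      (∀ m, CommutatorAt (kaehlerBracket P).prod (kaehlerAct ρ).prod ω η m) → ∀ (a : V) (m : M),
      CommutatorAt (kaehlerBracket P).prod (kaehlerAct ρ).prod ω (a • η) m :=
    CommutatorAt.smul_snd (θ := kaehlerAnchor P) (kaehlerBracketProd_smul P)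
      (kaehlerAct_act_smul ρ) (kaehlerActProd_smul ρ)
  have gen : ∀ f g m, CommutatorAt (kaehlerBracket P).prod (kaehlerAct ρ).prod
      (KaehlerDifferential.D F V f) (KaehlerDifferential.D F V g) m := by
    intro f g m S _ _ s t
    have hact : ∀ (r : S) (x : S ⊗[F] V) (y : S ⊗[F] M),
        extend (kaehlerAct ρ).prod r (diffCoeff F V S x) y = extend ρ.prod r x y := by
      intro r x y
      induction x using tensor_induction_smul with
      | one v =>
        induction y using tensor_induction_smul with
        | one m =>
          rw [LinearMap.lTensor_tmul, extend_tmul, extend_tmul, kaehlerAct_prod]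
          exact congrArg (fun z => (1 : S) • (1 : S) • evalAt r z) (kaehlerActProd_D ρ v m)
        | add x y hx hy => simp only [map_add, hx, hy]
        | smul p x hx => simp only [map_smul, hx]
      | add x y hx hy => simp only [map_add, LinearMap.add_apply, hx, hy]
      | smul p x hx => rw [diffCoeff_smul]; simp only [map_smul, LinearMap.smul_apply, hx]
    have hbr : extend (kaehlerBracket P).prod s ((1 : S) ⊗ₜ[F] KaehlerDifferential.D F V f)
        (1 ⊗ₜ KaehlerDifferential.D F V g)
        = diffCoeff F V S (extend P.lca.prod s (1 ⊗ₜ f) (1 ⊗ₜ g)) := by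
      rw [extend_tmul, extend_tmul, one_smul, one_smul, one_smul, one_smul, evalAt, evalAt,
        ← changeVar_diffCoeff, ← lieProd_D, ← kaehlerBracketProd_D_left]
      rfl
    have hD : ∀ f : V, (1 : S) ⊗ₜ[F] KaehlerDifferential.D F V f
        = diffCoeff F V S (1 ⊗ₜ f) := by simp
    rw [hbr]
    simp only [hD, hact]
    exact commutatorAt_iff.2 (ρ.jacobi f g m) S s t
  have skew := kaehlerBracketProd_skew P
  induction ω using kaehler_induction generalizing η m with
  | add x y hx hy => exact (hx η m).add_fst (hy η m)
  | smul a x hx =>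
    exact CommutatorAt.symm skew (smul (fun m => CommutatorAt.symm skew (hx η m)) a m)
  | D f =>
    induction η using kaehler_induction generalizing m with
    | add x y hx hy => exact (hx m).add_snd (hy m)
    | smul a x hx => exact smul hx a m
    | D g => exact gen f g m

/-- The bracket is not linear in its left argument in the sense needed for `CommutatorAt.smul_snd`,
so only the third argument can be extended from differentials to Ω(V). This is done three times, the
remaining arguments being brought to the third place by the symmetries of the identity. -/
theorem kaehler_jacobi (ω η ζ : Ω[V⁄F]) :
    CommutatorAt (kaehlerBracket P).prod (kaehlerBracket P).prod ω η ζ := by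
  have skew := kaehlerBracketProd_skew P
  have trd : ∀ {ω η : Ω[V⁄F]},
      (∀ h, CommutatorAt (kaehlerBracket P).prod (kaehlerBracket P).prod ω η
        (KaehlerDifferential.D F V h)) →
      ∀ ζ, CommutatorAt (kaehlerBracket P).prod (kaehlerBracket P).prod ω η ζ := by
    intro ω η h ζ
    induction ζ using kaehler_induction with
    | D f => exact h f
    | add x y hx hy => exact hx.add_trd hy
    | smul a x hx =>
      exact CommutatorAt.smul_trd (dM := kaehlerModule P.der) (θ := kaehlerAnchor P)
        (kaehlerBracketProd_smul P) hx a (kaehler_commutator (adjointModule P) ω η a)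
  have gen : ∀ f g h, CommutatorAt (kaehlerBracket P).prod (kaehlerBracket P).prod
      (KaehlerDifferential.D F V f) (KaehlerDifferential.D F V g)
      (KaehlerDifferential.D F V h) := by
    intro f g h S _ _ s t
    have hbr : ∀ (r : S) (x y : S ⊗[F] V),
        extend (kaehlerBracket P).prod r (diffCoeff F V S x) (diffCoeff F V S y)
          = diffCoeff F V S (extend P.lca.prod r x y) := by
      intro r x y
      induction x using tensor_induction_smul with
      | one f =>
        induction y using tensor_induction_smul with
        | one g =>
          rw [LinearMap.lTensor_tmul, LinearMap.lTensor_tmul, extend_tmul, extend_tmul, one_smul,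
            one_smul, one_smul, one_smul, evalAt, evalAt, ← changeVar_diffCoeff, ← lieProd_D,
            ← kaehlerBracketProd_D_left]
          rfl
        | add x y hx hy => simp only [map_add, hx, hy]
        | smul p x hx => simp only [diffCoeff_smul, map_smul, hx]
      | add x y hx hy => simp only [map_add, LinearMap.add_apply, hx, hy]
      | smul p x hx => simp only [diffCoeff_smul, map_smul, LinearMap.smul_apply, hx]
    have hD : ∀ f : V, (1 : S) ⊗ₜ[F] KaehlerDifferential.D F V f
        = diffCoeff F V S (1 ⊗ₜ f) := by simp
    simp only [hD, hbr, ← map_sub]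
    exact congrArg _ (commutatorAt_iff.2 (P.lca.jacobi f g h) S s t)
  have h1 := fun f g => trd (gen f g)
  have h2 := fun f η => trd (fun g => CommutatorAt.swap_right skew (h1 f g η))
  exact trd (fun f => CommutatorAt.swap_right skew (CommutatorAt.symm skew (h2 f ω η))) ζ

variable (P) in
/-- The structure of a Lie conformal algebroid on `Ω(V)`. -/
def kaehlerLCAd : LCAd (kaehlerModule P.der) where
  lca :=
    { toLambdaProduct := kaehlerBracket P
      skew := kaehlerBracketProd_skew P
      jacobi := fun a b c => commutatorAt_iff.1 (kaehler_jacobi a b c) }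
  anchor := kaehlerAnchor P
  anchor_mul := kaehlerAnchor_mul P
  anchor_smul := kaehlerAnchor_smul P
  bracket_smul := kaehlerBracketProd_smul P
  anchor_bracket a b c :=
    commutatorAt_iff_sub.1 (kaehler_commutator (adjointModule P) a b c)

theorem isKaehlerLCAd_kaehlerLCAd : IsKaehlerLCAd P (kaehlerLCAd P) :=
  ⟨kaehlerAnchor_D P, fun f g =>
    (kaehlerBracketProd_D_left P f (KaehlerDifferential.D F V g)).trans (lieProd_D P f g)⟩

theorem LambdaProduct.ext_prod {E : Type*} [AddCommGroup E] [Module F E] {dE : Module.End F E}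
    {M : Type*} [AddCommGroup M] [Module F M] {dM : Module.End F M} {b b' : LambdaProduct dE dM}
    (h : b.prod = b'.prod) : b = b' := by
  cases b; cases b'; simp_all

/-- The Leibniz rule in the second argument, carried to the first by skewsymmetry, determines the
bracket from its values on differentials; the anchor is determined by its linearity. -/
theorem IsKaehlerLCAd.eq_kaehlerLCAd {L : LCAd (kaehlerModule P.der)} (hL : IsKaehlerLCAd P L) :
    L = kaehlerLCAd P := by
  have hθ : L.anchor = kaehlerAnchor P := by
    refine LambdaProduct.ext_prod (LinearMap.ext₂ fun ω g => ?_)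
    induction ω using kaehler_induction with
    | D f => rw [hL.1, kaehlerAnchor_D]
    | add x y hx hy => simp only [map_add, LinearMap.add_apply, hx, hy]
    | smul a x hx => rw [L.anchor_smul, hx, kaehlerAnchor_smul]
  have hbr : L.lca.prod = kaehlerBracketProd P := by
    refine LinearMap.ext₂ fun ω η => ?_
    have smul : ∀ {ω η}, L.lca.prod ω η = kaehlerBracketProd P ω η → ∀ a : V,
        L.lca.prod ω (a • η) = kaehlerBracketProd P ω (a • η) := by
      intro ω η h a
      rw [L.bracket_smul, kaehlerBracketProd_smul, h, hθ]
    have symm : ∀ {ω η}, L.lca.prod ω η = kaehlerBracketProd P ω η →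
        L.lca.prod η ω = kaehlerBracketProd P η ω := by
      intro ω η h
      rw [L.lca.skew, kaehlerBracketProd_skew, h]
    induction ω using kaehler_induction generalizing η with
    | add x y hx hy => simp only [map_add, LinearMap.add_apply, hx, hy]
    | smul a x hx => exact symm (smul (symm (hx η)) a)
    | D f =>
      induction η using kaehler_induction with
      | D g => rw [hL.2, kaehlerBracketProd_D_left, lieProd_D]
      | add x y hx hy => simp only [map_add, hx, hy]
      | smul a x hx => exact smul hx a
  -- The other fields are propositions, so equality of brackets and anchors is enough.
  obtain ⟨⟨lp, _, _⟩, θ, _, _, _, _⟩ := L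
  obtain rfl : lp = kaehlerBracket P := LambdaProduct.ext_prod hbr
  obtain rfl : θ = kaehlerAnchor P := hθ
  rfl

/-- The action of the Lie conformal algebroid `Ω(V)` on a module over `V`. -/
def kaehlerLCAdModule (ρ : PVAModule P dM) : LCAdModule (kaehlerLCAd P) dM where
  toLambdaProduct := kaehlerAct ρ
  act_smul := kaehlerAct_act_smul ρ
  smul_act := kaehlerActProd_smul ρ
  bracket_act a b m := commutatorAt_iff_sub.1 (kaehler_commutator ρ a b m)

theorem isKaehlerAction_kaehlerLCAdModule (ρ : PVAModule P dM) :
    IsKaehlerAction ρ (kaehlerLCAdModule ρ) :=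
  kaehlerActProd_D ρ

theorem IsKaehlerAction.eq_kaehlerLCAdModule {ρ : PVAModule P dM}
    {R : LCAdModule (kaehlerLCAd P) dM} (hR : IsKaehlerAction ρ R) : R = kaehlerLCAdModule ρ := by
  have h : R.toLambdaProduct = kaehlerAct ρ := by
    refine LambdaProduct.ext_prod (LinearMap.ext₂ fun ω m => ?_)
    induction ω using kaehler_induction with
    | D f => exact (hR f m).trans (kaehlerActProd_D ρ f m).symm
    | add x y hx hy => simp only [map_add, LinearMap.add_apply, hx, hy]
    | smul a x hx => rw [R.smul_act, hx]; exact (kaehlerActProd_smul ρ a x m).symm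
  obtain ⟨act, _, _, _⟩ := R
  obtain rfl : act = kaehlerAct ρ := h
  rfl

end Existence


/-! ### The universal property of Ω(A) in several arguments. -/

section KaehlerMultilinear

variable {F : Type*} [Field F] {A : Type*} [CommRing A] [Algebra F A]
variable {C : Type*} [AddCommGroup C] [Module F C]

/-- The multilinear maps on `Ω(A)` that are linear over `A` in each argument, where `A` acts on `C`
in a way that depends on the argument. -/
def linMaps {k : ℕ} (σ : Fin k → A →ₐ[F] Module.End F C) :
    Submodule F (MultilinearMap F (fun _ : Fin k => Ω[A⁄F]) C) where
  carrier := {φ | ∀ (i : Fin k) (a : A) (u : Fin k → Ω[A⁄F]),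
    φ (Function.update u i (a • u i)) = σ i a (φ u)}
  add_mem' h h' i a u := by
    rw [add_apply, add_apply, map_add, h, h']
  zero_mem' i a u := by simp
  smul_mem' c φ h i a u := by
    rw [smul_apply, smul_apply, map_smul, h]

/-- The multilinear maps on `A` that are derivations in each argument, where `A` acts on `C` in a
way that depends on the argument. -/
def derMaps {k : ℕ} (σ : Fin k → A →ₐ[F] Module.End F C) :
    Submodule F (MultilinearMap F (fun _ : Fin k => A) C) where
  carrier := {γ | ∀ (i : Fin k) (b c : A) (u : Fin k → A),
    γ (Function.update u i (b * c)) = σ i b (γ (Function.update u i c))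
      + σ i c (γ (Function.update u i b))}
  add_mem' {γ γ'} h h' i b c u := by
    simp only [add_apply, map_add, h i b c u, h' i b c u]
    abel
  zero_mem' i b c u := by simp
  smul_mem' r γ h i b c u := by
    simp only [smul_apply, map_smul, h i b c u, smul_add]

/-- The restriction of a multilinear map on `Ω(A)` along `d : A → Ω(A)`. -/
def restrictD (F A C : Type*) [Field F] [CommRing A] [Algebra F A] [AddCommGroup C] [Module F C]
    (k : ℕ) : MultilinearMap F (fun _ : Fin k => Ω[A⁄F]) C →ₗ[F]
      MultilinearMap F (fun _ : Fin k => A) C :=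
  MultilinearMap.compLinearMapₗ fun _ => (KaehlerDifferential.D F A : A →ₗ[F] Ω[A⁄F])

@[simp] theorem restrictD_apply {k : ℕ} (φ : MultilinearMap F (fun _ : Fin k => Ω[A⁄F]) C)
    (u : Fin k → A) : restrictD F A C k φ u = φ fun i => KaehlerDifferential.D F A (u i) := rfl

theorem restrictD_update {k : ℕ} (φ : MultilinearMap F (fun _ : Fin k => Ω[A⁄F]) C)
    (u : Fin k → A) (i : Fin k) (a : A) : restrictD F A C k φ (Function.update u i a)
      = φ (Function.update (fun i => KaehlerDifferential.D F A (u i)) i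
        (KaehlerDifferential.D F A a)) := by
  rw [restrictD_apply]
  congr 1
  funext j
  by_cases h : j = i
  · subst h; simp
  · simp [h]

variable {k : ℕ}

theorem restrictD_mem {σ : Fin k → A →ₐ[F] Module.End F C}
    {φ : MultilinearMap F (fun _ : Fin k => Ω[A⁄F]) C} (h : φ ∈ linMaps σ) :
    restrictD F A C k φ ∈ derMaps σ := by
  intro i b c u
  have h' : ∀ (b c : A) (v : Fin k → Ω[A⁄F]), φ (Function.update v i
      (b • KaehlerDifferential.D F A c))
      = σ i b (φ (Function.update v i (KaehlerDifferential.D F A c))) := by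
    intro b c v
    have := h i b (Function.update v i (KaehlerDifferential.D F A c))
    simpa using this
  simp only [restrictD_update, Derivation.leibniz, MultilinearMap.map_update_add, h']

theorem curryLeft_mem_linMaps {σ : Fin (k + 1) → A →ₐ[F] Module.End F C}
    {φ : MultilinearMap F (fun _ : Fin (k + 1) => Ω[A⁄F]) C} (h : φ ∈ linMaps σ) (ω : Ω[A⁄F]) :
    φ.curryLeft ω ∈ linMaps fun i => σ i.succ := by
  intro i a u
  have := h i.succ a (Fin.cons ω u)
  rwa [Fin.cons_succ, ← Fin.cons_update] at this

theorem apply_cons_smul {σ : Fin (k + 1) → A →ₐ[F] Module.End F C}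
    {φ : MultilinearMap F (fun _ : Fin (k + 1) => Ω[A⁄F]) C} (h : φ ∈ linMaps σ) (a : A)
    (ω : Ω[A⁄F]) (u : Fin k → Ω[A⁄F]) :
    φ (Fin.cons (a • ω) u) = σ 0 a (φ (Fin.cons ω u)) := by
  have := h 0 a (Fin.cons ω u)
  rwa [Fin.cons_zero, Fin.update_cons_zero] at this

/-- This is the test on differentials. It is applied below to defects of sesquilinearity, which are
themselves linear. -/
theorem eq_zero_of_mem_linMaps {σ : Fin k → A →ₐ[F] Module.End F C}
    {φ : MultilinearMap F (fun _ : Fin k => Ω[A⁄F]) C} (h : φ ∈ linMaps σ)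
    (h0 : ∀ u : Fin k → A, φ (fun i => KaehlerDifferential.D F A (u i)) = 0) : φ = 0 := by
  induction k with
  | zero =>
    ext u
    rw [zero_apply, ← h0 0]
    exact congrArg φ (Subsingleton.elim _ _)
  | succ k ih =>
    suffices ∀ ω, φ.curryLeft ω = 0 by
      ext u
      have h := congrArg (fun ψ => ψ (Fin.tail u)) (this (u 0))
      simpa using h
    intro ω
    induction ω using kaehler_induction with
    | D f =>
      refine ih (curryLeft_mem_linMaps h _) fun u => ?_
      have := h0 (Fin.cons f u)
      rw [MultilinearMap.curryLeft_apply, ← this]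
      congr 1
      funext i
      refine Fin.cases rfl (fun i => rfl) i
    | add x y hx hy => rw [map_add, hx, hy, add_zero]
    | smul a x hx =>
      ext u
      rw [MultilinearMap.curryLeft_apply, apply_cons_smul h, ← MultilinearMap.curryLeft_apply, hx]
      simp

theorem linMaps_ext {σ : Fin k → A →ₐ[F] Module.End F C}
    {φ ψ : MultilinearMap F (fun _ : Fin k => Ω[A⁄F]) C} (hφ : φ ∈ linMaps σ) (hψ : ψ ∈ linMaps σ)
    (h : restrictD F A C k φ = restrictD F A C k ψ) : φ = ψ := by
  rw [← sub_eq_zero]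
  refine eq_zero_of_mem_linMaps (sub_mem hφ hψ) fun u => ?_
  have := congrArg (fun γ => γ u) h
  simpa [sub_eq_zero] using this

theorem compMultilinearMap_mem_linMaps {σ : Fin k → A →ₐ[F] Module.End F C} {f : Module.End F C}
    (hf : ∀ i a, Commute f (σ i a)) {φ : MultilinearMap F (fun _ : Fin k => Ω[A⁄F]) C}
    (h : φ ∈ linMaps σ) : LinearMap.compMultilinearMap f φ ∈ linMaps σ := by
  intro i a u
  rw [LinearMap.compMultilinearMap_apply, h, LinearMap.compMultilinearMap_apply]
  exact congrArg (fun g : Module.End F C => g (φ u)) (hf i a)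

/-- Induction on the number of arguments. Fixing the first argument f and extending in the others
gives a linear map g from A to `linMaps`. It is a derivation because extensions are unique, and the
universal property extends it to Ω(A). The actions have to commute in order that σ 0 a preserve
linearity in the other arguments. -/
theorem exists_mem_linMaps (σ : Fin k → A →ₐ[F] Module.End F C)
    (hσ : ∀ i j a b, Commute (σ i a) (σ j b))
    {γ : MultilinearMap F (fun _ : Fin k => A) C} (h : γ ∈ derMaps σ) :
    ∃ φ ∈ linMaps σ, restrictD F A C k φ = γ := by
  induction k with
  | zero =>
    refine ⟨MultilinearMap.constOfIsEmpty F _ (γ 0), fun i => i.elim0, ?_⟩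
    ext u
    exact congrArg γ (Subsingleton.elim _ _)
  | succ k ih =>
    let σ' : Fin k → A →ₐ[F] Module.End F C := fun i => σ i.succ
    let r : linMaps σ' →ₗ[F] derMaps σ' :=
      (restrictD F A C k).restrict fun φ hφ => restrictD_mem hφ
    have hr : Function.Bijective r := by
      refine ⟨fun φ ψ hφψ => Subtype.ext (linMaps_ext φ.2 ψ.2 (congrArg Subtype.val hφψ)), ?_⟩
      rintro ⟨γ, hγ⟩
      obtain ⟨φ, hφ, h⟩ := ih σ' (fun i j => hσ i.succ j.succ) hγ
      exact ⟨⟨φ, hφ⟩, Subtype.ext h⟩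
    let e := LinearEquiv.ofBijective r hr
    have hg : ∀ f, γ.curryLeft f ∈ derMaps σ' := by
      intro f i b c u
      have := h i.succ b c (Fin.cons f u)
      simp only [← Fin.cons_update] at this
      exact this
    let g : A →ₗ[F] linMaps σ' := e.symm.toLinearMap ∘ₗ γ.curryLeft.codRestrict _ hg
    have hres : ∀ f, restrictD F A C k (g f).1 = γ.curryLeft f := fun f =>
      congrArg Subtype.val (e.apply_symm_apply (γ.curryLeft.codRestrict _ hg f))
    -- Both sides are linear and have the same restriction to A, so uniqueness of extensions
    -- applies.
    have hmul : ∀ a b, (g (a * b)).1 = (σ 0 a).compMultilinearMap (g b).1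
        + (σ 0 b).compMultilinearMap (g a).1 := by
      intro a b
      refine linMaps_ext (g (a * b)).2 (add_mem
        (compMultilinearMap_mem_linMaps (fun i c => hσ 0 i.succ a c) (g b).2)
        (compMultilinearMap_mem_linMaps (fun i c => hσ 0 i.succ b c) (g a).2)) ?_
      have hc : ∀ a b, restrictD F A C k ((σ 0 a).compMultilinearMap (g b).1)
          = (σ 0 a).compMultilinearMap (γ.curryLeft b) := fun a b => by rw [← hres]; rfl
      rw [map_add, hres, hc, hc]
      ext u
      have := h 0 a b (Fin.cons 0 u)
      simp only [Fin.update_cons_zero] at this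
      exact this
    let B : A →ₗ[F] A →ₗ[F] MultilinearMap F (fun _ : Fin k => Ω[A⁄F]) C :=
      LinearMap.mk₂ F (fun a f => (σ 0 a).compMultilinearMap (g f).1)
        (fun a b f => by ext u; simp) (fun c a f => by ext u; simp)
        (fun a f f' => by ext u; simp) (fun c a f => by ext u; simp)
    have hB : ∀ a f f', B a (f * f') = B (a * f) f' + B (a * f') f := by
      intro a f f'
      ext u
      simp [B, hmul]
    have hsmul : ∀ (a : A) (ω : Ω[A⁄F]), kaehlerLift B hB (a • ω)
        = (σ 0 a).compMultilinearMap (kaehlerLift B hB ω) := by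
      intro a ω
      induction ω using kaehler_induction_smul_D with
      | D b f =>
        rw [smul_smul, kaehlerLift_smul_D, kaehlerLift_smul_D]
        ext u
        simp [B]
      | add x y hx hy =>
        rw [smul_add, map_add, hx, hy, map_add]
        ext u
        simp
    have hmem : ∀ ω, kaehlerLift B hB ω ∈ linMaps σ' := by
      intro ω
      induction ω using kaehler_induction_smul_D with
      | D b f =>
        rw [kaehlerLift_smul_D]
        exact compMultilinearMap_mem_linMaps (fun i c => hσ 0 i.succ b c) (g f).2
      | add x y hx hy => rw [map_add]; exact add_mem hx hy
    refine ⟨(kaehlerLift B hB).uncurryLeft, fun i a u => ?_, ?_⟩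
    · rw [LinearMap.uncurryLeft_apply, LinearMap.uncurryLeft_apply]
      refine Fin.cases ?_ (fun i => ?_) i
      · rw [Function.update_self, hsmul, LinearMap.compMultilinearMap_apply, Fin.tail_update_zero]
      · rw [Function.update_of_ne (Fin.succ_ne_zero i).symm, Fin.tail_update_succ]
        exact hmem (u 0) i a (Fin.tail u)
    · ext u
      rw [restrictD_apply, LinearMap.uncurryLeft_apply, kaehlerLift_D]
      have h1 : B 1 (u 0) = (g (u 0)).1 := by
        ext v
        simp [B]
      rw [h1]
      have := congrArg (fun ψ => ψ (Fin.tail u)) (hres (u 0))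
      simp only [restrictD_apply, MultilinearMap.curryLeft_apply, Fin.cons_self_tail] at this
      exact this

theorem apply_smul_of_mem_linMaps {σ : Fin k → A →ₐ[F] Module.End F C}
    {φ : MultilinearMap F (fun _ : Fin k => Ω[A⁄F]) C} (h : φ ∈ linMaps σ) (a : Fin k → A)
    (u : Fin k → Ω[A⁄F]) :
    φ (fun i => a i • u i) = (List.ofFn fun i => σ i (a i)).prod (φ u) := by
  induction k with
  | zero => simp [Subsingleton.elim (fun i => a i • u i) u]
  | succ k ih =>
    have e : (fun i => a i • u i) = Fin.cons (a 0 • u 0) (fun i : Fin k => a i.succ • u i.succ) := by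
      funext i
      refine Fin.cases rfl (fun i => rfl) i
    have := ih (curryLeft_mem_linMaps h (u 0)) (fun i => a i.succ) (fun i => u i.succ)
    rw [MultilinearMap.curryLeft_apply, MultilinearMap.curryLeft_apply] at this
    rw [e, apply_cons_smul h, this, List.ofFn_succ, List.prod_cons, Module.End.mul_apply]
    congr 3
    exact Fin.cons_self_tail u

end KaehlerMultilinear

/-! ### Restriction of cochains from Ω(V) to V. -/

section Cochains

variable {F : Type*} [Field F] {V : Type*} [CommRing V] [Algebra F V] {D : Derivation F V V}
variable {M : Type*} [AddCommGroup M] [Module F M] [Module V M] [IsScalarTower F V M]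
variable (dM : DiffModule D M) {k : ℕ}

theorem shiftCoeff_mk (i : Fin k) (a : V) (x : MvPolynomial (Fin k) F ⊗[F] M) :
    shiftCoeff dM i a (Submodule.Quotient.mk x)
      = Submodule.Quotient.mk (shift D (addVarAt i) a x) := rfl

/-- The action of `V` on the space of values of cochains that corresponds to the `i`-th
argument. -/
def coeffAction (i : Fin k) : V →ₐ[F] Module.End F (Coeff dM.der k) :=
  AlgHom.ofLinearMap
    { toFun := shiftCoeff dM i
      map_add' := fun a b => by
        refine LinearMap.ext fun x => ?_
        obtain ⟨x, rfl⟩ := Submodule.Quotient.mk_surjective _ x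
        simp only [LinearMap.add_apply, shiftCoeff_mk, shift_add_left, Submodule.Quotient.mk_add]
      map_smul' := fun c a => by
        refine LinearMap.ext fun x => ?_
        obtain ⟨x, rfl⟩ := Submodule.Quotient.mk_surjective _ x
        simp only [LinearMap.smul_apply, shiftCoeff_mk, shift_smul_left, RingHom.id_apply,
          Submodule.Quotient.mk_smul] }
    (by
      refine LinearMap.ext fun x => ?_
      obtain ⟨x, rfl⟩ := Submodule.Quotient.mk_surjective _ x
      simp [shiftCoeff_mk, (isTranslation_addVarAt i).shift_one])
    (fun a b => by
      refine LinearMap.ext fun x => ?_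
      obtain ⟨x, rfl⟩ := Submodule.Quotient.mk_surjective _ x
      simp [shiftCoeff_mk, (isTranslation_addVarAt i).shift_mul])

theorem coeffAction_apply (i : Fin k) (a : V) : coeffAction dM i a = shiftCoeff dM i a := rfl

theorem commute_coeffAction (i j : Fin k) (a b : V) :
    Commute (coeffAction dM i a) (coeffAction dM j b) := by
  refine LinearMap.ext fun x => ?_
  obtain ⟨x, rfl⟩ := Submodule.Quotient.mk_surjective _ x
  simp only [Module.End.mul_apply, coeffAction_apply, shiftCoeff_mk]
  rw [(isTranslation_addVarAt i).shift_comm (isTranslation_addVarAt j)]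

theorem shiftCoeff_X_smul (i j : Fin k) (a : V) (x : Coeff dM.der k) :
    shiftCoeff dM i a ((MvPolynomial.X j : MvPolynomial (Fin k) F) • x)
      = (MvPolynomial.X j : MvPolynomial (Fin k) F) • shiftCoeff dM i a x
        + if j = i then shiftCoeff dM i (D a) x else 0 := by
  obtain ⟨x, rfl⟩ := Submodule.Quotient.mk_surjective _ x
  rw [← Submodule.Quotient.mk_smul, shiftCoeff_mk, shiftCoeff_mk, shiftCoeff_mk,
    shift_smul_of_eq (c := if j = i then 1 else 0) (by by_cases h : j = i <;> simp [addVarAt, h])]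
  by_cases h : j = i <;> simp [h]

theorem changeVar_shift {S S' : Type*} [CommRing S] [Algebra F S] [CommRing S'] [Algebra F S']
    {f : S →ₐ[F] S'} {τ : S →ₐ[F] S[X]} {τ' : S' →ₐ[F] S'[X]}
    (h : (Polynomial.mapAlgHom f).comp τ = τ'.comp f) (a : V) (x : S ⊗[F] M) :
    changeVar M f (shift D τ a x) = shift D τ' a (changeVar M f x) := by
  rw [shift_eq_substDer, shift_eq_substDer, changeVar_substDer, changeVar_changeVar,
    changeVar_changeVar, h]

theorem permCoeff_mk (dM : Module.End F M) (π : Equiv.Perm (Fin k))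
    (x : MvPolynomial (Fin k) F ⊗[F] M) : permCoeff dM π (Submodule.Quotient.mk x)
      = Submodule.Quotient.mk (changeVar M (MvPolynomial.rename π) x) := rfl

theorem permCoeff_shiftCoeff (π : Equiv.Perm (Fin k)) (i : Fin k) (a : V) (x : Coeff dM.der k) :
    permCoeff dM.der π (shiftCoeff dM i a x) = shiftCoeff dM (π i) a (permCoeff dM.der π x) := by
  obtain ⟨x, rfl⟩ := Submodule.Quotient.mk_surjective _ x
  rw [shiftCoeff_mk, permCoeff_mk, permCoeff_mk, shiftCoeff_mk, changeVar_shift]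
  ext j : 1
  by_cases h : j = i <;> simp [addVarAt, h]

theorem mem_linMaps_of_mem_lcadCochains {φ : PreCochain Ω[V⁄F] dM.der k}
    (h : φ ∈ lcadCochains (kaehlerModule D) dM k) : φ ∈ linMaps (coeffAction dM) := h.2.1

/-- Neither φ(…, ∂uᵢ, …) nor λᵢ φ is linear in the i-th argument, but their sum is: the summand (∂a)
uᵢ of ∂(a uᵢ) accounts for the shift of λᵢ by ∂ acting on a. The sum therefore vanishes if it does
on differentials. -/
theorem isSesquilinear_of_mem_linMaps {φ : PreCochain Ω[V⁄F] dM.der k}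
    (h : φ ∈ linMaps (coeffAction dM))
    (hs : IsSesquilinear (D : Module.End F V) (restrictD F V (Coeff dM.der k) k φ)) :
    IsSesquilinear (kaehlerModule D).der φ := by
  intro i
  let ψ : PreCochain Ω[V⁄F] dM.der k :=
    φ.compLinearMap (Function.update (fun _ => LinearMap.id) i (kaehlerModule D).der)
  let χ : PreCochain Ω[V⁄F] dM.der k := (Algebra.lsmul F F (Coeff dM.der k)
    (MvPolynomial.X i : MvPolynomial (Fin k) F)).compMultilinearMap φ
  have hψ : ∀ u, ψ u = φ (Function.update u i ((kaehlerModule D).der (u i))) := by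
    intro u
    rw [MultilinearMap.compLinearMap_apply]
    congr 1
    funext j
    by_cases hj : j = i
    · subst hj; simp
    · simp [hj]
  have hχ : ∀ u, χ u = (MvPolynomial.X i : MvPolynomial (Fin k) F) • φ u := fun u => rfl
  have h' : ∀ (j : Fin k) (a : V) (v : Fin k → Ω[V⁄F]) (ω : Ω[V⁄F]),
      φ (Function.update v j (a • ω)) = shiftCoeff dM j a (φ (Function.update v j ω)) := by
    intro j a v ω
    have := h j a (Function.update v j ω)
    simpa [coeffAction_apply] using this
  have hmem : ψ + χ ∈ linMaps (coeffAction dM) := by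
    intro j a u
    rw [add_apply, add_apply, hψ, hψ, hχ, hχ, h j, map_add,
      coeffAction_apply, shiftCoeff_X_smul]
    by_cases hj : j = i
    · subst hj
      rw [Function.update_self, Function.update_idem, (kaehlerModule D).der_smul,
        MultilinearMap.map_update_add, h', h', Function.update_eq_self, if_pos rfl]
      abel
    · rw [Function.update_of_ne (Ne.symm hj), Function.update_comm hj, if_neg (Ne.symm hj),
        add_zero]
      congr 1
      have := h' j a (Function.update u i ((kaehlerModule D).der (u i))) (u j)
      rw [this, Function.update_comm (Ne.symm hj), Function.update_eq_self]
  have h0 : ψ + χ = 0 := by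
    refine eq_zero_of_mem_linMaps hmem fun u => ?_
    have := hs i u
    rw [restrictD_update, restrictD_apply] at this
    rw [add_apply, hψ, hχ, ← eq_neg_iff_add_eq_zero, ← this]
    congr 2
    exact kaehlerDer_D D (u i)
  intro u
  rw [← hψ, ← hχ, eq_neg_iff_add_eq_zero, ← add_apply, h0,
    zero_apply]

/-- The permuted cochain is again linear, since permuting the variables permutes the shifts
accordingly, so the two cochains may be compared on differentials. -/
theorem isSkew_of_mem_linMaps {φ : PreCochain Ω[V⁄F] dM.der k}
    (h : φ ∈ linMaps (coeffAction dM))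
    (hs : IsSkew (restrictD F V (Coeff dM.der k) k φ)) : IsSkew φ := by
  intro π
  let ψ : PreCochain Ω[V⁄F] dM.der k := (Equiv.Perm.sign π : ℤ) •
    (permCoeff dM.der π).compMultilinearMap (φ.domDomCongr π)
  have hψ : ∀ u, ψ u = (Equiv.Perm.sign π : ℤ) • permCoeff dM.der π (φ (u ∘ π)) := fun u => rfl
  have hmem : ψ ∈ linMaps (coeffAction dM) := by
    intro i a u
    have e : Function.update u i (a • u i) ∘ π
        = Function.update (u ∘ π) (π.symm i) (a • (u ∘ π) (π.symm i)) := by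
      rw [Function.update_comp_equiv]
      simp
    rw [hψ, hψ, e, h, coeffAction_apply, permCoeff_shiftCoeff, Equiv.apply_symm_apply,
      coeffAction_apply, map_zsmul]
  have heq : φ = ψ := by
    refine linMaps_ext h hmem ?_
    ext u
    exact hs π u
  intro u
  rw [← hψ, ← heq]

/-- The restriction of cochains along `d : V → Ω(V)`. -/
def restrictCochains (k : ℕ) :
    lcadCochains (kaehlerModule D) dM k →ₗ[F] pvaCochains dM k :=
  (restrictD F V (Coeff dM.der k) k).restrict fun φ hφ => by
    refine ⟨fun i u => ?_, restrictD_mem (mem_linMaps_of_mem_lcadCochains dM hφ), fun π u => ?_⟩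
    · rw [restrictD_update, restrictD_apply, ← hφ.1 i]
      congr 2
      exact (kaehlerDer_D D (u i)).symm
    · exact hφ.2.2 π _

theorem restrictCochains_bijective (k : ℕ) : Function.Bijective (restrictCochains dM k) := by
  constructor
  · intro φ ψ h
    exact Subtype.ext (linMaps_ext (mem_linMaps_of_mem_lcadCochains dM φ.2)
      (mem_linMaps_of_mem_lcadCochains dM ψ.2) (congrArg Subtype.val h))
  · rintro ⟨γ, h1, h2, h3⟩
    obtain ⟨φ, hφ, rfl⟩ := exists_mem_linMaps (coeffAction dM) (commute_coeffAction dM) h2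
    exact ⟨⟨φ, isSesquilinear_of_mem_linMaps dM hφ h1, hφ, isSkew_of_mem_linMaps dM hφ h3⟩, rfl⟩

end Cochains

/-! ### Naturality of the differential. -/

section Differential

variable {F : Type*} [Field F]
variable {E : Type*} [AddCommGroup E] [Module F E] {E' : Type*} [AddCommGroup E'] [Module F E']
variable {M : Type*} [AddCommGroup M] [Module F M]
variable {dE : Module.End F E} {dE' : Module.End F E'} {dM : Module.End F M}

theorem actCoeff_mk (act : LambdaProduct dE dM) {k : ℕ} (i : Fin (k + 1)) (u : E)
    (x : MvPolynomial (Fin k) F ⊗[F] M) : actCoeff act i u (Submodule.Quotient.mk x)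
      = Submodule.Quotient.mk (extend act.prod (MvPolynomial.X i : MvPolynomial (Fin (k + 1)) F)
        (1 ⊗ₜ u) (changeVar M (MvPolynomial.rename i.succAbove) x)) := rfl

/-- The differential is natural with respect to the homomorphisms of Lie conformal algebras. -/
theorem differential_compLinearMap {br : LambdaProduct dE dE} {act : LambdaProduct dE dM}
    {br' : LambdaProduct dE' dE'} {act' : LambdaProduct dE' dM} (f : E' →ₗ[F] E)
    (hbr : ∀ u v, br.prod (f u) (f v) = f.lTensor F[X] (br'.prod u v))
    (hact : ∀ u m, act.prod (f u) m = act'.prod u m) (k : ℕ) (φ : PreCochain E dM k) :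
    differential br' act' k (φ.compLinearMap fun _ => f)
      = (differential br act k φ).compLinearMap fun _ => f := by
  have h1 : ∀ i, actTerm act' i (φ.compLinearMap fun _ => f)
      = (actTerm act i φ).compLinearMap fun _ => f := by
    intro i
    ext u
    rw [MultilinearMap.compLinearMap_apply, actTerm_apply, actTerm_apply,
      MultilinearMap.compLinearMap_apply]
    obtain ⟨x, hx⟩ := Submodule.Quotient.mk_surjective _ (φ fun t => f (u (i.succAbove t)))
    rw [← hx, actCoeff_mk, actCoeff_mk]
    congr 1
    induction changeVar M (MvPolynomial.rename i.succAbove) x with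
    | zero => simp
    | add x y hx hy => simp only [map_add, hx, hy]
    | tmul p m => rw [extend_tmul, extend_tmul, hact]
  change diffAct act' k _ + diffBracket br' k _
    = (diffAct act k φ + diffBracket br k φ).compLinearMap _
  ext u
  rw [MultilinearMap.compLinearMap_apply, add_apply, add_apply]
  congr 1
  · simp only [diffAct, sum_apply, smul_apply, h1,
      MultilinearMap.compLinearMap_apply]
  · cases k with
    | zero => rfl
    | succ m =>
      have h2 : ∀ i j, bracketTerm br' i j (φ.compLinearMap fun _ => f)
          = (bracketTerm br i j φ).compLinearMap fun _ => f := by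
        intro i j
        ext u
        rw [MultilinearMap.compLinearMap_apply, bracketTerm_apply, bracketTerm_apply, hbr]
        induction br'.prod (u (j.succAbove i)) (u j) with
        | zero => simp
        | add x y hx hy =>
          simp only [map_add, add_apply, hx, hy]
        | tmul p w =>
          rw [LinearMap.lTensor_tmul, insertFirst_tmul, insertFirst_tmul,
            MultilinearMap.compLinearMap_apply]
          congr 3
          funext t
          refine Fin.cases rfl (fun t => rfl) t
      simp only [diffBracket, sum_apply]
      refine Finset.sum_congr rfl fun j _ => Finset.sum_congr rfl fun i _ => ?_
      split_ifs
      · rw [smul_apply, smul_apply, h2,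
          MultilinearMap.compLinearMap_apply]
      · rfl

end Differential


/-! ### The Chevalley–Eilenberg differential on functions of several variables

`Y` is a type with a bracket, which acts on the additive group `N`. -/

namespace CE

variable {Y N : Type*}

/-- Insertion of an element as the first argument. -/
def ins {k : ℕ} (y : Y) (Φ : (Fin (k + 1) → Y) → N) : (Fin k → Y) → N :=
  fun z => Φ (Fin.cons y z)

theorem ext_ins {k : ℕ} {Φ Ψ : (Fin (k + 1) → Y) → N} (h : ∀ y, ins y Φ = ins y Ψ) : Φ = Ψ := by
  funext z
  have := congrFun (h (z 0)) (Fin.tail z)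
  simpa [ins] using this

variable [AddCommGroup N]

section Defs

variable (br : Y → Y → Y) (act : Y → N →+ N)

/-- The Lie derivative. -/
def lie {k : ℕ} (y : Y) (Φ : (Fin k → Y) → N) : (Fin k → Y) → N :=
  fun z => act y (Φ z) - ∑ i, Φ (Function.update z i (br y (z i)))

/-- The differential, defined recursively by Cartan's formula `ι_y d = L_y - d ι_y`. -/
def diff : (k : ℕ) → ((Fin k → Y) → N) → ((Fin (k + 1) → Y) → N)
  | 0, Φ => fun y => lie br act (y 0) Φ (Fin.tail y)
  | k + 1, Φ => fun y => lie br act (y 0) Φ (Fin.tail y) - diff k (ins (y 0) Φ) (Fin.tail y)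

/-- The Jacobi identity for the brackets with the arguments of `Φ`. -/
def IsJacobi {k : ℕ} (Φ : (Fin k → Y) → N) : Prop :=
  ∀ (i : Fin k) (z : Fin k → Y) (x y w : Y), Φ (Function.update z i (br x (br y w)))
    = Φ (Function.update z i (br (br x y) w)) + Φ (Function.update z i (br y (br x w)))

/-- Skewsymmetry of the bracket, inside of `Φ`. -/
def IsAnti {k : ℕ} (Φ : (Fin k → Y) → N) : Prop :=
  ∀ (i : Fin k) (z : Fin k → Y) (x y : Y),
    Φ (Function.update z i (br x y)) = -Φ (Function.update z i (br y x))

/-- Skewsymmetry of a function. -/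
def IsSkewFun {k : ℕ} (Φ : (Fin k → Y) → N) : Prop :=
  ∀ (π : Equiv.Perm (Fin k)) (z : Fin k → Y), Φ (z ∘ π) = (Equiv.Perm.sign π : ℤ) • Φ z

end Defs

variable {br : Y → Y → Y} {act : Y → N →+ N} {k : ℕ}

theorem ins_diff_zero (y : Y) (Φ : (Fin 0 → Y) → N) :
    ins y (diff br act 0 Φ) = lie br act y Φ := rfl

theorem ins_diff_succ (y : Y) (Φ : (Fin (k + 1) → Y) → N) :
    ins y (diff br act (k + 1) Φ) = lie br act y Φ - diff br act k (ins y Φ) := rfl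

theorem lie_sub (y : Y) (Φ Ψ : (Fin k → Y) → N) :
    lie br act y (Φ - Ψ) = lie br act y Φ - lie br act y Ψ := by
  funext z
  simp only [lie, Pi.sub_apply, map_sub, Finset.sum_sub_distrib]
  abel

theorem ins_sub (y : Y) (Φ Ψ : (Fin (k + 1) → Y) → N) : ins y (Φ - Ψ) = ins y Φ - ins y Ψ := rfl

theorem diff_sub (Φ Ψ : (Fin k → Y) → N) :
    diff br act k (Φ - Ψ) = diff br act k Φ - diff br act k Ψ := by
  induction k with
  | zero =>
    refine ext_ins fun y => ?_
    rw [ins_sub, ins_diff_zero, ins_diff_zero, ins_diff_zero, lie_sub]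
  | succ k ih =>
    refine ext_ins fun y => ?_
    rw [ins_sub, ins_diff_succ, ins_diff_succ, ins_diff_succ, lie_sub, ins_sub, ih]
    abel

theorem diff_zero : diff br act k 0 = 0 := by
  have := diff_sub (br := br) (act := act) (0 : (Fin k → Y) → N) 0
  rwa [sub_zero, sub_self] at this

theorem diff_neg (Φ : (Fin k → Y) → N) : diff br act k (-Φ) = -diff br act k Φ := by
  rw [← zero_sub, diff_sub, diff_zero, zero_sub]

/-- This is Cartan's relation between L_x and ι_y: the summand of the Lie derivative that belongs to
the first argument is split off. -/
theorem ins_lie (x y : Y) (Φ : (Fin (k + 1) → Y) → N) :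
    ins y (lie br act x Φ) = lie br act x (ins y Φ) - ins (br x y) Φ := by
  funext z
  simp only [ins, lie, Fin.sum_univ_succ, Fin.cons_zero, Fin.update_cons_zero, Fin.cons_succ,
    ← Fin.cons_update, Pi.sub_apply]
  abel

theorem IsJacobi.ins {Φ : (Fin (k + 1) → Y) → N} (h : IsJacobi br Φ) (y : Y) :
    IsJacobi br (CE.ins y Φ) := by
  intro i z a b c
  have := h i.succ (Fin.cons y z) a b c
  simp only [← Fin.cons_update] at this
  exact this

theorem IsAnti.ins {Φ : (Fin (k + 1) → Y) → N} (h : IsAnti br Φ) (y : Y) :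
    IsAnti br (CE.ins y Φ) := by
  intro i z a b
  have := h i.succ (Fin.cons y z) a b
  simp only [← Fin.cons_update] at this
  exact this

/-- In the commutator, the terms in which x and y meet different arguments cancel, and those in
which they meet the same argument combine by the Jacobi identity inside Φ. -/
theorem lie_lie (hact : ∀ x y n, act (br x y) n = act x (act y n) - act y (act x n))
    {Φ : (Fin k → Y) → N} (h : IsJacobi br Φ) (x y : Y) :
    lie br act x (lie br act y Φ) - lie br act y (lie br act x Φ) = lie br act (br x y) Φ := by
  funext z
  -- T a b i j is Φ after [a, ·] has been applied to the argument i and then [b, ·] to the argument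
  -- j; for i ≠ j the order does not matter.
  let T (a b : Y) (i j : Fin k) : N := Φ (Function.update (Function.update z i (br a (z i))) j
    (br b (Function.update z i (br a (z i)) j)))
  have hT : ∀ i j, T x y i j - T y x j i
      = if i = j then -Φ (Function.update z i (br (br x y) (z i))) else 0 := by
    intro i j
    by_cases hij : i = j
    · subst hij
      simp only [T, Function.update_self, Function.update_idem, if_true, h i z x y (z i)]
      abel
    · simp only [T, if_neg hij, Function.update_of_ne hij, Function.update_of_ne (Ne.symm hij)]
      rw [Function.update_comm hij, sub_self]
  have hsum : ∑ i, ∑ j, T x y i j - ∑ i, ∑ j, T y x i j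
      = -∑ i, Φ (Function.update z i (br (br x y) (z i))) := by
    rw [Finset.sum_comm (f := fun i j => T y x i j)]
    simp only [← Finset.sum_sub_distrib, hT, Finset.sum_ite_eq, Finset.mem_univ, if_true,
      Finset.sum_neg_distrib]
  have e : ∀ a b, lie br act a (lie br act b Φ) z
      = act a (act b (Φ z)) - ∑ i, act a (Φ (Function.update z i (br b (z i))))
        - ∑ i, act b (Φ (Function.update z i (br a (z i)))) + ∑ i, ∑ j, T a b i j := by
    intro a b
    simp only [lie, map_sub, map_sum, Finset.sum_sub_distrib, T]
    abel
  rw [Pi.sub_apply, e, e, lie, hact, sub_eq_add_neg _ (∑ i, Φ _), ← hsum]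
  abel

/-- Induction on the number of arguments: contraction with y reduces the claim to the relations
between L_x, L_y and ι_y and to the claim for ι_y Φ. -/
theorem lie_diff (hact : ∀ x y n, act (br x y) n = act x (act y n) - act y (act x n))
    {Φ : (Fin k → Y) → N} (h : IsJacobi br Φ) (x : Y) :
    lie br act x (diff br act k Φ) = diff br act k (lie br act x Φ) := by
  induction k generalizing x with
  | zero =>
    refine ext_ins fun y => ?_
    rw [ins_lie, ins_diff_zero, ins_diff_zero, ins_diff_zero, ← lie_lie hact h x y]
    abel
  | succ k ih =>
    refine ext_ins fun y => ?_
    rw [ins_lie, ins_diff_succ, ins_diff_succ, ins_diff_succ, lie_sub, ins_lie, diff_sub,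
      ih (h.ins y) x, ← lie_lie hact h x y]
    abel

/-- The square of the differential is zero. -/
theorem diff_diff (hact : ∀ x y n, act (br x y) n = act x (act y n) - act y (act x n))
    {Φ : (Fin k → Y) → N} (h : IsJacobi br Φ) :
    diff br act (k + 1) (diff br act k Φ) = 0 := by
  induction k with
  | zero =>
    refine ext_ins fun y => ?_
    rw [ins_diff_succ, ins_diff_zero, lie_diff hact h, sub_self]
    rfl
  | succ k ih =>
    refine ext_ins fun y => ?_
    -- ι_y d d = L_y d − d ι_y d = L_y d − d L_y + d d ι_y. The first two terms cancel and the last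
    -- vanishes by induction.
    rw [ins_diff_succ, ins_diff_succ, lie_diff hact h, diff_sub, ih (h.ins y), sub_zero, sub_self]
    rfl

theorem isSkewFun_of_swap {Φ : (Fin (k + 1) → Y) → N}
    (h : ∀ (i : Fin k) (z : Fin (k + 1) → Y), Φ (z ∘ Equiv.swap i.castSucc i.succ) = -Φ z) :
    IsSkewFun Φ := by
  intro π
  have hπ : π ∈ Submonoid.closure
      (Set.range fun i : Fin k => Equiv.swap i.castSucc i.succ) := by
    rw [Equiv.Perm.mclosure_swap_castSucc_succ]
    trivial
  induction hπ using Submonoid.closure_induction with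
  | mem π hπ =>
    obtain ⟨i, rfl⟩ := hπ
    intro z
    rw [h, Equiv.Perm.sign_swap (Fin.castSucc_lt_succ).ne]
    simp
  | one => intro z; simp
  | mul π π' _ _ hπ hπ' =>
    intro z
    rw [Equiv.Perm.coe_mul, ← Function.comp_assoc, hπ', hπ, smul_smul, map_mul, mul_comm]
    simp

theorem isSkewFun_of_subsingleton {Φ : (Fin 1 → Y) → N} : IsSkewFun Φ :=
  isSkewFun_of_swap fun i => i.elim0

/-- An adjacent transposition either exchanges the first two arguments or fixes the first one. -/
theorem isSkewFun_of_ins {Φ : (Fin (k + 2) → Y) → N} (h : ∀ y, IsSkewFun (ins y Φ))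
    (h' : ∀ x y z, Φ (Fin.cons x (Fin.cons y z)) = -Φ (Fin.cons y (Fin.cons x z))) :
    IsSkewFun Φ := by
  refine isSkewFun_of_swap fun i z => ?_
  obtain ⟨x, z, rfl⟩ : ∃ x z', z = Fin.cons x z' := ⟨_, _, (Fin.cons_self_tail z).symm⟩
  refine Fin.cases ?_ (fun i => ?_) i
  · obtain ⟨y, z, rfl⟩ : ∃ y z', z = Fin.cons y z' := ⟨_, _, (Fin.cons_self_tail z).symm⟩
    rw [h' x y z, neg_neg]
    congr 1
    funext j
    refine Fin.cases ?_ (fun j => Fin.cases ?_ (fun j => ?_) j) j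
    · simp
    · simp only [Function.comp_apply, Fin.castSucc_zero]
      rw [Equiv.swap_apply_right]
      rfl
    · rw [Function.comp_apply, Equiv.swap_apply_of_ne_of_ne]
      · rfl
      · exact Fin.succ_ne_zero _
      · exact fun h => Fin.succ_ne_zero _ (Fin.succ_injective _ h)
  · have := h x (Equiv.swap i.castSucc i.succ) z
    rw [Equiv.Perm.sign_swap (Fin.castSucc_lt_succ).ne] at this
    simp only [ins, Units.val_neg, Units.val_one, neg_smul, one_smul] at this
    rw [← this]
    congr 1
    funext j
    refine Fin.cases ?_ (fun j => ?_) j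
    · rw [Function.comp_apply, Equiv.swap_apply_of_ne_of_ne]
      · rfl
      · rw [← Fin.succ_castSucc]
        exact (Fin.succ_ne_zero _).symm
      · exact (Fin.succ_ne_zero _).symm
    · rw [Function.comp_apply, ← Fin.succ_castSucc, Fin.cons_succ, Function.comp_apply,
        (Fin.succ_injective _).swap_apply, Fin.cons_succ]

theorem IsSkewFun.ins {Φ : (Fin (k + 1) → Y) → N} (h : IsSkewFun Φ) (y : Y) :
    IsSkewFun (CE.ins y Φ) := by
  intro π z
  -- This permutation fixes the first argument and acts as π on the others, with the same sign.
  have := h (Equiv.Perm.decomposeFin.symm (0, π)) (Fin.cons y z)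
  rw [Equiv.Perm.decomposeFin.symm_sign, if_pos rfl, one_mul] at this
  rw [CE.ins, CE.ins, ← this]
  congr 1
  funext j
  refine Fin.cases ?_ (fun j => ?_) j
  · simp
  · simp

theorem IsSkewFun.cons_cons {Φ : (Fin (k + 2) → Y) → N} (h : IsSkewFun Φ) (x y : Y)
    (z : Fin k → Y) : Φ (Fin.cons x (Fin.cons y z)) = -Φ (Fin.cons y (Fin.cons x z)) := by
  have := h (Equiv.swap 0 1) (Fin.cons y (Fin.cons x z))
  rw [Equiv.Perm.sign_swap (by simp)] at this
  simp only [Units.val_neg, Units.val_one, neg_smul, one_smul] at this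
  rw [← this]
  congr 1
  funext j
  refine Fin.cases ?_ (fun j => Fin.cases ?_ (fun j => ?_) j) j
  · simp
  · rw [Function.comp_apply, Fin.succ_zero_eq_one, Equiv.swap_apply_right]
    rfl
  · rw [Function.comp_apply, Equiv.swap_apply_of_ne_of_ne]
    · rfl
    · exact Fin.succ_ne_zero _
    · exact fun h => Fin.succ_ne_zero _ (Fin.succ_injective _ h)

/-- Moving the argument at position j to the front is a cycle of sign (−1)^j. -/
theorem IsSkewFun.cons_succAbove {Φ : (Fin (k + 1) → Y) → N} (h : IsSkewFun Φ) (j : Fin (k + 1))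
    (w : Y) (z : Fin (k + 1) → Y) :
    Φ (Fin.cons w fun t => z (j.succAbove t)) = (-1 : ℤ) ^ (j : ℕ) • Φ (Function.update z j w) := by
  have := h j.cycleRange.symm (Function.update z j w)
  rw [Equiv.Perm.sign_symm, Fin.sign_cycleRange] at this
  push_cast at this
  rw [← this]
  congr 1
  funext t
  refine Fin.cases ?_ (fun t => ?_) t
  · simp
  · simp [Fin.succAbove_ne]

theorem IsSkewFun.lie {Φ : (Fin k → Y) → N} (h : IsSkewFun Φ) (x : Y) :
    IsSkewFun (CE.lie br act x Φ) := by
  intro π z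
  have e : ∀ i, Φ (Function.update (z ∘ π) i (br x (z (π i))))
      = (Equiv.Perm.sign π : ℤ) • Φ (Function.update z (π i) (br x (z (π i)))) := by
    intro i
    rw [← h, Function.update_comp_equiv, Equiv.symm_apply_apply]
  simp only [CE.lie, Function.comp_apply, e, h π z, map_zsmul]
  rw [← Finset.smul_sum, Equiv.sum_comp π fun i => Φ (Function.update z i (br x (z i))), smul_sub]

theorem IsSkewFun.sub {Φ Ψ : (Fin k → Y) → N} (h : IsSkewFun Φ) (h' : IsSkewFun Ψ) :
    IsSkewFun (Φ - Ψ) := by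
  intro π z
  rw [Pi.sub_apply, Pi.sub_apply, h, h', smul_sub]

/-- The differential of a skewsymmetric function is skewsymmetric. -/
theorem IsSkewFun.diff {Φ : (Fin k → Y) → N} (h : IsSkewFun Φ) (hanti : IsAnti br Φ) :
    IsSkewFun (CE.diff br act k Φ) := by
  induction k with
  | zero => exact isSkewFun_of_subsingleton
  | succ k ih =>
    refine isSkewFun_of_ins (fun y => ?_) fun x y z => ?_
    · rw [ins_diff_succ]
      exact (h.lie y).sub (ih (h.ins y) (hanti.ins y))
    · have e : ∀ x y : Y, CE.diff br act (k + 1) Φ (Fin.cons x (Fin.cons y z))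
          = CE.ins y (CE.lie br act x Φ) z - CE.ins y (CE.diff br act k (CE.ins x Φ)) z :=
        fun x y => rfl
      -- Cartan's formulas give ι_y ι_x dΦ = L_x ι_y Φ − L_y ι_x Φ − ι_{[x,y]} Φ + d ι_y ι_x Φ, the
      -- last term being absent if Φ has one argument. Adding the expression with x and y exchanged
      -- gives zero by the skewsymmetry of Φ and of the bracket inside Φ.
      have ha := hanti 0 (Fin.cons x z) x y
      rw [Fin.update_cons_zero, Fin.update_cons_zero] at ha
      rw [eq_neg_iff_add_eq_zero, e, e, ins_lie, ins_lie]
      cases k with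
      | zero =>
        simp only [ins_diff_zero, Pi.sub_apply]
        simp only [CE.ins, ha]
        abel
      | succ k =>
        have hs : CE.ins y (CE.ins x Φ) = -CE.ins x (CE.ins y Φ) := by
          funext w
          exact h.cons_cons x y w
        simp only [ins_diff_succ, Pi.sub_apply, hs, diff_neg, Pi.neg_apply]
        have hx : ∀ y, CE.ins y Φ z = Φ (Fin.cons y z) := fun y => rfl
        rw [hx, hx, ha]
        abel

/-- Both terms of ι_x dΦ = L_x Φ − d ι_x Φ vanish for x ∈ Z. With Z the set of elements (∂ + s) w of
weight s, this yields the sesquilinearity of the differential. -/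
theorem diff_cons_eq_zero {Z : Set Y} (hact : ∀ x ∈ Z, ∀ n, act x n = 0)
    (hbr : ∀ x ∈ Z, ∀ y, br x y ∈ Z) {Φ : (Fin k → Y) → N}
    (h : ∀ (i : Fin k) z, z i ∈ Z → Φ z = 0) {x : Y} (hx : x ∈ Z) (z : Fin k → Y) :
    diff br act k Φ (Fin.cons x z) = 0 := by
  have h1 : lie br act x Φ z = 0 := by
    rw [lie, hact x hx, Finset.sum_eq_zero, sub_zero]
    intro i _
    exact h i _ (by simpa using hbr x hx _)
  cases k with
  | zero => exact h1
  | succ k =>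
    have h2 : ins x Φ = 0 := funext fun w => h 0 _ hx
    have := congrFun (ins_diff_succ (br := br) (act := act) x Φ) z
    rw [Pi.sub_apply, h1, h2, diff_zero] at this
    simpa [ins] using this

section Explicit

variable (br act)

/-- The first sum in the explicit formula for the differential. -/
def sumAct (k : ℕ) (Φ : (Fin k → Y) → N) (y : Fin (k + 1) → Y) : N :=
  ∑ i : Fin (k + 1), (-1 : ℤ) ^ (i : ℕ) • act (y i) (Φ fun t => y (i.succAbove t))

/-- The second sum in the explicit formula for the differential. -/
def sumBracket : (k : ℕ) → ((Fin k → Y) → N) → ((Fin (k + 1) → Y) → N)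
  | 0, _ => 0
  | m + 1, Φ => fun y => ∑ j : Fin (m + 2), ∑ i : Fin (m + 1),
      if i.castSucc < j then (-1 : ℤ) ^ ((i : ℕ) + (j : ℕ)) •
        Φ (Fin.cons (br (y (j.succAbove i)) (y j)) fun t => y (j.succAbove (i.succAbove t))) else 0

variable {br act}

theorem sumAct_cons (Φ : (Fin (k + 1) → Y) → N) (x : Y) (z : Fin (k + 1) → Y) :
    sumAct act (k + 1) Φ (Fin.cons x z) = act x (Φ z) - sumAct act k (ins x Φ) z := by
  rw [sumAct, Fin.sum_univ_succ, sumAct, sub_eq_add_neg, ← Finset.sum_neg_distrib]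
  congr 1
  · simp
  · refine Finset.sum_congr rfl fun i _ => ?_
    rw [Fin.val_succ, pow_succ, mul_neg_one, neg_smul, Fin.cons_succ, ins]
    congr 4
    funext t
    refine Fin.cases ?_ (fun t => ?_) t <;> simp

/-- Pairs that contain x give the sum of the Lie derivative: moving [x, z_j] from the front to the
position j costs (−1)^j, which leaves the sign −1 throughout. In the other pairs x becomes the first
argument after one transposition, which accounts for the second minus sign. -/
theorem sumBracket_cons {Φ : (Fin (k + 1) → Y) → N} (h : IsSkewFun Φ) (x : Y)
    (z : Fin (k + 1) → Y) : sumBracket br (k + 1) Φ (Fin.cons x z)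
      = -∑ j, Φ (Function.update z j (br x (z j))) - sumBracket br k (ins x Φ) z := by
  have h0 : ∀ i : Fin (k + 1), ¬i.castSucc < (0 : Fin (k + 2)) := by simp
  rw [sumBracket]
  beta_reduce
  rw [Fin.sum_univ_succ (n := k + 1)]
  simp only [h0, if_false, Finset.sum_const_zero, zero_add]
  rw [Finset.sum_congr rfl fun j _ => Fin.sum_univ_succ (n := k) _, Finset.sum_add_distrib,
    sub_eq_add_neg]
  congr 1
  · rw [← Finset.sum_neg_distrib]
    refine Finset.sum_congr rfl fun j _ => ?_
    rw [if_pos (by simp)]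
    have e : (fun t => (Fin.cons x z : Fin (k + 2) → Y)
        (j.succ.succAbove ((0 : Fin (k + 1)).succAbove t))) = fun t => z (j.succAbove t) := by
      funext t; simp
    rw [e, Fin.succ_succAbove_zero, Fin.cons_zero, Fin.cons_succ, h.cons_succAbove, smul_smul,
      ← pow_add, Fin.val_zero, zero_add, Fin.val_succ, add_right_comm, pow_succ,
      Even.neg_one_pow ⟨_, rfl⟩, one_mul, neg_smul, one_smul]
  · cases k with
    | zero => simp [sumBracket]
    | succ m =>
      rw [sumBracket, ← Finset.sum_neg_distrib]
      refine Finset.sum_congr rfl fun j _ => ?_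
      rw [← Finset.sum_neg_distrib]
      refine Finset.sum_congr rfl fun i _ => ?_
      simp only [← Fin.succ_castSucc, Fin.succ_lt_succ_iff]
      split_ifs with hij
      · have e : (fun t => (Fin.cons x z : Fin (m + 3) → Y)
            (j.succ.succAbove (i.succ.succAbove t)))
            = Fin.cons x fun t => z (j.succAbove (i.succAbove t)) := by
          funext t
          refine Fin.cases ?_ (fun t => ?_) t <;> simp
        rw [e, Fin.succ_succAbove_succ, Fin.cons_succ, Fin.cons_succ, h.cons_cons, ins, Fin.val_succ,
          Fin.val_succ, smul_neg, show (i : ℕ) + 1 + (j + 1) = i + j + 2 by ring, pow_add]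
        simp
      · simp

/-- The explicit formula for the differential. -/
theorem diff_eq_sum {Φ : (Fin k → Y) → N} (h : IsSkewFun Φ) (y : Fin (k + 1) → Y) :
    diff br act k Φ y = sumAct act k Φ y + sumBracket br k Φ y := by
  induction k with
  | zero =>
    simp only [diff, lie, sumAct, sumBracket]
    simp
    rfl
  | succ k ih =>
    obtain ⟨x, z, rfl⟩ : ∃ x z, y = Fin.cons x z := ⟨_, _, (Fin.cons_self_tail y).symm⟩
    change lie br act x Φ z - diff br act k (ins x Φ) z = _
    rw [sumAct_cons, sumBracket_cons h, ih (h.ins x), lie]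
    abel

end Explicit

end CE


/-! ### Extension of cochains to `S ⊗ E` -/

section BaseChange

variable {F : Type*} [Field F] {S : Type*} [CommRing S] [Algebra F S]
variable {E : Type*} [AddCommGroup E] [Module F E]
variable {C : Type*} [AddCommGroup C] [Module S C]

theorem multilinear_ext_one_tmul {k : ℕ} {f g : MultilinearMap S (fun _ : Fin k => S ⊗[F] E) C}
    (h : ∀ u : Fin k → E, f (fun i => 1 ⊗ₜ u i) = g (fun i => 1 ⊗ₜ u i)) : f = g := by
  let b := Module.Basis.ofVectorSpace F E
  refine Module.Basis.ext_multilinear (fun _ => Algebra.TensorProduct.basis S b) fun v => ?_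
  simpa using h fun i => b (v i)

variable [Module F C] [IsScalarTower F S C]

instance isScalarTower_multilinearMap (k : ℕ) :
    IsScalarTower F S (MultilinearMap S (fun _ : Fin k => S ⊗[F] E) C) where
  smul_assoc c s φ := MultilinearMap.ext fun x => smul_assoc c s (φ x)

variable (S) in
/-- The extension of an `F`-multilinear map on `E` to an `S`-multilinear map on `S ⊗ E`. -/
def multilinearExtension : (k : ℕ) → MultilinearMap F (fun _ : Fin k => E) C →ₗ[F]
    MultilinearMap S (fun _ : Fin k => S ⊗[F] E) C
  | 0 =>
    { toFun := fun φ => MultilinearMap.constOfIsEmpty S _ (φ 0)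
      map_add' := fun φ ψ => by ext; simp
      map_smul' := fun c φ => by ext; simp }
  | k + 1 =>
    { toFun := fun φ =>
        (LinearMap.liftBaseChange S (multilinearExtension k ∘ₗ φ.curryLeft)).uncurryLeft
      map_add' := fun φ ψ => by
        ext x
        simp only [LinearMap.uncurryLeft_apply, add_apply]
        induction x 0 using tensor_induction_smul with
        | one u =>
          have h : (φ + ψ).curryLeft u = φ.curryLeft u + ψ.curryLeft u := rfl
          simp [h]
        | add x y hx hy =>
          simp only [map_add, add_apply, hx, hy]
          abel
        | smul p x hx => simp only [map_smul, smul_apply, hx, smul_add]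
      map_smul' := fun c φ => by
        ext x
        simp only [LinearMap.uncurryLeft_apply, smul_apply, RingHom.id_apply]
        induction x 0 using tensor_induction_smul with
        | one u =>
          have h : (c • φ).curryLeft u = c • φ.curryLeft u := rfl
          simp [h]
        | add x y hx hy => simp only [map_add, add_apply, hx, hy, smul_add]
        | smul p x hx => simp only [map_smul, smul_apply, hx, smul_comm c p] }

@[simp] theorem multilinearExtension_one_tmul {k : ℕ} (φ : MultilinearMap F (fun _ : Fin k => E) C)
    (u : Fin k → E) : multilinearExtension S k φ (fun i => 1 ⊗ₜ u i) = φ u := by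
  induction k with
  | zero => exact congrArg φ (Subsingleton.elim _ _)
  | succ k ih =>
    change (LinearMap.liftBaseChange S (multilinearExtension S k ∘ₗ φ.curryLeft)) (1 ⊗ₜ u 0)
      (fun i : Fin k => 1 ⊗ₜ u i.succ) = _
    rw [LinearMap.liftBaseChange_tmul, one_smul, LinearMap.comp_apply, ih,
      MultilinearMap.curryLeft_apply]
    exact congrArg φ (Fin.cons_self_tail u)

end BaseChange

/-! ### The values of the extended cochains -/

section WeightSpace

variable {F : Type*} [Field F]
variable {E : Type*} [AddCommGroup E] [Module F E]
variable {M : Type*} [AddCommGroup M] [Module F M]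
variable {dE : Module.End F E} (dM : Module.End F M)
variable (S : Type*) [CommRing S] [Algebra F S]

/-- The functions on `S` with values at `t` in the image of `∂ + t`. -/
def weightRange : Submodule S (S → S ⊗[F] M) :=
  Submodule.pi Set.univ fun t => LinearMap.range (addDer dM t)

/-- The product over `t ∈ S` of the quotients of `S ⊗ M` by the images of `∂ + t`. -/
abbrev WeightSpace := (S → S ⊗[F] M) ⧸ weightRange dM S

variable {S}

open scoped Classical in
/-- The inclusion of the factor of weight `t`. -/
def weightIncl (t : S) : S ⊗[F] M →ₗ[S] WeightSpace dM S :=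
  (weightRange dM S).mkQ ∘ₗ LinearMap.single S (fun _ => S ⊗[F] M) t

theorem weightIncl_eq_zero_iff {t : S} {x : S ⊗[F] M} :
    weightIncl dM t x = 0 ↔ x ∈ LinearMap.range (addDer dM t) := by
  classical
  rw [weightIncl, LinearMap.comp_apply, Submodule.mkQ_apply, Submodule.Quotient.mk_eq_zero,
    weightRange, Submodule.mem_pi]
  constructor
  · intro h
    simpa using h t trivial
  · intro h s _
    by_cases hs : s = t
    · subst hs; simpa using h
    · simp [hs]

/-- The inclusion of the factor of weight `t`, on the quotient by the image of `∂ + t`. -/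
def weightInclQuot (t : S) : ModRange dM t →ₗ[S] WeightSpace dM S :=
  Submodule.liftQ _ (weightIncl dM t) fun _ hx => (weightIncl_eq_zero_iff dM).2 hx

theorem weightInclQuot_injective (t : S) : Function.Injective (weightInclQuot dM t) := by
  rw [injective_iff_map_eq_zero]
  intro x hx
  obtain ⟨x, rfl⟩ := Submodule.Quotient.mk_surjective _ x
  rw [Submodule.Quotient.mk_eq_zero]
  exact (weightIncl_eq_zero_iff dM).1 hx

/-- The values of cochains, evaluated at `λᵢ = s i`. -/
def evalCoeff {k : ℕ} (s : Fin k → S) : Coeff dM k →ₗ[F] WeightSpace dM S :=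
  (weightInclQuot dM (∑ i, s i)).restrictScalars F ∘ₗ
    mapQuot (changeVar M (MvPolynomial.aeval s)) fun x => by
      rw [changeVar_addDer]
      simp [varSum]

theorem evalCoeff_mk {k : ℕ} (s : Fin k → S) (x : MvPolynomial (Fin k) F ⊗[F] M) :
    evalCoeff dM s (Submodule.Quotient.mk x)
      = weightIncl dM (∑ i, s i) (changeVar M (MvPolynomial.aeval s) x) := rfl

theorem evalCoeff_smul {k : ℕ} (s : Fin k → S) (p : MvPolynomial (Fin k) F) (x : Coeff dM k) :
    evalCoeff dM s (p • x) = MvPolynomial.aeval s p • evalCoeff dM s x := by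
  obtain ⟨x, rfl⟩ := Submodule.Quotient.mk_surjective _ x
  rw [← Submodule.Quotient.mk_smul, evalCoeff_mk, evalCoeff_mk, changeVar_smul, map_smul]

theorem evalCoeff_permCoeff {k : ℕ} (s : Fin k → S) (π : Equiv.Perm (Fin k)) (x : Coeff dM k) :
    evalCoeff dM s (permCoeff dM π x) = evalCoeff dM (s ∘ π) x := by
  obtain ⟨x, rfl⟩ := Submodule.Quotient.mk_surjective _ x
  have h : (MvPolynomial.aeval s).comp (MvPolynomial.rename π)
      = (MvPolynomial.aeval (s ∘ π) : MvPolynomial (Fin k) F →ₐ[F] S) :=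
    MvPolynomial.algHom_ext fun i => by simp
  rw [permCoeff_mk, evalCoeff_mk, evalCoeff_mk, changeVar_changeVar, h, ← Equiv.sum_comp π]
  rfl

/-- Evaluation at the variables themselves loses nothing, so identities between cochains may be
checked on weighted elements over the polynomial algebra. -/
theorem evalCoeff_X_injective (k : ℕ) : Function.Injective
    (evalCoeff dM (MvPolynomial.X : Fin k → MvPolynomial (Fin k) F)) := by
  intro x y h
  obtain ⟨x, rfl⟩ := Submodule.Quotient.mk_surjective _ x
  obtain ⟨y, rfl⟩ := Submodule.Quotient.mk_surjective _ y
  rw [evalCoeff_mk, evalCoeff_mk, MvPolynomial.aeval_X_left, changeVar_id, changeVar_id] at h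
  exact weightInclQuot_injective dM (varSum F k) h

variable {dM}

/-- The action of an element of `S ⊗ E` of weight `s`. -/
def weightActHom (act : LambdaProduct dE dM) (s : S) (x : S ⊗[F] E) :
    WeightSpace dM S →ₗ[S] WeightSpace dM S :=
  Submodule.mapQ _ _
    (LinearMap.pi fun t => extend act.prod s x ∘ₗ LinearMap.proj (t - s)) fun r hr t _ => by
      obtain ⟨w, hw⟩ := hr (t - s) trivial
      refine ⟨extend act.prod s x w, ?_⟩
      rw [LinearMap.pi_apply, LinearMap.comp_apply, LinearMap.proj_apply, ← hw,
        act.extend_addDer_right, sub_add_cancel]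

theorem weightActHom_mk (act : LambdaProduct dE dM) (s : S) (x : S ⊗[F] E) (r : S → S ⊗[F] M) :
    weightActHom act s x (Submodule.Quotient.mk r)
      = Submodule.Quotient.mk fun t => extend act.prod s x (r (t - s)) := rfl

/-- The action of elements of `S ⊗ E` of weight `s`. -/
def weightAct (act : LambdaProduct dE dM) (s : S) :
    S ⊗[F] E →ₗ[S] WeightSpace dM S →ₗ[S] WeightSpace dM S where
  toFun := weightActHom act s
  map_add' x y := by
    refine LinearMap.ext fun n => ?_
    obtain ⟨r, rfl⟩ := Submodule.Quotient.mk_surjective _ n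
    rw [LinearMap.add_apply, weightActHom_mk, weightActHom_mk, weightActHom_mk,
      ← Submodule.Quotient.mk_add]
    congr 1
    funext t
    rw [map_add, LinearMap.add_apply, Pi.add_apply]
  map_smul' c x := by
    refine LinearMap.ext fun n => ?_
    obtain ⟨r, rfl⟩ := Submodule.Quotient.mk_surjective _ n
    rw [LinearMap.smul_apply, weightActHom_mk, weightActHom_mk, ← Submodule.Quotient.mk_smul]
    congr 1
    funext t
    rw [map_smul, LinearMap.smul_apply, Pi.smul_apply, RingHom.id_apply]

theorem weightAct_mk (act : LambdaProduct dE dM) (s : S) (x : S ⊗[F] E) (r : S → S ⊗[F] M) :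
    weightAct act s x (Submodule.Quotient.mk r)
      = Submodule.Quotient.mk fun t => extend act.prod s x (r (t - s)) := rfl

theorem weightAct_weightIncl (act : LambdaProduct dE dM) (s t : S) (x : S ⊗[F] E) (m : S ⊗[F] M) :
    weightAct act s x (weightIncl dM t m) = weightIncl dM (t + s) (extend act.prod s x m) := by
  classical
  rw [weightIncl, weightIncl, LinearMap.comp_apply, LinearMap.comp_apply, Submodule.mkQ_apply,
    Submodule.mkQ_apply, weightAct_mk]
  congr 1
  funext r
  by_cases h : r = t + s
  · subst h; simp
  · have h' : r - s ≠ t := fun h' => h (by rw [← h', sub_add_cancel])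
    simp [h, h']

theorem weightAct_addDer (act : LambdaProduct dE dM) (s : S) (x : S ⊗[F] E)
    (n : WeightSpace dM S) : weightAct act s (addDer dE s x) n = 0 := by
  obtain ⟨r, rfl⟩ := Submodule.Quotient.mk_surjective _ n
  rw [weightAct_mk, Submodule.Quotient.mk_eq_zero]
  intro t _
  change extend act.prod s (addDer dE s x) (r (t - s)) ∈ LinearMap.range (addDer dM t)
  rw [act.extend_addDer_left]
  simp

theorem evalCoeff_actCoeff (act : LambdaProduct dE dM) {k : ℕ} (s : Fin (k + 1) → S)
    (i : Fin (k + 1)) (u : E) (q : Coeff dM k) :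
    evalCoeff dM s (actCoeff act i u q)
      = weightAct act (s i) (1 ⊗ₜ u) (evalCoeff dM (fun t => s (i.succAbove t)) q) := by
  obtain ⟨x, rfl⟩ := Submodule.Quotient.mk_surjective _ q
  have h : (MvPolynomial.aeval s).comp (MvPolynomial.rename i.succAbove)
      = (MvPolynomial.aeval fun t => s (i.succAbove t) : MvPolynomial (Fin k) F →ₐ[F] S) :=
    MvPolynomial.algHom_ext fun t => by simp
  rw [actCoeff_mk, evalCoeff_mk, evalCoeff_mk, weightAct_weightIncl, changeVar_extend,
    changeVar_changeVar, changeVar_tmul, map_one, MvPolynomial.aeval_X, Fin.sum_univ_succAbove _ i,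
    add_comm, h]

theorem mergeCoeff_mk (dM : Module.End F M) (m : ℕ) (i : Fin (m + 1)) (j : Fin (m + 2))
    (x : MvPolynomial (Fin (m + 1)) F ⊗[F] M) : mergeCoeff dM m i j (Submodule.Quotient.mk x)
      = Submodule.Quotient.mk (changeVar M (mergeVar m i j) x) := rfl

theorem evalCoeff_mergeCoeff {m : ℕ} (s : Fin (m + 2) → S) (i : Fin (m + 1)) (j : Fin (m + 2))
    (q : Coeff dM (m + 1)) : evalCoeff dM s (mergeCoeff dM m i j q)
      = evalCoeff dM (Fin.cons (s (j.succAbove i) + s j)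
        fun t => s (j.succAbove (i.succAbove t))) q := by
  obtain ⟨x, rfl⟩ := Submodule.Quotient.mk_surjective _ q
  let s' : Fin (m + 1) → S := Fin.cons (s (j.succAbove i) + s j)
    fun t => s (j.succAbove (i.succAbove t))
  have h : (MvPolynomial.aeval s).comp (mergeVar m i j)
      = (MvPolynomial.aeval s' : MvPolynomial (Fin (m + 1)) F →ₐ[F] S) :=
    MvPolynomial.algHom_ext fun t => by
      refine Fin.cases ?_ (fun t => ?_) t <;> simp [mergeVar, s']
  have h' : ∑ t, s t = ∑ t, s' t := by
    rw [Fin.sum_univ_succAbove _ j, Fin.sum_univ_succAbove _ i, Fin.sum_univ_succ]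
    simp only [s', Fin.cons_zero, Fin.cons_succ]
    ring
  rw [mergeCoeff_mk, evalCoeff_mk, evalCoeff_mk, changeVar_changeVar, h, h']

end WeightSpace

/-! ### Cochains as functions of weighted elements. -/

section Hat

variable {F : Type*} [Field F]
variable {E : Type*} [AddCommGroup E] [Module F E]
variable {M : Type*} [AddCommGroup M] [Module F M]
variable {dE : Module.End F E} {dM : Module.End F M}
variable {S : Type*} [CommRing S] [Algebra F S]

/-- The `S`-multilinear extension of a cochain, evaluated at `λᵢ = s i`. -/
def evalCochain {k : ℕ} (φ : PreCochain E dM k) (s : Fin k → S) :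
    MultilinearMap S (fun _ : Fin k => S ⊗[F] E) (WeightSpace dM S) :=
  multilinearExtension S k ((evalCoeff dM s).compMultilinearMap φ)

@[simp] theorem evalCochain_one_tmul {k : ℕ} (φ : PreCochain E dM k) (s : Fin k → S)
    (u : Fin k → E) : evalCochain φ s (fun i => 1 ⊗ₜ u i) = evalCoeff dM s (φ u) :=
  multilinearExtension_one_tmul _ _

variable (S) in
/-- A cochain as a function of the elements of `S ⊗ E` with given weights. -/
def cochainFun {k : ℕ} (φ : PreCochain E dM k) : (Fin k → S × (S ⊗[F] E)) → WeightSpace dM S :=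
  fun y => evalCochain φ (fun i => (y i).1) (fun i => (y i).2)

theorem cochainFun_update {k : ℕ} (φ : PreCochain E dM k) (y : Fin k → S × (S ⊗[F] E)) (i : Fin k)
    (t : S) (x : S ⊗[F] E) : cochainFun S φ (Function.update y i (t, x))
      = evalCochain φ (Function.update (fun i => (y i).1) i t)
        (Function.update (fun i => (y i).2) i x) := by
  rw [cochainFun]
  congr 1
  · congr 1
    funext j
    by_cases h : j = i
    · subst h; simp
    · simp [h]
  · funext j
    by_cases h : j = i
    · subst h; simp
    · simp [h]

theorem cochainFun_update_add {k : ℕ} (φ : PreCochain E dM k) (y : Fin k → S × (S ⊗[F] E))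
    (i : Fin k) (t : S) (x x' : S ⊗[F] E) : cochainFun S φ (Function.update y i (t, x + x'))
      = cochainFun S φ (Function.update y i (t, x))
        + cochainFun S φ (Function.update y i (t, x')) := by
  rw [cochainFun_update, cochainFun_update, cochainFun_update, MultilinearMap.map_update_add]

theorem IsSkew.cochainFun {k : ℕ} {φ : PreCochain E dM k} (h : IsSkew φ) :
    CE.IsSkewFun (cochainFun S φ) := by
  intro π y
  let s : Fin k → S := fun i => (y i).1
  have : (evalCochain φ (s ∘ π)).domDomCongr π = (Equiv.Perm.sign π : ℤ) • evalCochain φ s := by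
    refine multilinear_ext_one_tmul fun u => ?_
    rw [smul_apply, evalCochain_one_tmul, h π u, map_zsmul, smul_smul, evalCoeff_permCoeff]
    have := evalCochain_one_tmul φ (s ∘ π) (u ∘ π)
    rw [MultilinearMap.domDomCongr_apply]
    refine this.trans ?_
    rcases Int.units_eq_one_or (Equiv.Perm.sign π) with h | h <;> simp [h]
  exact congrArg (fun f => f fun i => (y i).2) this

/-- The elements of the form `(∂ + s) x`, of weight `s`. -/
def nullSet (dE : Module.End F E) (S : Type*) [CommRing S] [Algebra F S] : Set (S × (S ⊗[F] E)) :=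
  {y | y.2 ∈ LinearMap.range (addDer dE y.1)}

/-- Sesquilinearity says that ∂uᵢ + λᵢ uᵢ contributes zero in the i-th argument. After S-linear
extension, φ vanishes when one argument of weight s lies in the image of ∂ + s. -/
theorem IsSesquilinear.cochainFun_eq_zero {k : ℕ} {φ : PreCochain E dM k}
    (h : IsSesquilinear dE φ) (i : Fin k) (y : Fin k → S × (S ⊗[F] E))
    (hy : y i ∈ nullSet dE S) : cochainFun S φ y = 0 := by
  obtain ⟨w, hw⟩ := hy
  let s : Fin k → S := fun i => (y i).1
  have e : ∀ x : Fin k → S ⊗[F] E, (fun j => (Function.update (fun _ => LinearMap.id) i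
      (addDer dE (s i)) : Fin k → S ⊗[F] E →ₗ[S] S ⊗[F] E) j (x j))
      = Function.update x i (addDer dE (s i) (x i)) := by
    intro x
    funext j
    by_cases hj : j = i
    · subst hj; simp
    · simp [hj]
  have h0 : (evalCochain φ s).compLinearMap
      (Function.update (fun _ => LinearMap.id) i (addDer dE (s i))) = 0 := by
    refine multilinear_ext_one_tmul fun u => ?_
    have h1 := evalCochain_one_tmul φ s (Function.update u i (dE (u i)))
    have h2 : (fun j => (1 : S) ⊗ₜ[F] Function.update u i (dE (u i)) j)
        = Function.update (fun j => (1 : S) ⊗ₜ[F] u j) i (1 ⊗ₜ dE (u i)) := by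
      funext j
      by_cases hj : j = i
      · subst hj; simp
      · simp [hj]
    rw [h2] at h1
    rw [MultilinearMap.compLinearMap_apply, e, addDer_tmul, mul_one, MultilinearMap.map_update_add,
      h1, h i u, tmul_eq_smul_one_tmul', MultilinearMap.map_update_smul,
      Function.update_eq_self i (fun j => (1 : S) ⊗ₜ[F] u j), evalCochain_one_tmul, map_neg,
      evalCoeff_smul]
    simp
  have := congrArg (fun f => f (Function.update (fun i => (y i).2) i w)) h0
  simp only [MultilinearMap.compLinearMap_apply, e, Function.update_idem, Function.update_self,
    zero_apply] at this
  rw [hw, Function.update_eq_self i (fun i => (y i).2)] at this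
  exact this

/-- The bracket of elements of `S ⊗ E` with given weights. -/
def weightBracket (br : E →ₗ[F] E →ₗ[F] F[X] ⊗[F] E) (y z : S × (S ⊗[F] E)) : S × (S ⊗[F] E) :=
  (y.1 + z.1, extend br y.1 y.2 z.2)

/-- The action of elements of `S ⊗ E` with given weights. -/
def weightAction (act : LambdaProduct dE dM) (y : S × (S ⊗[F] E)) :
    WeightSpace dM S →+ WeightSpace dM S :=
  (weightAct act y.1 y.2).toAddMonoidHom

theorem cochainFun_add {k : ℕ} (φ ψ : PreCochain E dM k) :
    cochainFun S (φ + ψ) = cochainFun S φ + cochainFun S ψ := by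
  funext y
  have : ((evalCoeff dM fun i => (y i).1).compMultilinearMap (φ + ψ))
      = (evalCoeff dM fun i => (y i).1).compMultilinearMap φ
        + (evalCoeff dM fun i => (y i).1).compMultilinearMap ψ := by
    ext u
    simp
  rw [cochainFun, evalCochain, this, map_add]
  rfl

/-- `cochainFun` as an additive map. -/
def cochainFunHom (S : Type*) [CommRing S] [Algebra F S] (k : ℕ) :
    PreCochain E dM k →+ ((Fin k → S × (S ⊗[F] E)) → WeightSpace dM S) :=
  AddMonoidHom.mk' (cochainFun S) cochainFun_add

theorem cochainFun_actTerm (act : LambdaProduct dE dM) {k : ℕ} (i : Fin (k + 1))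
    (φ : PreCochain E dM k) (y : Fin (k + 1) → S × (S ⊗[F] E)) :
    cochainFun S (actTerm act i φ) y
      = weightAction act (y i) (cochainFun S φ fun t => y (i.succAbove t)) := by
  let s : Fin (k + 1) → S := fun i => (y i).1
  have : evalCochain (actTerm act i φ) s = LinearMap.uncurryMid i
      { toFun := fun x => (weightAct act (s i) x).compMultilinearMap
          (evalCochain φ fun t => s (i.succAbove t))
        map_add' := fun x x' => by ext; simp
        map_smul' := fun c x => by ext; simp } := by
    refine multilinear_ext_one_tmul fun u => ?_
    rw [evalCochain_one_tmul, actTerm_apply, evalCoeff_actCoeff, ← evalCochain_one_tmul]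
    rfl
  exact congrArg (fun f => f fun i => (y i).2) this

theorem evalCoeff_insertFirst {m : ℕ} (i : Fin (m + 1)) (j : Fin (m + 2))
    (φ : PreCochain E dM (m + 1)) (s : Fin (m + 2) → S) (w : F[X] ⊗[F] E) (u : Fin m → E) :
    evalCoeff dM s (insertFirst i j φ w u)
      = (evalCochain φ (Fin.cons (s (j.succAbove i) + s j)
          fun t => s (j.succAbove (i.succAbove t)))).curryLeft
        (evalAt (s (j.succAbove i)) w) fun t => 1 ⊗ₜ u t := by
  generalize hs' : (Fin.cons (s (j.succAbove i) + s j)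
    fun t => s (j.succAbove (i.succAbove t)) : Fin (m + 1) → S) = s'
  induction w with
  | zero => simp
  | add x y hx hy => simp only [map_add, add_apply, hx, hy]
  | tmul p e =>
    rw [insertFirst_tmul, evalCoeff_smul, evalCoeff_mergeCoeff, hs', evalAt_tmul,
      tmul_eq_smul_one_tmul', map_smul, smul_apply, MultilinearMap.curryLeft_apply]
    have h1 := evalCochain_one_tmul φ s' (Fin.cons e u)
    have h2 : (fun t => (1 : S) ⊗ₜ[F] (Fin.cons e u : Fin (m + 1) → E) t)
        = Fin.cons (1 ⊗ₜ e) fun t => 1 ⊗ₜ u t := by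
      funext t
      refine Fin.cases rfl (fun t => rfl) t
    rw [h2] at h1
    rw [h1, ← Polynomial.aeval_algHom_apply, MvPolynomial.aeval_X]

/-- The `S`-multilinear map
`(x₁, …, x_{m+2}) ↦ ψ([xᵢ_s xⱼ], x₁, …, x̌ᵢ, …, x̌ⱼ, …, x_{m+2})`. -/
def bracketInsert {N : Type*} [AddCommGroup N] [Module S N] (br : LambdaProduct dE dE) {m : ℕ}
    (i : Fin (m + 1)) (j : Fin (m + 2)) (s : S)
    (ψ : MultilinearMap S (fun _ : Fin (m + 1) => S ⊗[F] E) N) :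
    MultilinearMap S (fun _ : Fin (m + 2) => S ⊗[F] E) N :=
  LinearMap.uncurryMid j
    { toFun := fun x' => LinearMap.uncurryMid i (ψ.curryLeft ∘ₗ (extend br.prod s).flip x')
      map_add' := fun x x' => by ext; simp
      map_smul' := fun c x => by ext; simp }

theorem bracketInsert_apply {N : Type*} [AddCommGroup N] [Module S N] (br : LambdaProduct dE dE)
    {m : ℕ} (i : Fin (m + 1)) (j : Fin (m + 2)) (s : S)
    (ψ : MultilinearMap S (fun _ : Fin (m + 1) => S ⊗[F] E) N) (x : Fin (m + 2) → S ⊗[F] E) :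
    bracketInsert br i j s ψ x = ψ.curryLeft (extend br.prod s (x (j.succAbove i)) (x j))
      fun t => x (j.succAbove (i.succAbove t)) := rfl

theorem evalCochain_bracketTerm (br : LambdaProduct dE dE) {m : ℕ} (i : Fin (m + 1))
    (j : Fin (m + 2)) (φ : PreCochain E dM (m + 1)) (s : Fin (m + 2) → S) :
    evalCochain (bracketTerm br i j φ) s = bracketInsert br i j (s (j.succAbove i))
      (evalCochain φ (Fin.cons (s (j.succAbove i) + s j)
        fun t => s (j.succAbove (i.succAbove t)))) := by
  refine multilinear_ext_one_tmul fun u => ?_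
  rw [evalCochain_one_tmul, bracketTerm_apply, evalCoeff_insertFirst, bracketInsert_apply,
    extend_tmul, one_smul, one_smul]

theorem cochainFun_bracketTerm (br : LambdaProduct dE dE) {m : ℕ} (i : Fin (m + 1))
    (j : Fin (m + 2)) (φ : PreCochain E dM (m + 1)) (y : Fin (m + 2) → S × (S ⊗[F] E)) :
    cochainFun S (bracketTerm br i j φ) y
      = cochainFun S φ (Fin.cons (weightBracket br.prod (y (j.succAbove i)) (y j))
        fun t => y (j.succAbove (i.succAbove t))) := by
  rw [cochainFun, evalCochain_bracketTerm, bracketInsert_apply, MultilinearMap.curryLeft_apply,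
    cochainFun]
  congr 1
  · congr 1
    funext t
    refine Fin.cases rfl (fun t => rfl) t
  · funext t
    refine Fin.cases rfl (fun t => rfl) t

/-- The two sums of the differential correspond term by term, and no symmetry of φ is used.
Skewsymmetry enters only when these sums are identified with the recursive differential. -/
theorem cochainFun_differential_eq_sum (br : LambdaProduct dE dE) (act : LambdaProduct dE dM)
    {k : ℕ} (φ : PreCochain E dM k) (y : Fin (k + 1) → S × (S ⊗[F] E)) :
    cochainFun S (differential br act k φ) y
      = CE.sumAct (weightAction act) k (cochainFun S φ) y
        + CE.sumBracket (weightBracket br.prod) k (cochainFun S φ) y := by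
  change cochainFunHom S (k + 1) (diffAct act k φ + diffBracket br k φ) y = _
  rw [map_add, Pi.add_apply]
  congr 1
  · rw [diffAct, map_sum, Finset.sum_apply, CE.sumAct]
    refine Finset.sum_congr rfl fun i _ => ?_
    rw [map_zsmul, Pi.smul_apply]
    exact congrArg _ (cochainFun_actTerm act i φ y)
  · cases k with
    | zero => rw [diffBracket, map_zero]; rfl
    | succ m =>
      rw [diffBracket, map_sum, Finset.sum_apply, CE.sumBracket]
      refine Finset.sum_congr rfl fun j _ => ?_
      rw [map_sum, Finset.sum_apply]
      refine Finset.sum_congr rfl fun i _ => ?_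
      split_ifs
      · rw [map_zsmul, Pi.smul_apply]
        exact congrArg _ (cochainFun_bracketTerm br i j φ y)
      · rw [map_zero]; rfl

end Hat


/-! ### The differential preserves skewsymmetry and sesquilinearity, and its square is zero -/

section SquareZero

variable {F : Type u} [Field F]
variable {E : Type*} [AddCommGroup E] [Module F E]
variable {M : Type*} [AddCommGroup M] [Module F M]
variable {dE : Module.End F E} {dM : Module.End F M}
variable {S : Type u} [CommRing S] [Algebra F S] {k : ℕ}

theorem weightBracket_mem_nullSet (br : LambdaProduct dE dE) {x : S × (S ⊗[F] E)}
    (hx : x ∈ nullSet dE S) (y : S × (S ⊗[F] E)) :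
    weightBracket br.prod x y ∈ nullSet dE S := by
  obtain ⟨w, hw⟩ := hx
  refine ⟨0, ?_⟩
  rw [map_zero, weightBracket, ← hw]
  exact (br.extend_addDer_left _ _ _).symm

theorem weightAction_eq_zero (act : LambdaProduct dE dM) {x : S × (S ⊗[F] E)}
    (hx : x ∈ nullSet dE S) (n : WeightSpace dM S) : weightAction act x n = 0 := by
  obtain ⟨w, hw⟩ := hx
  change weightAct act x.1 x.2 n = 0
  rw [← hw, weightAct_addDer]

/-- The bracket of weighted elements is skewsymmetric only modulo `nullSet`, on which a sesquilinear
cochain vanishes. -/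
theorem IsSesquilinear.isAnti_cochainFun (L : LieConformalAlgebra dE) {φ : PreCochain E dM k}
    (h : IsSesquilinear dE φ) : CE.IsAnti (weightBracket L.prod) (cochainFun S φ) := by
  intro i z x y
  rw [eq_neg_iff_add_eq_zero, weightBracket, weightBracket, add_comm y.1, ← cochainFun_update_add]
  refine h.cochainFun_eq_zero i _ ?_
  rw [Function.update_self]
  exact extend_skew L.skew x.1 y.1 x.2 y.2

/-- In contrast with skewsymmetry, the Jacobi identity holds in S ⊗ E itself; φ only has to be
additive in the argument. -/
theorem isJacobi_cochainFun (L : LieConformalAlgebra dE) (φ : PreCochain E dM k) :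
    CE.IsJacobi (weightBracket L.prod) (cochainFun S φ) := by
  intro i z x y w
  simp only [weightBracket]
  rw [← add_assoc, add_left_comm y.1, ← add_assoc, ← cochainFun_update_add,
    extend_commutator fun a b c => commutatorAt_iff.2 (L.jacobi a b c), sub_add_cancel]

theorem weightAction_mk (act : LambdaProduct dE dM) (x : S × (S ⊗[F] E)) (r : S → S ⊗[F] M) :
    weightAction act x (Submodule.Quotient.mk r)
      = Submodule.Quotient.mk fun t => extend act.prod x.1 x.2 (r (t - x.1)) := rfl

theorem weightAction_weightBracket {br : LambdaProduct dE dE} {act : LambdaProduct dE dM}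
    (hact : ∀ a b m, CommutatorAt br.prod act.prod a b m) (x y : S × (S ⊗[F] E))
    (n : WeightSpace dM S) : weightAction act (weightBracket br.prod x y) n
      = weightAction act x (weightAction act y n) - weightAction act y (weightAction act x n) := by
  obtain ⟨r, rfl⟩ := Submodule.Quotient.mk_surjective _ n
  rw [weightAction_mk, weightAction_mk, weightAction_mk, weightAction_mk, weightAction_mk,
    ← Submodule.Quotient.mk_sub]
  congr 1
  funext t
  rw [Pi.sub_apply, weightBracket, extend_commutator hact, sub_sub, sub_sub, add_comm y.1]

theorem cochainFun_differential (br : LambdaProduct dE dE) (act : LambdaProduct dE dM)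
    {φ : PreCochain E dM k} (h : IsSkew φ) : cochainFun S (differential br act k φ)
      = CE.diff (weightBracket br.prod) (weightAction act) k (cochainFun S φ) :=
  funext fun y => by rw [cochainFun_differential_eq_sum, CE.diff_eq_sum h.cochainFun]

theorem cochainFun_one_tmul (φ : PreCochain E dM k) (s : Fin k → S) (u : Fin k → E) :
    cochainFun S φ (fun i => (s i, 1 ⊗ₜ u i)) = evalCoeff dM s (φ u) :=
  evalCochain_one_tmul φ s u

theorem isSkew_of_isSkewFun {φ : PreCochain E dM k}
    (h : CE.IsSkewFun (cochainFun (MvPolynomial (Fin k) F) φ)) : IsSkew φ := by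
  intro π u
  refine evalCoeff_X_injective dM k ?_
  have h1 := h π fun i => (MvPolynomial.X i, 1 ⊗ₜ u i)
  have h2 := cochainFun_one_tmul φ ((MvPolynomial.X : _ → MvPolynomial (Fin k) F) ∘ π) (u ∘ π)
  rw [cochainFun_one_tmul φ MvPolynomial.X] at h1
  rw [map_zsmul, evalCoeff_permCoeff, ← h2]
  refine Eq.trans ?_ (congrArg _ h1.symm)
  rcases Int.units_eq_one_or (Equiv.Perm.sign π) with h | h <;> simp [h]

theorem isSesquilinear_of_cochainFun {φ : PreCochain E dM k}
    (h : ∀ i y, y i ∈ nullSet dE (MvPolynomial (Fin k) F) →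
      cochainFun (MvPolynomial (Fin k) F) φ y = 0) : IsSesquilinear dE φ := by
  intro i u
  refine evalCoeff_X_injective dM k ?_
  let y : Fin k → MvPolynomial (Fin k) F × (MvPolynomial (Fin k) F ⊗[F] E) :=
    fun i => (MvPolynomial.X i, 1 ⊗ₜ u i)
  have h1 := h i (Function.update y i (MvPolynomial.X i, addDer dE (MvPolynomial.X i) (1 ⊗ₜ u i)))
    ⟨1 ⊗ₜ u i, by rw [Function.update_self]⟩
  have h2 : Function.update y i (MvPolynomial.X i, 1 ⊗ₜ dE (u i))
      = fun j => (MvPolynomial.X j, 1 ⊗ₜ Function.update u i (dE (u i)) j) := by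
    funext j
    by_cases hj : j = i
    · subst hj; simp
    · simp [hj, y]
  have h3 : cochainFun _ φ (Function.update y i (MvPolynomial.X i,
      (MvPolynomial.X i : MvPolynomial (Fin k) F) ⊗ₜ u i))
      = (MvPolynomial.X i : MvPolynomial (Fin k) F) • cochainFun _ φ y := by
    rw [cochainFun_update, tmul_eq_smul_one_tmul', MultilinearMap.map_update_smul,
      Function.update_eq_self i (fun i => (y i).1), Function.update_eq_self i (fun i => (y i).2)]
    rfl
  rw [addDer_tmul, mul_one, cochainFun_update_add, h2, h3, cochainFun_one_tmul,
    cochainFun_one_tmul] at h1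
  rw [map_neg, evalCoeff_smul, MvPolynomial.aeval_X, eq_neg_iff_add_eq_zero, add_comm, h1]

theorem isSkewFun_cochainFun_differential (L : LieConformalAlgebra dE) (act : LambdaProduct dE dM)
    {φ : PreCochain E dM k} (h : IsSesquilinear dE φ) (h' : IsSkew φ) :
    CE.IsSkewFun (cochainFun S (differential L.toLambdaProduct act k φ)) := by
  rw [cochainFun_differential _ _ h']
  exact h'.cochainFun.diff (h.isAnti_cochainFun L)

theorem isSkew_differential (L : LieConformalAlgebra dE) (act : LambdaProduct dE dM)
    {φ : PreCochain E dM k} (h : IsSesquilinear dE φ) (h' : IsSkew φ) :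
    IsSkew (differential L.toLambdaProduct act k φ) :=
  isSkew_of_isSkewFun (isSkewFun_cochainFun_differential L act h h')

/-- It must be shown that dφ vanishes on null elements. As dφ is skewsymmetric, the null element may
be moved to the first argument, where Cartan's formula applies. -/
theorem isSesquilinear_differential (L : LieConformalAlgebra dE) (act : LambdaProduct dE dM)
    {φ : PreCochain E dM k} (h : IsSesquilinear dE φ) (h' : IsSkew φ) :
    IsSesquilinear dE (differential L.toLambdaProduct act k φ) := by
  refine isSesquilinear_of_cochainFun fun i y hy => ?_
  have h0 : ∀ y : Fin (k + 1) → _, y 0 ∈ nullSet dE (MvPolynomial (Fin (k + 1)) F) →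
      cochainFun _ (differential L.toLambdaProduct act k φ) y = 0 := by
    intro y hy
    rw [cochainFun_differential _ _ h', ← Fin.cons_self_tail y]
    exact CE.diff_cons_eq_zero (fun x hx n => weightAction_eq_zero act hx n)
      (fun x hx y => weightBracket_mem_nullSet L.toLambdaProduct hx y)
      (fun i z hz => h.cochainFun_eq_zero i z hz) hy _
  have h1 := isSkewFun_cochainFun_differential (S := MvPolynomial (Fin (k + 1)) F) L act h h'
    (Equiv.swap 0 i) (y ∘ Equiv.swap 0 i)
  rw [h0 (y ∘ Equiv.swap 0 i) (by simpa using hy), smul_zero] at h1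
  rw [← h1]
  congr 1
  funext j
  simp

theorem differential_differential (L : LieConformalAlgebra dE) {act : LambdaProduct dE dM}
    (hact : ∀ a b m, CommutatorAt L.prod act.prod a b m)
    {φ : PreCochain E dM k} (h : IsSesquilinear dE φ) (h' : IsSkew φ) :
    differential L.toLambdaProduct act (k + 1) (differential L.toLambdaProduct act k φ) = 0 := by
  ext u
  refine evalCoeff_X_injective dM (k + 2) ?_
  rw [← cochainFun_one_tmul, cochainFun_differential _ _ (isSkew_differential L act h h'),
    cochainFun_differential _ _ h',
    CE.diff_diff (weightAction_weightBracket hact) (isJacobi_cochainFun L φ)]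
  simp

end SquareZero


/-! ### The differential is compatible with the module structure over the differential algebra -/

section InsertFirst

variable {F : Type*} [Field F] {E : Type*} [AddCommGroup E] [Module F E]
variable {M : Type*} [AddCommGroup M] [Module F M]
variable {dE : Module.End F E} {dM : Module.End F M} {k : ℕ}

theorem insertFirst_X_smul {i : Fin (k + 1)} {j : Fin (k + 2)} (φ : PreCochain E dM (k + 1))
    (W : F[X] ⊗[F] E) (u : Fin k → E) :
    insertFirst i j φ ((Polynomial.X : F[X]) • W) u
      = (MvPolynomial.X (j.succAbove i) : MvPolynomial (Fin (k + 2)) F)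
        • insertFirst i j φ W u := by
  induction W with
  | zero => simp
  | add x y hx hy => simp only [smul_add, map_add, add_apply, hx, hy]
  | tmul p w =>
    rw [TensorProduct.smul_tmul', insertFirst_tmul, insertFirst_tmul, smul_eq_mul, map_mul,
      Polynomial.aeval_X, mul_smul]

theorem mergeCoeff_X_zero_smul (dM : Module.End F M) {i : Fin (k + 1)} {j : Fin (k + 2)}
    (q : Coeff dM (k + 1)) :
    mergeCoeff dM k i j ((MvPolynomial.X 0 : MvPolynomial (Fin (k + 1)) F) • q)
      = (MvPolynomial.X (j.succAbove i) + MvPolynomial.X j : MvPolynomial (Fin (k + 2)) F)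
        • mergeCoeff dM k i j q := by
  obtain ⟨x, rfl⟩ := Submodule.Quotient.mk_surjective _ q
  rw [← Submodule.Quotient.mk_smul, mergeCoeff_mk, mergeCoeff_mk, changeVar_smul,
    ← Submodule.Quotient.mk_smul]
  simp [mergeVar]

/-- The inserted element has weight λᵢ + λⱼ, so inside φ the derivation ∂ is −λᵢ − λⱼ, while the
polynomial variable is evaluated at λᵢ. -/
theorem IsSesquilinear.insertFirst_addDer {i : Fin (k + 1)} {j : Fin (k + 2)}
    {φ : PreCochain E dM (k + 1)} (h : IsSesquilinear dE φ) (W : F[X] ⊗[F] E)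
    (u : Fin k → E) :
    insertFirst i j φ (addDer dE (Polynomial.X : F[X]) W) u
      = -((MvPolynomial.X j : MvPolynomial (Fin (k + 2)) F) • insertFirst i j φ W u) := by
  induction W with
  | zero => simp
  | add x y hx hy => simp only [map_add, add_apply, hx, hy, smul_add, neg_add]
  | tmul p w =>
    have h1 := h 0 (Fin.cons w u)
    rw [Fin.cons_zero, Fin.update_cons_zero] at h1
    have h2 := insertFirst_X_smul (i := i) (j := j) φ (p ⊗ₜ w) u
    rw [TensorProduct.smul_tmul', smul_eq_mul] at h2
    rw [addDer_tmul, map_add, add_apply, h2, insertFirst_tmul, insertFirst_tmul, h1, map_neg,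
      mergeCoeff_X_zero_smul, smul_neg, add_smul, smul_add, smul_comm _ (MvPolynomial.X _),
      smul_comm _ (MvPolynomial.X j)]
    abel

/-- Inside φ the operator −λ − ∂ is multiplication by λⱼ. Together with skewsymmetry this allows a
bracket to be expanded by the Leibniz rule in its first argument. -/
theorem IsSesquilinear.insertFirst_negSubst_tmul {i : Fin (k + 1)} {j : Fin (k + 2)}
    {φ : PreCochain E dM (k + 1)} (h : IsSesquilinear dE φ) (p : F[X]) (e : E)
    (u : Fin k → E) :
    insertFirst i j φ (negSubst dE (p ⊗ₜ e)) u
      = Polynomial.aeval (MvPolynomial.X j : MvPolynomial (Fin (k + 2)) F) p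
        • mergeCoeff dM k i j (φ (Fin.cons e u)) := by
  induction p using Polynomial.induction_on' with
  | add p q hp hq => simp only [TensorProduct.add_tmul, map_add, add_apply, hp, hq, add_smul]
  | monomial n c =>
    rw [← mul_one c, ← smul_eq_mul, ← Polynomial.smul_monomial, ← TensorProduct.smul_tmul',
      map_smul, map_smul, map_smul, smul_apply, smul_assoc, ← Polynomial.X_pow_eq_monomial]
    congr 1
    induction n with
    | zero => simp [negSubst_one_tmul, insertFirst_tmul]
    | succ n ih =>
      rw [pow_succ', ← smul_eq_mul, ← TensorProduct.smul_tmul', negSubst_X_smul, map_neg,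
        neg_apply, h.insertFirst_addDer, neg_neg, ih, smul_eq_mul, map_mul, Polynomial.aeval_X,
        mul_smul]

end InsertFirst

section Smul

variable {F : Type*} [Field F] {A : Type*} [CommRing A] [Algebra F A] {D : Derivation F A A}
variable {E : Type*} [AddCommGroup E] [Module F E] [Module A E]
variable {M : Type*} [AddCommGroup M] [Module F M] [Module A M] [IsScalarTower F A M]
variable {dM : DiffModule D M} {k : ℕ}

/-- `φ_{λ₁,…,λₖ}(…, a uᵢ, …) = (|_{x=∂} a) φ_{λ₁,…,λᵢ+x,…,λₖ}(…, uᵢ, …)`. -/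
def IsLinearAt (dM : DiffModule D M) (i : Fin k) (φ : PreCochain E dM.der k) : Prop :=
  ∀ (a : A) (u : Fin k → E), φ (Function.update u i (a • u i)) = shiftCoeff dM i a (φ u)

theorem IsSkew.isLinearAt {φ : PreCochain E dM.der k} (h : IsSkew φ) {i : Fin k}
    (hi : IsLinearAt dM i φ) (j : Fin k) : IsLinearAt dM j φ := by
  intro a u
  have e : Function.update u j (a • u j) ∘ Equiv.swap i j
      = Function.update (u ∘ Equiv.swap i j) i (a • (u ∘ Equiv.swap i j) i) := by
    rw [Function.update_comp_equiv]
    simp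
  rw [h (Equiv.swap i j), h (Equiv.swap i j) u, e, hi, permCoeff_shiftCoeff,
    Equiv.swap_apply_left, map_zsmul]

theorem IsLinearAt.cons {φ : PreCochain E dM.der (k + 1)} (h : IsLinearAt dM 0 φ) (a : A) (e : E)
    (u : Fin k → E) : φ (Fin.cons (a • e) u) = shiftCoeff dM 0 a (φ (Fin.cons e u)) := by
  have := h a (Fin.cons e u)
  rwa [Fin.cons_zero, Fin.update_cons_zero] at this

theorem IsLinearAt.cons_cons {φ : PreCochain E dM.der (k + 2)} (h : IsLinearAt dM 1 φ) (a : A)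
    (w e : E) (u : Fin k → E) : φ (Fin.cons w (Fin.cons (a • e) u))
      = shiftCoeff dM 1 a (φ (Fin.cons w (Fin.cons e u))) := by
  have := h a (Fin.cons w (Fin.cons e u))
  rwa [← Fin.succ_zero_eq_one, ← Fin.cons_update, Fin.cons_succ, Fin.cons_zero,
    Fin.update_cons_zero] at this

theorem isLinearAt_zero_of_cons {φ : PreCochain E dM.der (k + 1)}
    (h : ∀ (a : A) (e : E) (u : Fin k → E),
      φ (Fin.cons (a • e) u) = shiftCoeff dM 0 a (φ (Fin.cons e u))) : IsLinearAt dM 0 φ := by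
  intro a u
  have := h a (u 0) (Fin.tail u)
  rwa [Fin.cons_self_tail, ← Fin.update_cons_zero (u 0), Fin.cons_self_tail] at this

variable [IsScalarTower F A E] {dE : DiffModule D E}

theorem shiftCoeff_aeval_X_smul {i j : Fin k} (hij : j ≠ i) (p : F[X]) (a : A)
    (x : Coeff dM.der k) :
    shiftCoeff dM i a (Polynomial.aeval (MvPolynomial.X j : MvPolynomial (Fin k) F) p • x)
      = Polynomial.aeval (MvPolynomial.X j : MvPolynomial (Fin k) F) p • shiftCoeff dM i a x := by
  obtain ⟨x, rfl⟩ := Submodule.Quotient.mk_surjective _ x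
  rw [← Submodule.Quotient.mk_smul, shiftCoeff_mk, shiftCoeff_mk, shift_smul_of_eq (c := 0),
    zero_smul, add_zero, Submodule.Quotient.mk_smul]
  rw [zero_smul, add_zero, ← Polynomial.aeval_algHom_apply]
  have h : addVarAt i (MvPolynomial.X j : MvPolynomial (Fin k) F)
      = Polynomial.CAlgHom (R := F) (MvPolynomial.X j) := by simp [addVarAt, hij]
  rw [h, Polynomial.aeval_algHom_apply]
  rfl

theorem actCoeff_smul_left {act : LambdaProduct dE.der dM.der}
    (hact : ∀ (a : A) u m, act.prod (a • u) m = shift D addVar a (act.prod u m))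
    (a : A) (e : E) (q : Coeff dM.der k) :
    actCoeff act 0 (a • e) q = shiftCoeff dM 0 a (actCoeff act 0 e q) := by
  obtain ⟨x, rfl⟩ := Submodule.Quotient.mk_surjective _ q
  have h := extend_coeffProd_left hact (MvPolynomial.X 0 : MvPolynomial (Fin (k + 1)) F) (1 ⊗ₜ a)
    (1 ⊗ₜ e) (changeVar M (MvPolynomial.rename (Fin.succAbove 0)) x)
  -- The variables of q are those of index different from 0, so the shift of the variable of index 0
  -- fixes them.
  have hv : (addVarAt (0 : Fin (k + 1))).comp (MvPolynomial.rename (Fin.succAbove 0))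
      = (Polynomial.CAlgHom : MvPolynomial (Fin (k + 1)) F →ₐ[F] _).comp
        (MvPolynomial.rename (Fin.succAbove 0)) :=
    MvPolynomial.algHom_ext fun t => by simp [addVarAt]
  rw [coeffProd_tmul, one_mul] at h
  rw [actCoeff_mk, actCoeff_mk, shiftCoeff_mk, h, shift_eq_substDer, changeVar_extend,
    changeVar_changeVar, changeVar_changeVar, hv]
  simp [addVarAt]

/-- The element `(|_{x=∂} θ(v)_{λⱼ}(a)) q_{λ₁+λⱼ+x, …, λ̌ⱼ, …}`. -/
def anchorTerm (θ : LambdaProduct dE.der (D : Module.End F A)) (j : Fin (k + 2)) (v : E) (a : A)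
    (x : MvPolynomial (Fin (k + 1)) F ⊗[F] M) : MvPolynomial (Fin (k + 2)) F ⊗[F] M :=
  substDer D (evalAt (MvPolynomial.X j) (θ.prod v a))
    (changeVar M ((Polynomial.mapAlgHom (mergeVar k 0 j)).comp (addVarAt 0)) x)

/-- Moving the action of v past the substitution x = ∂ on a differentiates a along the anchor
(`extend_substDer`), and this is the additional term. -/
theorem actCoeff_shiftCoeff {act : LambdaProduct dE.der dM.der}
    {θ : LambdaProduct dE.der (D : Module.End F A)}
    (hact : ∀ u (a : A) m,
      act.prod u (a • m) = coeffMul a (act.prod u m) + mulVec (θ.prod u a) m)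
    (j : Fin (k + 1)) (v : E) (a : A) (x : MvPolynomial (Fin (k + 1)) F ⊗[F] M) :
    actCoeff act j.succ v (shiftCoeff dM 0 a (Submodule.Quotient.mk x))
      = shiftCoeff dM 0 a (actCoeff act j.succ v (Submodule.Quotient.mk x))
        + Submodule.Quotient.mk (anchorTerm θ j.succ v a x) := by
  let r : MvPolynomial (Fin (k + 1)) F →ₐ[F] MvPolynomial (Fin (k + 2)) F :=
    MvPolynomial.rename j.succ.succAbove
  have hr : (Polynomial.mapAlgHom r).comp (addVarAt 0) = (addVarAt 0).comp r :=
    MvPolynomial.algHom_ext fun t => by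
      refine Fin.cases ?_ (fun t => ?_) t <;> simp [addVarAt, r]
  -- The translation of x by λⱼ in the anchor term has the effect of the merging substitution of the
  -- bracket terms. This puts the additional term into the form in which it also arises from the
  -- bracket.
  have hm : (translate (MvPolynomial.X j.succ)).comp ((addVarAt 0).comp r)
      = (Polynomial.mapAlgHom (mergeVar k 0 j.succ)).comp (addVarAt 0) :=
    MvPolynomial.algHom_ext fun t => by
      refine Fin.cases ?_ (fun t => ?_) t
      · simp [addVarAt, r, mergeVar]
        ring
      · simp [addVarAt, r, mergeVar]
  have hX : addVarAt 0 (MvPolynomial.X j.succ : MvPolynomial (Fin (k + 2)) F)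
      = Polynomial.C (MvPolynomial.X j.succ) := by simp [addVarAt]
  rw [shiftCoeff_mk, actCoeff_mk, actCoeff_mk, shiftCoeff_mk, ← Submodule.Quotient.mk_add]
  congr 1
  rw [changeVar_shift hr, shift_eq_substDer, shift_eq_substDer,
    extend_substDer act θ hact, changeVar_changeVar, changeVar_changeVar, changeVar_extend, hX,
    changeVar_changeVar]
  refine congrArg₂ (· + ·) ?_ ?_
  · simp [r]
  · rw [anchorTerm, hm]
    simp

end Smul


section Linear

variable {F : Type*} [Field F] {A : Type*} [CommRing A] [Algebra F A] {D : Derivation F A A}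
variable {E : Type*} [AddCommGroup E] [Module F E] [Module A E]
variable {M : Type*} [AddCommGroup M] [Module F M] [Module A M] [IsScalarTower F A M]
variable {dM : DiffModule D M} {k : ℕ}

theorem mergeCoeff_shiftCoeff_one (i : Fin (k + 1)) (j : Fin (k + 2)) (a : A)
    (q : Coeff dM.der (k + 2)) :
    mergeCoeff dM.der (k + 1) i.succ j.succ (shiftCoeff dM 1 a q)
      = shiftCoeff dM 0 a (mergeCoeff dM.der (k + 1) i.succ j.succ q) := by
  obtain ⟨x, rfl⟩ := Submodule.Quotient.mk_surjective _ q
  have h : (Polynomial.mapAlgHom (mergeVar (F := F) (k + 1) i.succ j.succ)).comp (addVarAt 1)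
      = (addVarAt 0).comp (mergeVar (k + 1) i.succ j.succ) :=
    MvPolynomial.algHom_ext fun t => by
      refine Fin.cases ?_ (fun t => Fin.cases ?_ (fun t => ?_) t) t
      · simp [addVarAt, mergeVar]
      · simp [addVarAt, mergeVar]
      · have h1 : t.succ.succ ≠ (1 : Fin (k + 2)) := fun h =>
          Fin.succ_ne_zero _ (Fin.succ_injective _ h)
        simp [addVarAt, mergeVar, h1]
  rw [shiftCoeff_mk, mergeCoeff_mk, mergeCoeff_mk, shiftCoeff_mk, changeVar_shift h]

theorem IsLinearAt.insertFirst_cons {φ : PreCochain E dM.der (k + 2)} (h : IsLinearAt dM 1 φ)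
    (i : Fin (k + 1)) (j : Fin (k + 2)) (W : F[X] ⊗[F] E) (a : A) (e : E) (u : Fin k → E) :
    insertFirst i.succ j.succ φ W (Fin.cons (a • e) u)
      = shiftCoeff dM 0 a (insertFirst i.succ j.succ φ W (Fin.cons e u)) := by
  induction W with
  | zero => simp
  | add x y hx hy => simp only [map_add, add_apply, hx, hy]
  | tmul p w =>
    rw [insertFirst_tmul, insertFirst_tmul, h.cons_cons, mergeCoeff_shiftCoeff_one,
      shiftCoeff_aeval_X_smul (by simp)]

variable [IsScalarTower F A E] {dE : DiffModule D E}

theorem mergeCoeff_shiftCoeff_zero (j : Fin (k + 1)) (p : F[X]) (a : A)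
    (x : MvPolynomial (Fin (k + 1)) F ⊗[F] M) :
    Polynomial.aeval (MvPolynomial.X j.succ : MvPolynomial (Fin (k + 2)) F) p
        • mergeCoeff dM.der k 0 j.succ (shiftCoeff dM 0 a (Submodule.Quotient.mk x))
      = Submodule.Quotient.mk (substDer D (evalAt (MvPolynomial.X j.succ) (p ⊗ₜ a))
        (changeVar M ((Polynomial.mapAlgHom (mergeVar k 0 j.succ)).comp (addVarAt 0)) x)) := by
  rw [shiftCoeff_mk, mergeCoeff_mk, shift_eq_substDer, changeVar_substDer, changeVar_changeVar,
    ← Submodule.Quotient.mk_smul, evalAt_tmul,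
    tmul_eq_smul_one_tmul' (Polynomial.aeval _ p), substDer_smul_left]

/-- The term of the differential with `[a u₁_{λ₁} uⱼ]`. -/
theorem IsSesquilinear.insertFirst_bracket_smul (L : LCAd dE) {φ : PreCochain E dM.der (k + 1)}
    (h : IsSesquilinear dE.der φ) (h0 : IsLinearAt dM 0 φ) (j : Fin (k + 1)) (a : A) (e v : E)
    (u : Fin k → E) {x : MvPolynomial (Fin (k + 1)) F ⊗[F] M}
    (hx : Submodule.Quotient.mk x = φ (Fin.cons e u)) :
    insertFirst 0 j.succ φ (L.lca.prod (a • e) v) u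
      = shiftCoeff dM 0 a (insertFirst 0 j.succ φ (L.lca.prod e v) u)
        - Submodule.Quotient.mk (anchorTerm L.anchor j.succ v a x) := by
  -- By skewsymmetry, [a e_λ v] is minus the image of a [v_λ e] + θ(v)_λ(a) e under λ ↦ −λ − ∂. Here
  -- the first summand is evaluated inside φ, and in `h2` the second.
  have h1 : ∀ W : F[X] ⊗[F] E, insertFirst 0 j.succ φ (negSubst dE.der (coeffMul a W)) u
      = shiftCoeff dM 0 a (insertFirst 0 j.succ φ (negSubst dE.der W) u) := by
    intro W
    induction W with
    | zero => simp
    | add x y hx hy => simp only [map_add, add_apply, hx, hy]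
    | tmul p w =>
      obtain ⟨y, hy⟩ := Submodule.Quotient.mk_surjective _ (φ (Fin.cons w u))
      have hm : (Polynomial.mapAlgHom (mergeVar (F := F) k 0 j.succ)).comp (addVarAt 0)
          = (addVarAt 0).comp (mergeVar k 0 j.succ) :=
        MvPolynomial.algHom_ext fun t => by
          refine Fin.cases ?_ (fun t => ?_) t
          · simp [addVarAt, mergeVar]
            ring
          · simp [addVarAt, mergeVar]
      rw [coeffMul_tmul, h.insertFirst_negSubst_tmul, h.insertFirst_negSubst_tmul, h0.cons,
        shiftCoeff_aeval_X_smul (by simp), ← hy, shiftCoeff_mk, mergeCoeff_mk, mergeCoeff_mk,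
        shiftCoeff_mk, changeVar_shift hm]
  have h2 : ∀ g : F[X] ⊗[F] A, insertFirst 0 j.succ φ (negSubst dE.der (mulVec g e)) u
      = Submodule.Quotient.mk (substDer D (evalAt (MvPolynomial.X j.succ) g)
        (changeVar M ((Polynomial.mapAlgHom (mergeVar k 0 j.succ)).comp (addVarAt 0)) x)) := by
    intro g
    induction g with
    | zero =>
      have : substDer D (0 : MvPolynomial (Fin (k + 2)) F ⊗[F] A)
          (changeVar M ((Polynomial.mapAlgHom (mergeVar k 0 j.succ)).comp (addVarAt 0)) x) = 0 := by
        have := substDer_smul_left (D := D) 0 (0 : MvPolynomial (Fin (k + 2)) F ⊗[F] A)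
          (changeVar M ((Polynomial.mapAlgHom (mergeVar k 0 j.succ)).comp (addVarAt 0)) x)
        rwa [zero_smul, zero_smul] at this
      rw [map_zero, this, mulVec, map_zero]
      simp
    | add g g' hg hg' =>
      rw [mulVec_add, map_add, map_add, add_apply, hg, hg', map_add, substDer_add_left,
        Submodule.Quotient.mk_add]
    | tmul p b =>
      rw [mulVec_tmul, h.insertFirst_negSubst_tmul, h0.cons, ← hx, mergeCoeff_shiftCoeff_zero]
  rw [L.lca.skew v (a • e), L.bracket_smul, L.lca.skew v e, map_add, map_neg, map_neg,
    neg_apply, neg_apply, map_neg, map_add, add_apply, h1, h2, anchorTerm, neg_add, sub_eq_add_neg]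

/-- The differential of a cochain is linear in its first argument. -/
theorem isLinearAt_zero_differential {L : LCAd dE} (R : LCAdModule L dM)
    {φ : PreCochain E dM.der k} (h : IsSesquilinear dE.der φ) (h' : ∀ i, IsLinearAt dM i φ) :
    IsLinearAt dM 0 (differential L.lca.toLambdaProduct R.toLambdaProduct k φ) := by
  refine isLinearAt_zero_of_cons fun a e u => ?_
  change diffAct _ k φ _ + diffBracket _ k φ _
    = shiftCoeff dM 0 a (diffAct _ k φ _ + diffBracket _ k φ _)
  have hact0 : ∀ e : E, actTerm R.toLambdaProduct 0 φ (Fin.cons e u)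
      = actCoeff R.toLambdaProduct 0 e (φ u) := by
    intro e
    rw [actTerm_apply]
    congr 2
  have h0 : actTerm R.toLambdaProduct 0 φ (Fin.cons (a • e) u)
      = shiftCoeff dM 0 a (actTerm R.toLambdaProduct 0 φ (Fin.cons e u)) := by
    rw [hact0, hact0, actCoeff_smul_left R.smul_act]
  cases k with
  | zero => simpa [diffAct, diffBracket] using h0
  | succ k =>
    choose x hx using fun j : Fin (k + 1) => Submodule.Quotient.mk_surjective _
      (φ (Fin.cons e fun t => u (j.succAbove t)))
    -- T j is the anchor term of the argument u j. It occurs where u j acts on the shifted value,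
    -- and with the opposite sign in the bracket of a e with u j, so it drops out of the
    -- differential.
    let T : Fin (k + 1) → Coeff dM.der (k + 2) := fun j =>
      Submodule.Quotient.mk (anchorTerm L.anchor j.succ (u j) a (x j))
    have hcons : ∀ (e : E) (j : Fin (k + 1)),
        (fun t => (Fin.cons e u : Fin (k + 2) → E) (j.succ.succAbove t))
          = Fin.cons e fun t => u (j.succAbove t) := by
      intro e j
      funext t
      refine Fin.cases ?_ (fun t => ?_) t <;> simp
    have hact : ∀ j : Fin (k + 1), actTerm R.toLambdaProduct j.succ φ (Fin.cons (a • e) u)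
        = shiftCoeff dM 0 a (actTerm R.toLambdaProduct j.succ φ (Fin.cons e u)) + T j := by
      intro j
      rw [actTerm_apply, actTerm_apply, hcons, hcons, Fin.cons_succ, Fin.cons_succ, (h' 0).cons,
        ← hx, actCoeff_shiftCoeff R.act_smul]
    have hbr0 : ∀ j : Fin (k + 1),
        bracketTerm L.lca.toLambdaProduct 0 j.succ φ (Fin.cons (a • e) u)
          = shiftCoeff dM 0 a (bracketTerm L.lca.toLambdaProduct 0 j.succ φ (Fin.cons e u))
            - T j := by
      intro j
      have e0 : ∀ e : E, bracketTerm L.lca.toLambdaProduct 0 j.succ φ (Fin.cons e u)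
          = insertFirst 0 j.succ φ (L.lca.prod e (u j)) fun t => u (j.succAbove t) := by
        intro e
        rw [bracketTerm_apply]
        congr 1
        funext t
        simp
      rw [e0, e0, h.insertFirst_bracket_smul L (h' 0) j a e (u j) _ (hx j)]
    have hbr : ∀ (j : Fin (k + 1)) (i : Fin k),
        bracketTerm L.lca.toLambdaProduct i.succ j.succ φ (Fin.cons (a • e) u)
          = shiftCoeff dM 0 a
            (bracketTerm L.lca.toLambdaProduct i.succ j.succ φ (Fin.cons e u)) := by
      intro j i
      cases k with
      | zero => exact i.elim0
      | succ k =>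
        have e0 : ∀ e : E, bracketTerm L.lca.toLambdaProduct i.succ j.succ φ (Fin.cons e u)
            = insertFirst i.succ j.succ φ (L.lca.prod (u (j.succAbove i)) (u j))
              (Fin.cons e fun t => u (j.succAbove (i.succAbove t))) := by
          intro e
          rw [bracketTerm_apply]
          congr 1
          · simp
          · funext t
            refine Fin.cases ?_ (fun t => ?_) t <;> simp
        rw [e0, e0, (h' 1).insertFirst_cons]
    have hA : diffAct R.toLambdaProduct (k + 1) φ (Fin.cons (a • e) u)
        = shiftCoeff dM 0 a (diffAct R.toLambdaProduct (k + 1) φ (Fin.cons e u))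
          + ∑ j : Fin (k + 1), (-1 : ℤ) ^ ((j : ℕ) + 1) • T j := by
      simp only [diffAct, sum_apply, smul_apply]
      rw [Fin.sum_univ_succ, Fin.sum_univ_succ (n := k + 1), map_add, map_sum, map_zsmul, h0]
      refine (congrArg _ ?_).trans (add_assoc _ _ _).symm
      rw [← Finset.sum_add_distrib]
      refine Finset.sum_congr rfl fun j _ => ?_
      rw [hact, smul_add, map_zsmul, Fin.val_succ]
    have hB : diffBracket L.lca.toLambdaProduct (k + 1) φ (Fin.cons (a • e) u)
        = shiftCoeff dM 0 a (diffBracket L.lca.toLambdaProduct (k + 1) φ (Fin.cons e u))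
          - ∑ j : Fin (k + 1), (-1 : ℤ) ^ ((j : ℕ) + 1) • T j := by
      have hz : ∀ i : Fin (k + 1), ¬i.castSucc < (0 : Fin (k + 2)) := by simp
      simp only [diffBracket, sum_apply]
      rw [Fin.sum_univ_succ, Fin.sum_univ_succ (n := k + 1)]
      simp only [hz, if_false, zero_apply, Finset.sum_const_zero, zero_add]
      rw [map_sum, ← Finset.sum_sub_distrib]
      refine Finset.sum_congr rfl fun j _ => ?_
      rw [Fin.sum_univ_succ, Fin.sum_univ_succ (n := k), map_add, map_sum, add_sub_right_comm]
      congr 1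
      · rw [if_pos (by simp), smul_apply, smul_apply, hbr0, smul_sub, map_zsmul]
        simp
      · refine Finset.sum_congr rfl fun i _ => ?_
        split_ifs
        · rw [smul_apply, smul_apply, hbr, map_zsmul]
        · simp
    rw [hA, hB, map_add]
    abel

end Linear

/-! ### The complexes and the isomorphism between them. -/

section Main

variable {F : Type u} [Field F] {V : Type v} [CommRing V] [Algebra F V]
variable {M : Type w} [AddCommGroup M] [Module F M] [Module V M] [IsScalarTower F V M]

theorem isLCAdComplex {E : Type v} [AddCommGroup E] [Module F E] [Module V E]
    [IsScalarTower F V E] {D : Derivation F V V} {dE : DiffModule D E} {L : LCAd dE}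
    {dM : DiffModule D M} (R : LCAdModule L dM) : IsLCAdComplex R where
  map_mem _ _ h :=
    have hs := isSkew_differential L.lca R.toLambdaProduct h.1 h.2.2
    ⟨isSesquilinear_differential L.lca R.toLambdaProduct h.1 h.2.2,
      hs.isLinearAt (isLinearAt_zero_differential R h.1 h.2.1), hs⟩
  sq_zero _ _ h := differential_differential L.lca
    (fun a b m => commutatorAt_iff_sub.2 (R.bracket_act a b m)) h.1 h.2.2

variable {P : PVA F V} {dM : DiffModule P.der M}

theorem differential_restrictD {L : LCAd (kaehlerModule P.der)} (hL : IsKaehlerLCAd P L)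
    {ρ : PVAModule P dM} {R : LCAdModule L dM} (hR : IsKaehlerAction ρ R) (k : ℕ)
    (φ : PreCochain Ω[V⁄F] dM.der k) :
    differential P.lca.toLambdaProduct ρ.toLambdaProduct k (restrictD F V (Coeff dM.der k) k φ)
      = restrictD F V (Coeff dM.der (k + 1)) (k + 1)
        (differential L.lca.toLambdaProduct R.toLambdaProduct k φ) :=
  differential_compLinearMap (br := L.lca.toLambdaProduct) (act := R.toLambdaProduct)
    (KaehlerDifferential.D F V : V →ₗ[F] Ω[V⁄F]) hL.2 hR k φ

/-- Every variational cochain is the restriction of a cochain on Ω(V), so both properties are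
carried over from the complex of the algebroid. -/
theorem isPVAComplex {L : LCAd (kaehlerModule P.der)} (hL : IsKaehlerLCAd P L)
    {ρ : PVAModule P dM} {R : LCAdModule L dM} (hR : IsKaehlerAction ρ R) : IsPVAComplex ρ where
  map_mem k γ h := by
    obtain ⟨φ, hφ⟩ := (restrictCochains_bijective dM k).2 ⟨γ, h⟩
    obtain rfl : restrictD F V (Coeff dM.der k) k φ.1 = γ := congrArg Subtype.val hφ
    rw [differential_restrictD hL hR]
    exact (restrictCochains dM (k + 1) ⟨_, (isLCAdComplex R).map_mem k φ.1 φ.2⟩).2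
  sq_zero k γ h := by
    obtain ⟨φ, hφ⟩ := (restrictCochains_bijective dM k).2 ⟨γ, h⟩
    obtain rfl : restrictD F V (Coeff dM.der k) k φ.1 = γ := congrArg Subtype.val hφ
    rw [differential_restrictD hL hR, differential_restrictD hL hR,
      (isLCAdComplex R).sq_zero k φ.1 φ.2, map_zero]

/-- The isomorphism `Γ^k(V, M) ≅ C^k(Ω(V), M)`. -/
def cochainEquiv (dM : DiffModule P.der M) (k : ℕ) :
    pvaCochains dM k ≃ₗ[F] lcadCochains (kaehlerModule P.der) dM k :=
  (LinearEquiv.ofBijective _ (restrictCochains_bijective dM k)).symm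

theorem restrictD_cochainEquiv (k : ℕ) (γ : pvaCochains dM k) :
    restrictD F V (Coeff dM.der k) k (cochainEquiv dM k γ).1 = γ.1 :=
  congrArg Subtype.val ((cochainEquiv dM k).symm_apply_apply γ)

theorem cochainEquiv_apply (k : ℕ) (γ : pvaCochains dM k) (a u : Fin k → V) :
    (cochainEquiv dM k γ).1 (fun i => a i • KaehlerDifferential.D F V (u i))
      = shiftAll dM a (γ.1 u) := by
  rw [← restrictD_cochainEquiv k γ]
  exact apply_smul_of_mem_linMaps (mem_linMaps_of_mem_lcadCochains dM (cochainEquiv dM k γ).2) a _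

/-- The isomorphism of complexes `Γ^•(V, M) ≅ C^•(Ω(V), M)`. -/
def complexIso {L : LCAd (kaehlerModule P.der)} (hL : IsKaehlerLCAd P L)
    {ρ : PVAModule P dM} {R : LCAdModule L dM} (hR : IsKaehlerAction ρ R) :
    pvaComplex ρ (isPVAComplex hL hR) ≅ lcadComplex R (isLCAdComplex R) :=
  HomologicalComplex.Hom.isoOfComponents (fun k => (cochainEquiv dM k).toModuleIso) (by
    rintro i j (rfl : i + 1 = j)
    simp only [pvaComplex, lcadComplex, IsCochainComplex.toComplex, CochainComplex.of_d]
    refine ModuleCat.hom_ext (LinearMap.ext fun γ => Subtype.ext ?_)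
    -- Both sides are linear cochains on Ω(V), so it is enough to compare their restrictions to V,
    -- where Φ is undone and the differentials are intertwined.
    refine linMaps_ext
      (mem_linMaps_of_mem_lcadCochains dM ((isLCAdComplex R).map_mem i _ (cochainEquiv dM i γ).2))
      (mem_linMaps_of_mem_lcadCochains dM (cochainEquiv dM (i + 1) _).2) ?_
    change restrictD F V (Coeff dM.der (i + 1)) (i + 1) (differential L.lca.toLambdaProduct
      R.toLambdaProduct i (cochainEquiv dM i γ).1) = _
    rw [← differential_restrictD hL hR, restrictD_cochainEquiv]
    exact (restrictD_cochainEquiv (dM := dM) (i + 1)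
      ⟨_, (isPVAComplex hL hR).map_mem i γ.1 γ.2⟩).symm)

end Main

end LambdaCalc
end

theorem mainTheorem1 {F : Type*} [Field F] [CharZero F]
    {V : Type*} [CommRing V] [Algebra F V] (P : LambdaCalc.PVA F V)
    {M : Type*} [AddCommGroup M] [Module F M] [Module V M] [IsScalarTower F V M]
    (dM : LambdaCalc.DiffModule P.der M) (ρ : LambdaCalc.PVAModule P dM) :
    -- `Ω(V)` is a Lie conformal algebroid in a unique way
    (∃! L : LambdaCalc.LCAd (LambdaCalc.kaehlerModule P.der), LambdaCalc.IsKaehlerLCAd P L) ∧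
    ∀ L : LambdaCalc.LCAd (LambdaCalc.kaehlerModule P.der), LambdaCalc.IsKaehlerLCAd P L →
      -- `M` is a module over it in a unique way
      (∃! R : LambdaCalc.LCAdModule L dM, LambdaCalc.IsKaehlerAction ρ R) ∧
      ∀ R : LambdaCalc.LCAdModule L dM, LambdaCalc.IsKaehlerAction ρ R →
        -- the cochains form complexes, and `Φ` is an isomorphism between them
        ∃ (hΓ : LambdaCalc.IsPVAComplex ρ) (hC : LambdaCalc.IsLCAdComplex R)
          (Φ : LambdaCalc.pvaComplex ρ hΓ ≅ LambdaCalc.lcadComplex R hC),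
          (∀ (k : ℕ) (γ : LambdaCalc.pvaCochains dM k) (a u : Fin k → V),
            (LambdaCalc.component Φ.hom k γ).1
                (fun i => a i • KaehlerDifferential.D F V (u i))
              = LambdaCalc.shiftAll dM a (γ.1 u)) ∧
          -- hence `Φ` induces isomorphisms of the cohomology spaces
          ∀ k : ℕ, CategoryTheory.IsIso (HomologicalComplex.homologyMap Φ.hom k) := by
  refine ⟨⟨LambdaCalc.kaehlerLCAd P, LambdaCalc.isKaehlerLCAd_kaehlerLCAd,
    fun L hL => hL.eq_kaehlerLCAd⟩, fun L hL => ⟨?_, fun R hR =>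
      ⟨LambdaCalc.isPVAComplex hL hR, LambdaCalc.isLCAdComplex R, LambdaCalc.complexIso hL hR,
        LambdaCalc.cochainEquiv_apply, fun k => inferInstance⟩⟩⟩
  -- By uniqueness L is the structure constructed above, for which the action of Ω(V) on M is at
  -- hand.
  obtain rfl := hL.eq_kaehlerLCAd
  exact ⟨LambdaCalc.kaehlerLCAdModule ρ, LambdaCalc.isKaehlerAction_kaehlerLCAdModule ρ,
    fun R hR => hR.eq_kaehlerLCAdModule⟩
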